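/- Let $\Bbbk$ be a field of characteristic zero and $n\in\mathbb N\cup\{\infty\}$. A Lie $n$-algebra is an $L_\infty$-algebra $(L,\ell)$ over $\Bbbk$ concentrated in degrees $0\le i<n$; equivalently, such a graded space $L$ with a degree $-1$ codifferential $\delta$ on the reduced cofree cocommutative coalgebra $\bar S(\mathbf sL)$, with structure maps $\delta^1_m=(-1)^{m(m-1)/2}\,\mathbf s\circ\ell_m\circ(\mathbf s^{-1})^{\otimes m}\colon S^m(\mathbf sL)\to\mathbf sL$. A morphism $f\colon(L,\ell)\to(L',\ell')$ is a morphism of dg coalgebras $F\colon(\bar S(\mathbf sL),\delta)\to(\bar S(\mathbf sL'),\delta')$; its structure maps $F^1_m\colon S^m(\mathbf sL)\to\mathbf sL'$ correspond to skew-symmetric maps $f_m\colon\Lambda^mL\to L'$ of degree $m-1$. Write $F^p_m\colon S^m(\mathbf sL)\to S^p(\mathbf sL')$ and $\delta^p_m\colon S^m(\mathbf sL)\to S^p(\mathbf sL)$ for the components of $F$ and $\delta$. The morphism $f$ is strict if $f_m=0$ for all $m\ge2$, a weak equivalence if $f_1\colon(L,\ell_1)\to(L',\ell'_1)$ is a quasi-isomorphism,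 and a fibration if $f_1$ is surjective in all positive degrees. For a Lie $n$-algebra $L'$ let $P(L')$ be the graded space with $P(L')_0=0\oplus L'_1$ and $P(L')_i=L'_i\oplus L'_{i+1}$ for $i\ge1$, and put $d(x,y)=(0,x)$, $h(x,y)=(y,0)$ and $\pi(x,y)=x+\ell'_1y$. Let $f=f_1\colon(L,\ell)\to(L',\ell')$ be a strict morphism of Lie $n$-algebras. Then $f$ factors in the category of Lie $n$-algebras as $$(L,\ell)\xrightarrow{\ \jmath\ }(\tilde L,\tilde\ell)\xrightarrow{\ \phi\ }(L',\ell'),\qquad \phi\circ\jmath=f,$$ where $\jmath$ is a weak equivalence and $\phi$ is a fibration. More precisely: 1. $(P(L'),d)$ is a chain complex and $h$, of degree $1$, satisfies $dh+hd=\mathrm{id}$; in particular $P(L')$ is acyclic. 2. $\tilde L=L\oplus P(L')$ with $\tilde\ell_1=\ell_1\oplus d$ and $\tilde\ell_k\bigl((v_1,w_1),\dots,(v_k,w_k)\bigr)=\bigl(\ell_k(v_1,\dots,v_k),0\bigr)$ for $k\ge2$ is a Lie $n$-algebra, and $\jmath(v)=(v,0)$ is a strict morphism and a weak equivalence. 3.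 There is a morphism $\phi\colon\tilde L\to L'$ which is a fibration, with $\phi\circ\jmath=f$, with linear part $\phi_1(v,w)=f_1(v)+\pi(w)$, and whose higher structure maps $\Phi^1_m$ are given recursively for $m\ge2$ by $$\Phi^1_m=-\,c_m\circ(\mathrm{id}_{S(\mathbf sL)}\otimes H),\qquad c_m=\sum_{k=1}^{m-1}\Phi^1_k\tilde\delta^k_m-\sum_{k=2}^m\delta'^1_k\Phi^k_m .$$ Here $S^m(\mathbf s\tilde L)=\bigoplus_{i+k=m}S^i(\mathbf sL)\otimes S^k(\mathbf sP(L'))$, and $H$ is zero on $S^0(\mathbf sP(L'))$ and is, on $S^k(\mathbf sP(L'))$ with $k\ge1$, the symmetrized homotopy $$H_k=\frac1{k!}\sum_{\sigma\in\mathbb S_k}\sigma^{-1}\cdot\bigl(\mathrm{id}^{\otimes(k-1)}\otimes\mathbf sh\mathbf s^{-1}\bigr)\,\sigma\cdot{}.$$ -/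

import Mathlib

/-- `StructMaps 𝕜 V W` is the type of families of multilinear maps `F_m : V^m → W`, one for each
arity `m`.  Such families encode the structure maps of coalgebra morphisms
`S̄(sL) → S̄(sL')` and of coderivations of `S̄(sL)`.  (The suspension `sL` has the same elements
as `L`, with degrees raised by one.) -/
abbrev StructMaps (𝕜 V W : Type*) [Field 𝕜] [AddCommGroup V] [Module 𝕜 V]
    [AddCommGroup W] [Module 𝕜 W] :=
  ∀ m : ℕ, MultilinearMap 𝕜 (fun _ : Fin m => V) W

/-- The Koszul sign of the permutation which sorts the letters `0, …, m-1` stably by the key `c`;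
the letter `i` has degree `d i`. -/
def koszulSign {m : ℕ} {α : Type*} [LinearOrder α] (c : Fin m → α) (d : Fin m → ℤ) : ℤˣ :=
  ∏ i, ∏ j, if i < j ∧ c j < c i then Int.negOnePow (d i * d j) else 1

/-- The subfamily of `x` indexed by `B`, in increasing order. -/
def subTuple {m : ℕ} {α : Type*} (x : Fin m → α) (B : Finset (Fin m)) : Fin B.card → α :=
  fun a => x (B.orderEmbOfFin rfl a)

namespace StructMaps

variable {𝕜 V W X : Type*} [Field 𝕜] [AddCommGroup V] [Module 𝕜 V]
  [AddCommGroup W] [Module 𝕜 W] [AddCommGroup X] [Module 𝕜 X]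

/-- The linear part of a family. -/
def linPart (F : StructMaps 𝕜 V W) : V →ₗ[𝕜] W :=
  (MultilinearMap.ofSubsingleton 𝕜 V W (0 : Fin 1)).symm (F 1)

/-- The family whose arity one component is `g`, all other components being zero. -/
def ofLinear (g : V →ₗ[𝕜] W) : StructMaps 𝕜 V W
  | 1 => MultilinearMap.ofSubsingleton 𝕜 V W (0 : Fin 1) g
  | _ => 0

/-- `F_m = 0` for all `m ≥ 2`. -/
def IsStrict (F : StructMaps 𝕜 V W) : Prop := ∀ m, 2 ≤ m → F m = 0

/-- The value `G^1_k (δ^k_m (x_1, …, x_m))` on homogeneous `x_i` of degree `d i`, where `δ^k_m` is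
the component `S^m(V) → S^k(V)` of the coderivation with structure maps `δ`:
a sum over all `(m-k+1, k-1)`-shuffles, that is, over all subsets `B` with `m-k+1` elements, of
`± G_k (δ_{m-k+1}(x_B), x_{Bᶜ})`. -/
def coderTerm (G : StructMaps 𝕜 V W) (δ : StructMaps 𝕜 V V) (k : ℕ) {m : ℕ}
    (d : Fin m → ℤ) (x : Fin m → V) : W :=
  ∑ B : Finset (Fin m) with Bᶜ.card + 1 = k,
    koszulSign (fun i => if i ∈ B then 0 else 1) d •
      G (Bᶜ.card + 1) (Fin.cons (δ B.card (subTuple x B)) (subTuple x Bᶜ))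

/-- The value `G^1_p (F^p_m (x_1, …, x_m))` on homogeneous `x_i` of degree `d i`, where `F^p_m` is
the component `S^m(V) → S^p(W)` of the coalgebra morphism with structure maps `F`:
`1/p!` times a sum over all `(k_1, …, k_p)`-shuffles with `k_1, …, k_p ≥ 1` and
`k_1 + ⋯ + k_p = m`, that is, over all surjections `c` from `{1, …, m}` to `{1, …, p}`, of
`± G_p (F(x_{c⁻¹(1)}), …, F(x_{c⁻¹(p)}))`. -/
noncomputable def morphTerm (G : StructMaps 𝕜 W X) (F : StructMaps 𝕜 V W) (p : ℕ) {m : ℕ}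
    (d : Fin m → ℤ) (x : Fin m → V) : X :=
  open scoped Classical in
  ((p.factorial : 𝕜)⁻¹) •
    ∑ c : Fin m → Fin p with Function.Surjective c,
      koszulSign c d •
        G p (fun a => F (Finset.univ.filter (fun i => c i = a)).card
          (subTuple x (Finset.univ.filter (fun i => c i = a))))

/-- The structure maps of the composition `G ∘ F`, evaluated on homogeneous `x_i` of degree
`d i`. -/
noncomputable def compVal (G : StructMaps 𝕜 W X) (F : StructMaps 𝕜 V W) {m : ℕ}
    (d : Fin m → ℤ) (x : Fin m → V) : X :=
  ∑ p ∈ Finset.Icc 1 m, morphTerm G F p d x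

end StructMaps

/-- The data underlying an `L_∞`-algebra: a family of subspaces `L_i` (`i ∈ ℤ`) of `V`, and
multilinear maps `δ_m : V^m → V`, the structure maps `S^m(sL) → sL` of a coderivation. They are
related to the skew-symmetric brackets `ℓ_m` by
`δ_m = (-1)^{m(m-1)/2} s ∘ ℓ_m ∘ (s⁻¹)^{⊗ m}`; in particular `δ_1 = ℓ_1` on elements. -/
structure LInfData (𝕜 V : Type*) [Field 𝕜] [AddCommGroup V] [Module 𝕜 V] where
  /-- The degree `i` part `L_i`. -/
  deg : ℤ → Submodule 𝕜 V
  /-- The structure maps. -/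
  δ : StructMaps 𝕜 V V

namespace LInfData

variable {𝕜 V W : Type*} [Field 𝕜] [AddCommGroup V] [Module 𝕜 V]
  [AddCommGroup W] [Module 𝕜 W]

/-- The degree `i` part of the suspension, `(sL)_i = L_{i-1}`. -/
def susp (L : LInfData 𝕜 V) (i : ℤ) : Submodule 𝕜 V := L.deg (i - 1)

/-- `x_i ∈ (sL)_{d i}` for all `i`. -/
def Homog (L : LInfData 𝕜 V) {m : ℕ} (d : Fin m → ℤ) (x : Fin m → V) : Prop :=
  ∀ i, x i ∈ L.susp (d i)

/-- The differential `ℓ_1`. -/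
def diff (L : LInfData 𝕜 V) : V →ₗ[𝕜] V := L.δ.linPart

/-- The maps `F_m : V^m → W`, `m ≥ 1`, are graded symmetric maps `S^m(sL) → sL'` of
degree `e`. -/
structure IsGradedSymmetric (L : LInfData 𝕜 V) (L' : LInfData 𝕜 W) (e : ℤ)
    (F : StructMaps 𝕜 V W) : Prop where
  zero : F 0 = 0
  degree : ∀ (m : ℕ) (d : Fin m → ℤ) (x : Fin m → V), L.Homog d x →
    F m x ∈ L'.susp (∑ i, d i + e)
  symm : ∀ (m : ℕ) (d : Fin m → ℤ) (x : Fin m → V), L.Homog d x →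
    ∀ σ : Equiv.Perm (Fin m), F m x = koszulSign σ.symm d • F m (x ∘ σ)

/-- `L` is an `L_∞`-algebra: `V` is the direct sum of the `L_i`, and the `δ_m` are the structure
maps of a degree `-1` coderivation of `S̄(sL)` whose square is zero. -/
structure IsLInfAlgebra (L : LInfData 𝕜 V) : Prop where
  internal : DirectSum.IsInternal L.deg
  symmetric : L.IsGradedSymmetric L (-1) L.δ
  codiff : ∀ m, 1 ≤ m → ∀ (d : Fin m → ℤ) (x : Fin m → V), L.Homog d x →
    ∑ k ∈ Finset.Icc 1 m, L.δ.coderTerm L.δ k d x = 0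

/-- `L` is a Lie `n`-algebra: an `L_∞`-algebra concentrated in the degrees `i` with
`0 ≤ i < n`. -/
structure IsLieAlgebra (n : ℕ∞) (L : LInfData 𝕜 V) : Prop extends L.IsLInfAlgebra where
  neg : ∀ i : ℤ, i < 0 → L.deg i = ⊥
  top : ∀ i : ℕ, n ≤ (i : ℕ∞) → L.deg (i : ℤ) = ⊥

/-- `F` consists of the structure maps of a (weak) `L_∞`-morphism `L → L'`, that is, of a degree
`0` coalgebra morphism `S̄(sL) → S̄(sL')` which commutes with the codifferentials. -/
structure IsMorphism (L : LInfData 𝕜 V) (L' : LInfData 𝕜 W) (F : StructMaps 𝕜 V W) : Prop where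
  symmetric : L.IsGradedSymmetric L' 0 F
  dgmap : ∀ m, 1 ≤ m → ∀ (d : Fin m → ℤ) (x : Fin m → V), L.Homog d x →
    ∑ k ∈ Finset.Icc 1 m, L'.δ.morphTerm F k d x = ∑ k ∈ Finset.Icc 1 m, F.coderTerm L.δ k d x

/-- The linear part of `F` induces an isomorphism `H_i(L) → H_i(L')` for every `i`; injectivity and
surjectivity on homology are spelled out on cycles. -/
def IsWeakEquivalence (L : LInfData 𝕜 V) (L' : LInfData 𝕜 W) (F : StructMaps 𝕜 V W) : Prop :=
  ∀ i : ℤ,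
    (∀ x ∈ L.deg i, L.diff x = 0 → (∃ y ∈ L'.deg (i + 1), L'.diff y = F.linPart x) →
      ∃ z ∈ L.deg (i + 1), L.diff z = x) ∧
    (∀ y ∈ L'.deg i, L'.diff y = 0 →
      ∃ x ∈ L.deg i, L.diff x = 0 ∧ ∃ w ∈ L'.deg (i + 1), y = F.linPart x + L'.diff w)

/-- The linear part of `F` is surjective in all positive degrees. -/
def IsFibration (L : LInfData 𝕜 V) (L' : LInfData 𝕜 W) (F : StructMaps 𝕜 V W) : Prop :=
  ∀ i : ℤ, 0 < i → ∀ y ∈ L'.deg i, ∃ x ∈ L.deg i, F.linPart x = y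

/-! ### The path complex -/

/-- The sum of the `L_i` with `i ≥ 1`. -/
def posPart (L : LInfData 𝕜 V) : Submodule 𝕜 V := ⨆ i : ℤ, ⨆ _ : 1 ≤ i, L.deg i

/-- The vector space underlying `P(L)`, consisting of pairs `(x, y)`. -/
abbrev Path (L : LInfData 𝕜 V) : Type _ := L.posPart × L.posPart

/-- `P(L)_i`, the pairs `(x, y)` with `x ∈ L_i`, `y ∈ L_{i+1}`. Since `x` and `y` have no component
of degree `≤ 0`, it is `0 ⊕ L_1` for `i = 0`, and zero for `i < 0`. -/
def pathDeg (L : LInfData 𝕜 V) (i : ℤ) : Submodule 𝕜 L.Path :=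
  ((L.deg i).comap L.posPart.subtype).prod ((L.deg (i + 1)).comap L.posPart.subtype)

/-- The differential `(x, y) ↦ (0, x)` of `P(L)`. -/
def pathDiff (L : LInfData 𝕜 V) : L.Path →ₗ[𝕜] L.Path :=
  LinearMap.inr 𝕜 _ _ ∘ₗ LinearMap.fst 𝕜 _ _

/-- The contracting homotopy `(x, y) ↦ (y, 0)` of `P(L)`. -/
def pathHtpy (L : LInfData 𝕜 V) : L.Path →ₗ[𝕜] L.Path :=
  LinearMap.inl 𝕜 _ _ ∘ₗ LinearMap.snd 𝕜 _ _

/-- The map `π : P(L) → L`, `(x, y) ↦ x + ℓ_1 y`. -/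
def pathProj (L : LInfData 𝕜 V) : L.Path →ₗ[𝕜] V :=
  L.posPart.subtype ∘ₗ LinearMap.fst 𝕜 _ _ +
    L.diff ∘ₗ L.posPart.subtype ∘ₗ LinearMap.snd 𝕜 _ _

/-! ### The middle object `L ⊕ P(L')` -/

/-- `L ⊕ P(L')` with differential `ℓ_1 ⊕ d_{P(L')}`, and with the higher brackets of `L` extended
by zero. -/
def middle (L : LInfData 𝕜 V) (L' : LInfData 𝕜 W) : LInfData 𝕜 (V × L'.Path) where
  deg i := (L.deg i).prod (L'.pathDeg i)
  δ m := (LinearMap.inl 𝕜 V L'.Path).compMultilinearMap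
      ((L.δ m).compLinearMap fun _ => LinearMap.fst 𝕜 V L'.Path) +
    StructMaps.ofLinear
      (LinearMap.inr 𝕜 V L'.Path ∘ₗ L'.pathDiff ∘ₗ LinearMap.snd 𝕜 V L'.Path) m

/-- The strict inclusion `ȷ : L → L ⊕ P(L')`. -/
def incl (_L : LInfData 𝕜 V) (L' : LInfData 𝕜 W) : StructMaps 𝕜 V (V × L'.Path) :=
  StructMaps.ofLinear (LinearMap.inl 𝕜 V L'.Path)

/-- The chain map `p_f : L ⊕ P(L') → L'`, `(v, (x, y)) ↦ f_1(v) + x + ℓ'_1 y`. -/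
def linProj (_L : LInfData 𝕜 V) (L' : LInfData 𝕜 W) (F : StructMaps 𝕜 V W) :
    V × L'.Path →ₗ[𝕜] W :=
  F.linPart.coprod L'.pathProj

/-- The obstruction `c_m = ∑_{k=1}^{m-1} Φ_k δ̃^k_m - ∑_{k=2}^m δ'_k Φ^k_m`, evaluated on
homogeneous `x_i` of degree `d i`. It involves only the `Φ_k` with `k < m`. -/
noncomputable def obstruction (L : LInfData 𝕜 V) (L' : LInfData 𝕜 W) (Φ : StructMaps 𝕜 V W) {m : ℕ}
    (d : Fin m → ℤ) (x : Fin m → V) : W :=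
  ∑ k ∈ Finset.Icc 1 (m - 1), Φ.coderTerm L.δ k d x -
    ∑ k ∈ Finset.Icc 2 m, L'.δ.morphTerm Φ k d x

/-- The component of `x_1 ∨ ⋯ ∨ x_m ∈ S^m(sL ⊕ sP(L'))` in which the letters in the places of `T`
are projected to `P(L')`, and those in the other places to `L`. -/
def mixed (_L : LInfData 𝕜 V) (L' : LInfData 𝕜 W) {m : ℕ} (T : Finset (Fin m))
    (x : Fin m → V × L'.Path) : Fin m → V × L'.Path :=
  fun i => if i ∈ T then (0, (x i).2) else ((x i).1, 0)

/-- The value of `c ∘ (id_{S(sL)} ⊗ H)` on homogeneous `x_i ∈ sL ⊕ sP(L')` of degree `d i`, where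
`H` is zero on `S^0` and, for `k ≥ 1`, is the symmetrization
`(1/k!) ∑_{σ ∈ 𝕊_k} σ⁻¹ (id^{⊗(k-1)} ⊗ h) σ = (1/k) ∑_{i=1}^k id^{⊗(i-1)} ⊗ h ⊗ id^{⊗(k-i)}`
of the homotopy `h` on `S^k(sP(L'))`. Since `h` has degree one, it raises the degree of the `i`-th
letter by one and picks up the sign `(-1)^{d_1 + ⋯ + d_{i-1}}`. -/
noncomputable def compHtpy (L : LInfData 𝕜 V) (L' : LInfData 𝕜 W) {m : ℕ}
    (c : (Fin m → ℤ) → (Fin m → V × L'.Path) → W)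
    (d : Fin m → ℤ) (x : Fin m → V × L'.Path) : W :=
  ∑ T : Finset (Fin m), ((T.card : 𝕜)⁻¹) •
    ∑ i ∈ T, Int.negOnePow (∑ j ∈ Finset.Iio i, d j) •
      c (Function.update d i (d i + 1))
        (Function.update (L.mixed L' T x) i (0, L'.pathHtpy (x i).2))

end LInfData

/-!
The higher structure maps of `φ` are built one arity at a time. Once the maps of arity `< m` commute
with the codifferentials in all arities `< m`, the failure in arity `m` of the family truncated
below `m` is `-c_m` (`defect_eq_sub_obstruction`), where `c_m` is the obstruction. Linearizing
`δ' (δ' F - F δ) + (δ' F - F δ) δ = 0` in this lowest arity shows that `c_m` is a cocycle for the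
differential induced by `δ'_1` and `δ̃_1` (`LInfData.linearized_defect`). The homotopy `H` contracts
the part of `S^m(sL ⊕ sP(L'))` with at least one letter from `P(L')` (`LInfData.compHtpy_homotopy`),
and on the remaining part, `S^m(sL)`, the obstruction is that of the strict morphism `f`,
hence zero.
So `Φ_m = -c_m H` makes the defect vanish in arity `m`
(`LInfData.IsRecursiveLift.defect_eq_zero`).

The signs are handled by passing to an even situation. Let `A` be a supercommutative algebra, and
extend a multilinear map `G` to `A ⊗ V` *without signs*, by
`(a_1 ⊗ x_1, …, a_p ⊗ x_p) ↦ a_1 ⋯ a_p ⊗ G (x_1, …, x_p)`. On elements of total degree zero, graded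
symmetric maps become symmetric, and the Koszul signs in the composites disappear
(`StructMaps.morphTerm_tensorExt`, `StructMaps.coderTerm_tensorExt`). Conversely, an identity in
`A ⊗ V` gives back the graded one when `A` is a Grassmann algebra with enough generators
(`exists_grassmann`, `eq_zero_of_tmul_eq_zero`).

In the even situation a family `F` is a formal function `F(u) = ∑ F_p(u, …, u) / p!`: morphisms
compose as functions (`StructMaps.eval_eval`), and a coderivation `δ` acts as the infinitesimal
change of variables `u ↦ u + θ δ(u)` with an odd parameter `θ` (`LInfData.smul_sum_coderTerm`).
All functions are evaluated at multiples of a central nilpotent `t`, so that the sums are finite.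
The cocycle identity then follows by comparing two successive changes of variables, with parameters
`τ` and `σ`, with the single one with parameter `τ + σ` (`LInfData.smul_linearized_defect`), and by
polarizing the result.
-/

open scoped TensorProduct

/-! ### Koszul signs and supercommutative algebras -/

/-- A family of subspaces `𝒜 d`, `d ∈ ℤ`, of an algebra which is closed under products and whose
elements commute up to the Koszul sign.  No directness of the family is required, so that it may
be periodic. -/
structure IsSupercommutative {𝕜 A : Type*} [CommRing 𝕜] [Ring A] [Algebra 𝕜 A]
    (𝒜 : ℤ → Submodule 𝕜 A) : Prop where
  one_mem : 1 ∈ 𝒜 0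
  mul_mem : ∀ {i j a b}, a ∈ 𝒜 i → b ∈ 𝒜 j → a * b ∈ 𝒜 (i + j)
  comm : ∀ {i j a b}, a ∈ 𝒜 i → b ∈ 𝒜 j → a * b = Int.negOnePow (i * j) • (b * a)

theorem ofFn_subTuple {α : Type*} {m : ℕ} (x : Fin m → α) (B : Finset (Fin m)) :
    List.ofFn (subTuple x B) = ((List.finRange m).filter (· ∈ B)).map x := by
  have h : (List.finRange B.card).map (B.orderEmbOfFin rfl) =
      (List.finRange m).filter (· ∈ B) := by
    rw [Finset.listMap_orderEmbOfFin_finRange]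
    apply List.Perm.eq_of_pairwise' (r := (· ≤ ·))
    · exact Finset.pairwise_sort _ _
    · exact ((List.pairwise_lt_finRange m).imp le_of_lt).filter _
    · rw [List.perm_ext_iff_of_nodup (Finset.sort_nodup _ _) ((List.nodup_finRange m).filter _)]
      simp
  rw [← h, List.ofFn_eq_map, List.map_map]
  rfl

section

variable {𝕜 A : Type*} [CommRing 𝕜] [Ring A] [Algebra 𝕜 A] {𝒜 : ℤ → Submodule 𝕜 A}

theorem units_smul_mem {M : Type*} [AddCommGroup M] [Module 𝕜 M] (p : Submodule 𝕜 M) (u : ℤˣ)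
    {x : M} (hx : x ∈ p) : u • x ∈ p := by
  rcases Int.units_eq_one_or u with rfl | rfl
  · simpa using hx
  · simpa [Units.smul_def] using hx

namespace IsSupercommutative

theorem map_prod_mem (h𝒜 : IsSupercommutative 𝒜) {ι : Type*} (l : List ι) {a : ι → A} {d : ι → ℤ}
    (h : ∀ i, a i ∈ 𝒜 (d i)) : (l.map a).prod ∈ 𝒜 (l.map d).sum := by
  induction l with
  | nil => simpa using h𝒜.one_mem
  | cons i l ih => simpa using h𝒜.mul_mem (h i) ih

theorem prod_ofFn_mem (h𝒜 : IsSupercommutative 𝒜) {m : ℕ} {a : Fin m → A} {d : Fin m → ℤ}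
    (h : ∀ i, a i ∈ 𝒜 (d i)) : (List.ofFn a).prod ∈ 𝒜 (∑ i, d i) := by
  rw [List.ofFn_eq_map, ← List.sum_ofFn, List.ofFn_eq_map]
  exact h𝒜.map_prod_mem _ h

/-- Moving a factor `a₀`, which belongs to the block `k₀`, from the left end of a product of blocks
into its block. -/
theorem mul_prod_blocks (h𝒜 : IsSupercommutative 𝒜) {α : Type*} [LinearOrder α] {K : List α}
    (hK : K.Pairwise (· < ·)) {k₀ : α} (hk₀ : k₀ ∈ K) {a₀ : A} {d₀ : ℤ} (ha₀ : a₀ ∈ 𝒜 d₀)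
    {P : α → A} {D : α → ℤ} (hP : ∀ k, P k ∈ 𝒜 (D k)) :
    a₀ * (K.map P).prod =
      Int.negOnePow (d₀ * (K.map fun k => if k < k₀ then D k else 0).sum) •
        (K.map fun k => (if k₀ = k then a₀ else 1) * P k).prod := by
  induction K with
  | nil => simp at hk₀
  | cons k K ih =>
    rw [List.pairwise_cons] at hK
    by_cases hk : k₀ = k
    · subst hk
      have h1 : (K.map fun k => (if k₀ = k then a₀ else 1) * P k) = K.map P :=
        List.map_congr_left fun j hj => by simp [(hK.1 j hj).ne]
      have h2 : (K.map fun k => if k < k₀ then D k else 0) = K.map fun _ => 0 :=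
        List.map_congr_left fun j hj => by simp [(hK.1 j hj).not_gt]
      rw [List.map_cons, List.map_cons, List.map_cons, h1, h2]
      simp [mul_assoc]
    · have hk₀' : k₀ ∈ K := by simpa [hk] using hk₀
      simp only [List.map_cons, List.prod_cons, List.sum_cons, if_neg hk, one_mul,
        if_pos (hK.1 k₀ hk₀')]
      rw [← mul_assoc, h𝒜.comm ha₀ (hP k), smul_mul_assoc, mul_assoc, ih hK.2 hk₀', mul_smul_comm,
        smul_smul, ← Int.negOnePow_add, mul_add]

theorem sum_map_ite_lt {α : Type*} [LinearOrder α] {K : List α} (hK : K.Pairwise (· < ·))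
    {m : ℕ} (c : Fin m → α) (hc : ∀ i, c i ∈ K) (d : Fin m → ℤ) (k₀ : α) :
    (K.map fun k => if k < k₀ then ((((List.finRange m).filter (c · = k)).map d).sum) else 0).sum =
      ∑ i, if c i < k₀ then d i else 0 := by
  have h : ∀ k, (((List.finRange m).filter (c · = k)).map d).sum =
      ∑ i, if c i = k then d i else 0 := by
    intro k
    rw [← List.sum_ofFn, List.ofFn_eq_map]
    induction List.finRange m with
    | nil => simp
    | cons i l ih => by_cases hi : c i = k <;> simp [hi, ih]
  have hn : K.Nodup := hK.imp ne_of_lt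
  rw [← List.sum_toFinset _ hn]
  have h' : ∀ k, (if k < k₀ then (((List.finRange m).filter (c · = k)).map d).sum else 0) =
      ∑ i, if c i = k then (if k < k₀ then d i else 0) else 0 := by
    intro k
    rw [h]
    split_ifs <;> simp
  simp only [h']
  rw [Finset.sum_comm]
  exact Finset.sum_congr rfl fun i _ => by simp [Finset.sum_ite_eq, hc]

/-- The Koszul sign is the sign by which a product in a supercommutative algebra changes when its
factors are sorted stably by the key `c`, whose values are listed increasingly in `K`. -/
theorem prod_ofFn_eq_koszulSign (h𝒜 : IsSupercommutative 𝒜) {α : Type*} [LinearOrder α]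
    {K : List α} (hK : K.Pairwise (· < ·)) {m : ℕ} (c : Fin m → α) (hc : ∀ i, c i ∈ K)
    {d : Fin m → ℤ} {a : Fin m → A} (ha : ∀ i, a i ∈ 𝒜 (d i)) :
    (List.ofFn a).prod = koszulSign c d •
      (K.map fun k => (List.ofFn (subTuple a (Finset.univ.filter (c · = k)))).prod).prod := by
  simp only [ofFn_subTuple, Finset.mem_filter, Finset.mem_univ, true_and]
  -- sort the factors `a 1, a 2, …` first, and then move `a 0` to the front of its block
  induction m with
  | zero => simp [koszulSign]
  | succ m ih =>
    have h1 : koszulSign c d =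
        Int.negOnePow (d 0 * ∑ i : Fin m, if c i.succ < c 0 then d i.succ else 0) *
          koszulSign (c ∘ Fin.succ) (d ∘ Fin.succ) := by
      simp only [koszulSign, Fin.prod_univ_succ, Fin.not_lt_zero, false_and, if_false, one_mul,
        Fin.succ_pos, true_and, Fin.succ_lt_succ_iff, Function.comp]
      congr 1
      rw [Finset.mul_sum]
      induction (Finset.univ : Finset (Fin m)) using Finset.induction_on with
      | empty => simp
      | insert i s hi ih =>
        rw [Finset.prod_insert hi, Finset.sum_insert hi, Int.negOnePow_add, ih]
        congr 1
        split_ifs <;> simp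
    have h2 : ∀ k, (((List.finRange (m + 1)).filter (c · = k)).map a).prod =
        (if c 0 = k then a 0 else 1) *
          ((((List.finRange m).filter ((c ∘ Fin.succ) · = k)).map (a ∘ Fin.succ)).prod) := by
      intro k
      rw [List.finRange_succ, List.filter_cons, List.filter_map]
      by_cases h : c 0 = k <;> simp [h, Function.comp_def]
    simp only [h2]
    rw [List.ofFn_succ, List.prod_cons]
    have ih' := ih (c ∘ Fin.succ) (fun i => hc _) (d := d ∘ Fin.succ) (a := a ∘ Fin.succ)
      (fun i => ha _)
    rw [show (List.ofFn fun i => a (Fin.succ i)) = List.ofFn (a ∘ Fin.succ) from rfl, ih',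
      mul_smul_comm, h𝒜.mul_prod_blocks hK (hc 0) (ha 0)
        (P := fun k => (((List.finRange m).filter ((c ∘ Fin.succ) · = k)).map (a ∘ Fin.succ)).prod)
        (D := fun k => (((List.finRange m).filter ((c ∘ Fin.succ) · = k)).map (d ∘ Fin.succ)).sum)
        (fun k => h𝒜.map_prod_mem _ fun i => ha _), smul_smul,
      sum_map_ite_lt hK (c ∘ Fin.succ) (fun i => hc _), h1, mul_comm]
    rfl

/-- Permuting the factors of a product. -/
theorem prod_ofFn_comp_perm (h𝒜 : IsSupercommutative 𝒜) {m : ℕ} {d : Fin m → ℤ} {a : Fin m → A}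
    (ha : ∀ i, a i ∈ 𝒜 (d i)) (σ : Equiv.Perm (Fin m)) :
    (List.ofFn a).prod = koszulSign σ.symm d • (List.ofFn (a ∘ σ)).prod := by
  rw [h𝒜.prod_ofFn_eq_koszulSign (List.pairwise_lt_finRange m) σ.symm (by simp) ha]
  congr 2
  rw [List.ofFn_eq_map]
  refine List.map_congr_left fun k _ => ?_
  have : (List.finRange m).filter (fun i => σ.symm i = k) = [σ k] := by
    rw [← List.perm_singleton,
      List.perm_ext_iff_of_nodup ((List.nodup_finRange m).filter _) (List.nodup_singleton _)]
    simp [Equiv.symm_apply_eq]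
  simp [ofFn_subTuple, this]

end IsSupercommutative
end

/-! ### Multilinear maps -/

namespace MultilinearMap

section

variable {𝕜 E E' : Type*} [CommRing 𝕜] [AddCommGroup E] [Module 𝕜 E] [AddCommGroup E'] [Module 𝕜 E']
  {p : ℕ}

/-- Two multilinear maps which agree on the tuples of elements of a set agree on the tuples of
elements of its span. -/
theorem eq_of_eqOn_span {f g : MultilinearMap 𝕜 (fun _ : Fin p => E) E'} {S : Set E}
    (h : ∀ z : Fin p → E, (∀ i, z i ∈ S) → f z = g z) (u : Fin p → E)
    (hu : ∀ i, u i ∈ Submodule.span 𝕜 S) : f u = g u := by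
  have key : ∀ s : Finset (Fin p), ∀ u : Fin p → E, (∀ i ∈ s, u i ∈ Submodule.span 𝕜 S) →
      (∀ i ∉ s, u i ∈ S) → f u = g u := by
    intro s
    induction s using Finset.induction_on with
    | empty => exact fun u _ hu => h u fun i => hu i (by simp)
    | insert i s hi ih =>
      intro u hu hu'
      have : ∀ x ∈ Submodule.span 𝕜 S, f (Function.update u i x) = g (Function.update u i x) := by
        intro x hx
        induction hx using Submodule.span_induction with
        | mem x hx =>
          refine ih _ (fun j hj => ?_) fun j hj => ?_
          · have : j ≠ i := fun h => hi (h ▸ hj)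
            simpa [Function.update_of_ne this] using hu j (by simp [hj])
          · by_cases hji : j = i
            · subst hji; simpa using hx
            · simpa [Function.update_of_ne hji] using hu' j (by simp [hj, hji])
        | zero => simp
        | add x y _ _ hx hy => simp [hx, hy]
        | smul c x _ hx => simp [hx]
      simpa using this (u i) (hu i (by simp))
  exact key Finset.univ u (fun i _ => hu i) (by simp)

/-- The expansion of `f (u + w)` to first order. -/
theorem map_add_of_sq_zero (f : MultilinearMap 𝕜 (fun _ : Fin p => E) E') (u w : Fin p → E)
    (h : ∀ i j, i ≠ j → ∀ z : Fin p → E, z i = w i → z j = w j → f z = 0) :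
    f (u + w) = f u + ∑ i, f (Function.update u i (w i)) := by
  rw [add_comm u w, f.map_add_univ]
  rw [← Finset.sum_filter_add_sum_filter_not _ (fun s : Finset (Fin p) => s.card ≤ 1)]
  rw [Finset.sum_eq_zero (s := Finset.univ.filter fun s : Finset (Fin p) => ¬ s.card ≤ 1), add_zero]
  · have : (Finset.univ.filter fun s : Finset (Fin p) => s.card ≤ 1) =
        insert ∅ (Finset.univ.image fun i : Fin p => ({i} : Finset (Fin p))) := by
      ext s
      simp [Nat.le_one_iff_eq_zero_or_eq_one, Finset.card_eq_one, eq_comm]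
    rw [this, Finset.sum_insert (by simp), Finset.sum_image fun i _ j _ h => by simpa using h]
    simp [Finset.piecewise_singleton]
  · intro s hs
    simp only [Finset.mem_filter, Finset.mem_univ, true_and, not_le] at hs
    obtain ⟨i, hi, j, hj, hij⟩ := Finset.one_lt_card.1 hs
    exact h i j hij _ (by simp [hi]) (by simp [hj])

/-- A multilinear map does not change if its arguments are changed by elements on which it
vanishes. -/
theorem map_add_of_zero (f : MultilinearMap 𝕜 (fun _ : Fin p => E) E') (u w : Fin p → E)
    (h : ∀ i, ∀ (s : Finset (Fin p)), i ∈ s → f (s.piecewise w u) = 0) : f (u + w) = f u := by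
  rw [add_comm u w, f.map_add_univ, Finset.sum_eq_single ∅]
  · simp
  · intro s _ hs
    obtain ⟨i, hi⟩ := Finset.nonempty_iff_ne_empty.2 hs
    exact h i s hi
  · simp

/-- Polarization: a multilinear map which vanishes on the diagonal of a submodule has zero
symmetrization there. -/
theorem sum_perm_eq_zero (f : MultilinearMap 𝕜 (fun _ : Fin p => E) E') (M : Submodule 𝕜 E)
    (h : ∀ v ∈ M, f (fun _ => v) = 0) (v : Fin p → E) (hv : ∀ i, v i ∈ M) :
    ∑ σ : Equiv.Perm (Fin p), f (v ∘ σ) = 0 := by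
  -- inclusion-exclusion over the set `t` of omitted indices: in the expansion of the alternating
  -- sum, the coefficient of `f (v ∘ r)` vanishes unless `r` is surjective
  have h0 : ∑ t : Finset (Fin p), (-1 : ℤ) ^ t.card • f (fun _ => ∑ i ∈ tᶜ, v i) = 0 :=
    Finset.sum_eq_zero fun t _ => by rw [h _ (M.sum_mem fun i _ => hv i), smul_zero]
  have h1 : ∀ t : Finset (Fin p), f (fun _ => ∑ i ∈ tᶜ, v i) =
      ∑ r : Fin p → Fin p, if t ⊆ (Finset.univ.image r)ᶜ then f (v ∘ r) else 0 := by
    intro t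
    rw [f.map_sum_finset (fun _ => v) fun _ => tᶜ, ← Finset.sum_filter]
    refine Finset.sum_congr ?_ fun _ _ => rfl
    ext r
    simp only [Fintype.mem_piFinset, Finset.mem_compl, Finset.mem_filter, Finset.mem_univ, true_and,
      Finset.subset_iff, Finset.mem_image, not_exists]
    exact ⟨fun h x hx i hi => h i (hi ▸ hx), fun h i hi => h hi i rfl⟩
  simp only [h1, Finset.smul_sum] at h0
  rw [Finset.sum_comm] at h0
  have h2 : ∀ r : Fin p → Fin p, ∑ t : Finset (Fin p), (-1 : ℤ) ^ t.card •
      (if t ⊆ (Finset.univ.image r)ᶜ then f (v ∘ r) else 0) =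
      if Function.Surjective r then f (v ∘ r) else 0 := by
    intro r
    have : ∀ t : Finset (Fin p), (-1 : ℤ) ^ t.card •
      (if t ⊆ (Finset.univ.image r)ᶜ then f (v ∘ r) else 0) =
      if t ∈ ((Finset.univ.image r)ᶜ).powerset then (-1 : ℤ) ^ t.card • f (v ∘ r) else 0 := by
      intro t; simp [Finset.mem_powerset]
    simp only [this]
    rw [Finset.sum_ite_mem, Finset.univ_inter, ← Finset.sum_smul,
      Finset.sum_powerset_neg_one_pow_card]
    have : ((Finset.univ.image r)ᶜ = ∅) ↔ Function.Surjective r := by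
      rw [Finset.compl_eq_empty_iff, Finset.eq_univ_iff_forall]
      simp [Function.Surjective]
    simp [this]
  simp only [h2] at h0
  rw [← Finset.sum_filter] at h0
  rw [← h0]
  refine Finset.sum_bij (fun σ _ => (σ : Fin p → Fin p)) (by simp [Equiv.surjective]) ?_ ?_ ?_
  · intro σ _ τ _ h; exact DFunLike.coe_injective h
  · intro r hr
    have hr' : Function.Bijective r :=
      Finite.surjective_iff_bijective.1 (by simpa using hr)
    exact ⟨Equiv.ofBijective r hr', by simp, rfl⟩
  · intro σ _; rfl

/-- A family of multilinear maps `T d`, one for each choice `d` of degrees, extends from the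
homogeneous tuples to a multilinear map on a graded module. -/
theorem exists_eq_on_homogeneous {𝒱 : ℤ → Submodule 𝕜 E} (h𝒱 : DirectSum.IsInternal 𝒱)
    (T : (Fin p → ℤ) → MultilinearMap 𝕜 (fun _ : Fin p => E) E') :
    ∃ f : MultilinearMap 𝕜 (fun _ : Fin p => E) E',
      ∀ (d : Fin p → ℤ) (x : Fin p → E), (∀ i, x i ∈ 𝒱 (d i)) → f x = T d x := by
  let e : (Π₀ i, 𝒱 i) ≃ₗ[𝕜] E := LinearEquiv.ofBijective (DirectSum.coeLinearMap 𝒱) h𝒱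
  have he : ∀ i (x : 𝒱 i), e (DFinsupp.single i x) = x := fun i x =>
    DirectSum.coeLinearMap_lof 𝒱 i x
  let g := fromDFinsuppEquiv (fun _ : Fin p => ℤ) 𝕜 (M := fun _ i => 𝒱 i) (N := E')
    fun d => (T d).compLinearMap fun i => (𝒱 (d i)).subtype
  refine ⟨g.compLinearMap fun _ => e.symm.toLinearMap, fun d x hx => ?_⟩
  have : (fun i => e.symm (x i)) = fun i => DFinsupp.single (d i) (⟨x i, hx i⟩ : 𝒱 (d i)) := by
    ext1 i
    rw [LinearEquiv.symm_apply_eq, he]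
  simp only [compLinearMap_apply, LinearEquiv.coe_coe, this, g]
  rw [fromDFinsuppEquiv_single]
  rfl

end

end MultilinearMap

section

variable {α : Type*} {m : ℕ}

theorem subTuple_update_of_notMem (x : Fin m → α) {B : Finset (Fin m)} {i : Fin m} (hi : i ∉ B)
    (v : α) : subTuple (Function.update x i v) B = subTuple x B := by
  ext a
  refine Function.update_of_ne (fun h => hi ?_) _ _
  rw [← h]
  exact B.orderEmbOfFin_mem rfl a

theorem exists_subTuple_update_of_mem {B : Finset (Fin m)} {i : Fin m} (hi : i ∈ B) :
    ∃ j, ∀ (x : Fin m → α) (v : α),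
      subTuple (Function.update x i v) B = Function.update (subTuple x B) j v := by
  have : i ∈ Set.range (B.orderEmbOfFin rfl) := by simpa using hi
  obtain ⟨j, rfl⟩ := this
  refine ⟨j, fun x v => ?_⟩
  ext a
  by_cases h : a = j
  · subst h; simp [subTuple]
  · simp [subTuple, h]

theorem sum_subTuple {M : Type*} [AddCommMonoid M] (d : Fin m → M) (B : Finset (Fin m)) :
    ∑ j, subTuple d B j = ∑ i ∈ B, d i := by
  conv_rhs => rw [← B.map_orderEmbOfFin_univ rfl, Finset.sum_map]
  rfl

end

namespace StructMaps

variable {𝕜 V W X : Type*} [Field 𝕜] [AddCommGroup V] [Module 𝕜 V]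
  [AddCommGroup W] [Module 𝕜 W] [AddCommGroup X] [Module 𝕜 X]

/-- A summand of `coderTerm`, without its sign. -/
def coderSummand (G : StructMaps 𝕜 V W) (δ : StructMaps 𝕜 V V) {m : ℕ} (B : Finset (Fin m)) :
    MultilinearMap 𝕜 (fun _ : Fin m => V) W :=
  MultilinearMap.mk'
    (fun x => G (Bᶜ.card + 1) (Fin.cons (δ B.card (subTuple x B)) (subTuple x Bᶜ)))
    (by
      intro x i v w
      by_cases hi : i ∈ B
      · obtain ⟨j, hj⟩ := exists_subTuple_update_of_mem (α := V) hi
        simp only [hj, subTuple_update_of_notMem x (show i ∉ Bᶜ by simpa using hi),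
          MultilinearMap.map_update_add, MultilinearMap.cons_add]
      · obtain ⟨j, hj⟩ := exists_subTuple_update_of_mem (α := V) (show i ∈ Bᶜ by simpa using hi)
        simp only [hj, subTuple_update_of_notMem x hi, Fin.cons_update,
          MultilinearMap.map_update_add])
    (by
      intro x i c v
      by_cases hi : i ∈ B
      · obtain ⟨j, hj⟩ := exists_subTuple_update_of_mem (α := V) hi
        simp only [hj, subTuple_update_of_notMem x (show i ∉ Bᶜ by simpa using hi),
          MultilinearMap.map_update_smul, MultilinearMap.cons_smul]
      · obtain ⟨j, hj⟩ := exists_subTuple_update_of_mem (α := V) (show i ∈ Bᶜ by simpa using hi)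
        simp only [hj, subTuple_update_of_notMem x hi, Fin.cons_update,
          MultilinearMap.map_update_smul])

theorem exists_blocks_update (F : StructMaps 𝕜 V W) {p m : ℕ} (c : Fin m → Fin p) (x : Fin m → V)
    (i : Fin m) : ∃ g : V →ₗ[𝕜] W, ∀ v,
      (fun a => F (Finset.univ.filter (fun i => c i = a)).card
        (subTuple (Function.update x i v) (Finset.univ.filter (fun i => c i = a)))) =
      Function.update (fun a => F (Finset.univ.filter (fun i => c i = a)).card
        (subTuple x (Finset.univ.filter (fun i => c i = a)))) (c i) (g v) := by
  obtain ⟨j, hj⟩ := exists_subTuple_update_of_mem (α := V)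
    (show i ∈ Finset.univ.filter (fun k => c k = c i) by simp)
  refine ⟨(F _).toLinearMap (subTuple x (Finset.univ.filter (fun k => c k = c i))) j, fun v => ?_⟩
  ext a
  by_cases ha : a = c i
  · subst ha; simp [hj]
  · rw [Function.update_of_ne ha, subTuple_update_of_notMem]
    simpa using fun h => ha h.symm

/-- A summand of `morphTerm`, without its sign. -/
def morphSummand (G : StructMaps 𝕜 W X) (F : StructMaps 𝕜 V W) {p m : ℕ} (c : Fin m → Fin p) :
    MultilinearMap 𝕜 (fun _ : Fin m => V) X :=
  MultilinearMap.mk'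
    (fun x => G p (fun a => F (Finset.univ.filter (fun i => c i = a)).card
          (subTuple x (Finset.univ.filter (fun i => c i = a)))))
    (by
      intro x i v w
      obtain ⟨g, hg⟩ := exists_blocks_update F c x i
      simp only [hg, map_add, MultilinearMap.map_update_add])
    (by
      intro x i k v
      obtain ⟨g, hg⟩ := exists_blocks_update F c x i
      simp only [hg, map_smul, MultilinearMap.map_update_smul])

/-- `coderTerm` as a multilinear map, for fixed degrees. -/
def coderMap (G : StructMaps 𝕜 V W) (δ : StructMaps 𝕜 V V) (k : ℕ) {m : ℕ} (d : Fin m → ℤ) :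
    MultilinearMap 𝕜 (fun _ : Fin m => V) W :=
  ∑ B : Finset (Fin m) with Bᶜ.card + 1 = k,
    koszulSign (fun i => if i ∈ B then 0 else 1) d • coderSummand G δ B

theorem coderMap_apply (G : StructMaps 𝕜 V W) (δ : StructMaps 𝕜 V V) (k : ℕ) {m : ℕ}
    (d : Fin m → ℤ) (x : Fin m → V) : coderMap G δ k d x = coderTerm G δ k d x := by
  simp only [coderMap, sum_apply, coderTerm]
  rfl

open scoped Classical in
/-- `morphTerm` as a multilinear map, for fixed degrees. -/
noncomputable def morphMap (G : StructMaps 𝕜 W X) (F : StructMaps 𝕜 V W) (p : ℕ) {m : ℕ}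
    (d : Fin m → ℤ) : MultilinearMap 𝕜 (fun _ : Fin m => V) X :=
  ((p.factorial : 𝕜)⁻¹) • ∑ c : Fin m → Fin p with Function.Surjective c,
    koszulSign c d • morphSummand G F c

theorem morphMap_apply (G : StructMaps 𝕜 W X) (F : StructMaps 𝕜 V W) (p : ℕ) {m : ℕ}
    (d : Fin m → ℤ) (x : Fin m → V) : morphMap G F p d x = morphTerm G F p d x := by
  simp only [morphMap, smul_apply, sum_apply, morphTerm]
  rfl

end StructMaps

/-! ### Extension of scalars -/

namespace MultilinearMap

section

variable {𝕜 V W : Type*} [Field 𝕜] [AddCommGroup V] [Module 𝕜 V]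
  [AddCommGroup W] [Module 𝕜 W] (A : Type*) [Ring A] [Algebra 𝕜 A]

/-- The extension of a multilinear map `G` to `A ⊗ V`, determined by
`a₁ ⊗ x₁, …, a_p ⊗ x_p ↦ a₁ ⋯ a_p ⊗ G (x₁, …, x_p)`.  No Koszul signs occur in this formula: if
`aᵢ` and `xᵢ` have the same degree, then the signs which arise from permuting the `aᵢ` and the `xᵢ`
cancel. -/
noncomputable def tensorExtₗ : (p : ℕ) → MultilinearMap 𝕜 (fun _ : Fin p => V) W →ₗ[𝕜]
    MultilinearMap 𝕜 (fun _ : Fin p => A ⊗[𝕜] V) (A ⊗[𝕜] W)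
  | 0 =>
    { toFun := fun G => constOfIsEmpty 𝕜 _ ((1 : A) ⊗ₜ[𝕜] G 0)
      map_add' := fun G H => by ext; simp [TensorProduct.tmul_add]
      map_smul' := fun c G => by ext; simp }
  | p + 1 =>
    { toFun := fun G => LinearMap.uncurryLeft (M := fun _ : Fin (p + 1) => A ⊗[𝕜] V)
        (TensorProduct.lift (LinearMap.mk₂ 𝕜
          (fun (a : A) (x : V) => (Algebra.lsmul 𝕜 𝕜 (A ⊗[𝕜] W) a).compMultilinearMap
            (tensorExtₗ p (G.curryLeft x)))
          (fun a b x => by ext z; simp)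
          (fun c a x => by ext z; simp)
          (fun a x y => by ext z; simp)
          (fun c a x => by ext z; simp [smul_comm c a])))
      map_add' := fun G H => by
        ext z
        simp only [LinearMap.uncurryLeft_apply, add_apply]
        generalize z 0 = w
        induction w using TensorProduct.induction_on with
        | zero => simp
        | tmul a x => simp [show (G + H).curryLeft x = G.curryLeft x + H.curryLeft x from rfl]
        | add v w hv hw => simp only [map_add, add_apply, hv, hw]; abel
      map_smul' := fun c G => by
        ext z
        simp only [LinearMap.uncurryLeft_apply, smul_apply, RingHom.id_apply]
        generalize z 0 = w
        induction w using TensorProduct.induction_on with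
        | zero => simp
        | tmul a x => simp [show (c • G).curryLeft x = c • G.curryLeft x from rfl, smul_comm c a]
        | add v w hv hw => simp only [map_add, add_apply, hv, hw, smul_add] }

/-- The extension of a multilinear map to `A ⊗ V`, see `tensorExtₗ`. -/
noncomputable def tensorExt {p : ℕ} (G : MultilinearMap 𝕜 (fun _ : Fin p => V) W) :
    MultilinearMap 𝕜 (fun _ : Fin p => A ⊗[𝕜] V) (A ⊗[𝕜] W) := tensorExtₗ A p G

variable {A}

theorem tensorExt_tmul {p : ℕ} (G : MultilinearMap 𝕜 (fun _ : Fin p => V) W) (a : Fin p → A)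
    (x : Fin p → V) :
    G.tensorExt A (fun i => a i ⊗ₜ x i) = (List.ofFn a).prod ⊗ₜ G x := by
  unfold tensorExt
  induction p with
  | zero => simp [tensorExtₗ, Subsingleton.elim x 0]
  | succ p ih =>
    have := ih (G.curryLeft (x 0)) (fun i => a i.succ) (fun i => x i.succ)
    simp only [tensorExtₗ, LinearMap.coe_mk, AddHom.coe_mk, LinearMap.uncurryLeft_apply,
      TensorProduct.lift.tmul, LinearMap.mk₂_apply, LinearMap.compMultilinearMap_apply,
      Algebra.lsmul_coe]
    unfold Fin.tail
    rw [this, TensorProduct.smul_tmul', List.ofFn_succ, List.prod_cons, smul_eq_mul,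
      curryLeft_apply]
    congr 2
    exact Fin.cons_self_tail x

theorem tensorExt_zero {p : ℕ} : tensorExt A (0 : MultilinearMap 𝕜 (fun _ : Fin p => V) W) = 0 :=
  (tensorExtₗ (𝕜 := 𝕜) (V := V) (W := W) A p).map_zero

/-- Multilinear maps on `A ⊗ V` which agree on pure tensors are equal. -/
theorem eq_of_eq_on_tmul {E : Type*} [AddCommGroup E] [Module 𝕜 E] {p : ℕ}
    {f g : MultilinearMap 𝕜 (fun _ : Fin p => A ⊗[𝕜] V) E}
    (h : ∀ (a : Fin p → A) (x : Fin p → V), f (fun i => a i ⊗ₜ x i) = g (fun i => a i ⊗ₜ x i)) :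
    f = g := by
  refine MultilinearMap.ext fun u => eq_of_eqOn_span (S := {t | ∃ (a : A) (x : V), a ⊗ₜ x = t}) ?_ u
    fun i => by rw [TensorProduct.span_tmul_eq_top]; trivial
  intro z hz
  choose a x hax using hz
  obtain rfl : (fun i => a i ⊗ₜ x i) = z := funext hax
  exact h a x

theorem prod_ofFn_update_central {t : A} (ht : ∀ a, a * t = t * a) {p : ℕ} (a : Fin p → A)
    (i : Fin p) (b : A) : (List.ofFn (Function.update a i (t * b))).prod =
      t * (List.ofFn (Function.update a i b)).prod := by
  induction p with
  | zero => exact i.elim0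
  | succ p ih =>
    rw [List.ofFn_succ, List.ofFn_succ, List.prod_cons, List.prod_cons]
    cases i using Fin.cases with
    | zero => simp [mul_assoc]
    | succ i =>
      have h : ∀ b, (fun j : Fin p => Function.update a i.succ b j.succ) =
          Function.update (fun j => a j.succ) i b := by
        intro b; ext j; simp [Function.update_apply]
      rw [h, h, ih]
      simp only [← mul_assoc, ← ht, ne_eq, (Fin.succ_ne_zero i).symm, not_false_eq_true,
        Function.update_of_ne]

/-- Extensions of multilinear maps are linear over the center of `A`. -/
theorem tensorExt_update_smul {p : ℕ} (G : MultilinearMap 𝕜 (fun _ : Fin p => V) W) {t : A}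
    (ht : ∀ a, a * t = t * a) (z : Fin p → A ⊗[𝕜] V) (i : Fin p) (w : A ⊗[𝕜] V) :
    G.tensorExt A (Function.update z i (t • w)) = t • G.tensorExt A (Function.update z i w) := by
  have h : (G.tensorExt A).compLinearMap (Function.update (fun _ => LinearMap.id) i
        (Algebra.lsmul 𝕜 𝕜 (A ⊗[𝕜] V) t)) =
      (Algebra.lsmul 𝕜 𝕜 (A ⊗[𝕜] W) t).compMultilinearMap (G.tensorExt A) := by
    refine eq_of_eq_on_tmul fun a x => ?_
    simp only [compLinearMap_apply, LinearMap.compMultilinearMap_apply, tensorExt_tmul,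
      Algebra.lsmul_coe]
    have : (fun j => Function.update (fun _ => LinearMap.id) i (Algebra.lsmul 𝕜 𝕜 (A ⊗[𝕜] V) t) j
        (a j ⊗ₜ x j)) = fun j => (Function.update a i (t * a i) j) ⊗ₜ[𝕜] x j := by
      ext j
      by_cases hj : j = i
      · subst hj; simp [TensorProduct.smul_tmul']
      · simp [hj]
    rw [this, tensorExt_tmul, prod_ofFn_update_central ht, Function.update_eq_self,
      TensorProduct.smul_tmul', smul_eq_mul]
  have := congr($h (Function.update z i w))
  simp only [compLinearMap_apply, LinearMap.compMultilinearMap_apply, Algebra.lsmul_coe] at this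
  rw [← this]
  congr 1
  ext j
  by_cases hj : j = i
  · subst hj; simp
  · simp [hj]

theorem tensorExt_pow_smul {p : ℕ} (G : MultilinearMap 𝕜 (fun _ : Fin p => V) W) {t : A}
    (ht : ∀ a, a * t = t * a) (r : Fin p → ℕ) (z : Fin p → A ⊗[𝕜] V) :
    G.tensorExt A (fun i => t ^ r i • z i) = t ^ (∑ i, r i) • G.tensorExt A z := by
  have key : ∀ s : Finset (Fin p), G.tensorExt A (s.piecewise (fun i => t ^ r i • z i) z) =
      t ^ (∑ i ∈ s, r i) • G.tensorExt A z := by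
    intro s
    induction s using Finset.induction_on with
    | empty => simp
    | insert i s hi ih =>
      rw [Finset.piecewise_insert, tensorExt_update_smul G fun a =>
        (Commute.pow_right (ht a) (r i)),
        Finset.sum_insert hi, pow_add, mul_smul, ← ih]
      congr 2
      ext j
      by_cases hj : j = i
      · subst hj; simp [hi]
      · simp [hj]
  simpa using key Finset.univ

theorem tensorExt_smul {p : ℕ} (G : MultilinearMap 𝕜 (fun _ : Fin p => V) W) {t : A}
    (ht : ∀ a, a * t = t * a) (z : Fin p → A ⊗[𝕜] V) :
    G.tensorExt A (fun i => t • z i) = t ^ p • G.tensorExt A z := by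
  simpa using tensorExt_pow_smul G ht (fun _ => 1) z

theorem prod_ofFn_eq_zero {p : ℕ} {a : Fin p → A} {i j : Fin p} (hij : i < j)
    (h : ∀ y, a i * y * a j = 0) : (List.ofFn a).prod = 0 := by
  induction p with
  | zero => exact i.elim0
  | succ p ih =>
    rw [List.ofFn_succ, List.prod_cons]
    cases j using Fin.cases with
    | zero => simp at hij
    | succ j =>
      cases i using Fin.cases with
      | succ i =>
        rw [ih (a := fun k => a k.succ) (Fin.succ_lt_succ_iff.1 hij) h, mul_zero]
      | zero =>
        have : ∀ (p : ℕ) (a : Fin p → A) (j : Fin p),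
            ∃ x y, (List.ofFn a).prod = x * a j * y := by
          intro p
          induction p with
          | zero => intro _ j; exact j.elim0
          | succ p ih =>
            intro a j
            rw [List.ofFn_succ, List.prod_cons]
            cases j using Fin.cases with
            | zero => exact ⟨1, _, by rw [one_mul]⟩
            | succ j =>
              obtain ⟨x, y, h⟩ := ih (fun k => a k.succ) j
              exact ⟨a 0 * x, y, by rw [h]; simp only [mul_assoc]⟩
        obtain ⟨x, y, hxy⟩ := this p (fun k => a k.succ) j
        rw [hxy, ← mul_assoc, ← mul_assoc, h, zero_mul]

/-- If `θ A θ = 0`, then an extension vanishes when two arguments are multiples of `θ`. -/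
theorem tensorExt_eq_zero_of_smul {p : ℕ} (G : MultilinearMap 𝕜 (fun _ : Fin p => V) W) {θ : A}
    (hθ : ∀ a, θ * a * θ = 0) {i j : Fin p} (hij : i ≠ j) {z : Fin p → A ⊗[𝕜] V}
    {v w : A ⊗[𝕜] V} (hi : z i = θ • v) (hj : z j = θ • w) : G.tensorExt A z = 0 := by
  wlog h : i < j generalizing i j v w
  · exact this hij.symm hj hi (lt_of_le_of_ne (not_lt.1 h) hij.symm)
  have h0 : (G.tensorExt A).compLinearMap (fun k => if k = i ∨ k = j then
        (Algebra.lsmul 𝕜 𝕜 (A ⊗[𝕜] V) θ) else LinearMap.id) = 0 := by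
    refine eq_of_eq_on_tmul fun a x => ?_
    simp only [compLinearMap_apply, zero_apply]
    have : (fun k => (if k = i ∨ k = j then (Algebra.lsmul 𝕜 𝕜 (A ⊗[𝕜] V) θ) else LinearMap.id)
        (a k ⊗ₜ x k)) = fun k => (if k = i ∨ k = j then θ * a k else a k) ⊗ₜ[𝕜] x k := by
      ext k
      split_ifs <;> simp [TensorProduct.smul_tmul']
    rw [this, tensorExt_tmul, prod_ofFn_eq_zero h, TensorProduct.zero_tmul]
    intro y
    simp only [true_or, or_true, if_true]
    rw [show θ * a i * y * (θ * a j) = (θ * (a i * y) * θ) * a j by simp only [mul_assoc], hθ,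
      zero_mul]
  have := congr($h0 (Function.update (Function.update z i v) j w))
  simp only [compLinearMap_apply, zero_apply] at this
  rw [← this]
  congr 1
  ext k
  by_cases hk : k = j
  · subst hk; simp [hj]
  · by_cases hk' : k = i
    · subst hk'; simp [hi, hij]
    · simp [hk, hk']

/-- Multiples of the first argument may be pulled out. -/
theorem tensorExt_cons_smul {p : ℕ} (G : MultilinearMap 𝕜 (fun _ : Fin (p + 1) => V) W) (θ : A)
    (w : A ⊗[𝕜] V) (z : Fin p → A ⊗[𝕜] V) :
    G.tensorExt A (Fin.cons (θ • w) z) = θ • G.tensorExt A (Fin.cons w z) := by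
  have h : (G.tensorExt A).compLinearMap (Fin.cons (Algebra.lsmul 𝕜 𝕜 (A ⊗[𝕜] V) θ)
      (fun _ => LinearMap.id)) =
      (Algebra.lsmul 𝕜 𝕜 (A ⊗[𝕜] W) θ).compMultilinearMap (G.tensorExt A) := by
    refine eq_of_eq_on_tmul fun a x => ?_
    simp only [compLinearMap_apply, LinearMap.compMultilinearMap_apply, tensorExt_tmul,
      Algebra.lsmul_coe]
    have : (fun j => (Fin.cons (Algebra.lsmul 𝕜 𝕜 (A ⊗[𝕜] V) θ) (fun _ => LinearMap.id) :
        Fin (p + 1) → (A ⊗[𝕜] V →ₗ[𝕜] A ⊗[𝕜] V)) j (a j ⊗ₜ x j)) =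
        fun j => (Fin.cons (θ * a 0) (fun k => a k.succ) : Fin (p + 1) → A) j ⊗ₜ[𝕜] x j := by
      ext j
      cases j using Fin.cases <;> simp [TensorProduct.smul_tmul']
    rw [this, tensorExt_tmul, TensorProduct.smul_tmul', List.ofFn_succ, List.ofFn_succ]
    simp [mul_assoc]
  have := congr($h (Fin.cons w z))
  simp only [compLinearMap_apply, LinearMap.compMultilinearMap_apply, Algebra.lsmul_coe] at this
  rw [← this]
  congr 1
  ext j
  cases j using Fin.cases <;> simp

end

end MultilinearMap

/-! ### The even rules -/

theorem koszulSign_zero {m : ℕ} {α : Type*} [LinearOrder α] (c : Fin m → α) :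
    koszulSign c 0 = 1 := by
  simp [koszulSign]

section

variable {𝕜 V W X : Type*} [Field 𝕜] [AddCommGroup V] [Module 𝕜 V]
  [AddCommGroup W] [Module 𝕜 W] [AddCommGroup X] [Module 𝕜 X]
  {A : Type*} [Ring A] [Algebra 𝕜 A] {𝒜 : ℤ → Submodule 𝕜 A}

theorem units_smul_tmul_smul (u : ℤˣ) (a : A) (x : V) : (u • a) ⊗ₜ[𝕜] (u • x) = a ⊗ₜ[𝕜] x := by
  rcases Int.units_eq_one_or u with rfl | rfl
  · simp
  · simp [Units.smul_def, TensorProduct.tmul_neg, TensorProduct.neg_tmul]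

namespace StructMaps

variable (A) in
/-- The extension of a family of multilinear maps to `A ⊗ V`. -/
noncomputable def tensorExt (F : StructMaps 𝕜 V W) : StructMaps 𝕜 (A ⊗[𝕜] V) (A ⊗[𝕜] W) :=
  fun m => (F m).tensorExt A

/-- On pure tensors, the signs in `morphTerm` are absorbed by the product in `A`. -/
theorem morphTerm_tensorExt (h𝒜 : IsSupercommutative 𝒜) (G : StructMaps 𝕜 W X)
    (F : StructMaps 𝕜 V W) (p : ℕ) {m : ℕ} {d : Fin m → ℤ} {a : Fin m → A}
    (ha : ∀ i, a i ∈ 𝒜 (d i)) (x : Fin m → V) :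
    (G.tensorExt A).morphTerm (F.tensorExt A) p 0 (fun i => a i ⊗ₜ x i) =
      (List.ofFn a).prod ⊗ₜ G.morphTerm F p d x := by
  classical
  rw [morphTerm, morphTerm, TensorProduct.tmul_smul, TensorProduct.tmul_sum]
  congr 1
  refine Finset.sum_congr rfl fun c _ => ?_
  rw [koszulSign_zero, one_smul,
    h𝒜.prod_ofFn_eq_koszulSign (List.pairwise_lt_finRange p) c (by simp) ha, units_smul_tmul_smul]
  simp only [tensorExt]
  rw [← List.ofFn_eq_map, ← MultilinearMap.tensorExt_tmul]
  congr 1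
  ext k
  rw [← MultilinearMap.tensorExt_tmul]
  rfl

theorem coderTerm_tensorExt (h𝒜 : IsSupercommutative 𝒜) (G : StructMaps 𝕜 V W)
    (δ : StructMaps 𝕜 V V) (k : ℕ) {m : ℕ} {d : Fin m → ℤ} {a : Fin m → A}
    (ha : ∀ i, a i ∈ 𝒜 (d i)) (x : Fin m → V) :
    (G.tensorExt A).coderTerm (δ.tensorExt A) k 0 (fun i => a i ⊗ₜ x i) =
      (List.ofFn a).prod ⊗ₜ G.coderTerm δ k d x := by
  simp only [coderTerm, TensorProduct.tmul_sum]
  refine Finset.sum_congr rfl fun B _ => ?_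
  have hs : (List.ofFn a).prod = koszulSign (fun i => if i ∈ B then 0 else 1) d •
      ((List.ofFn (subTuple a B)).prod * (List.ofFn (subTuple a Bᶜ)).prod) := by
    rw [h𝒜.prod_ofFn_eq_koszulSign (K := [0, 1]) (by simp) (fun i => if i ∈ B then 0 else 1)
      (fun i => by split_ifs <;> simp) ha]
    have h0 : Finset.univ.filter (fun i => (if i ∈ B then 0 else 1) = 0) = B := by ext; simp
    have h1 : Finset.univ.filter (fun i => (if i ∈ B then 0 else 1) = 1) = Bᶜ := by ext; simp
    simp only [List.map_cons, List.map_nil, List.prod_cons, List.prod_nil, mul_one]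
    rw [h0, h1]
  rw [koszulSign_zero, one_smul, hs, units_smul_tmul_smul]
  have : (Fin.cons ((δ.tensorExt A) B.card (subTuple (fun i => a i ⊗ₜ x i) B))
      (subTuple (fun i => a i ⊗ₜ x i) Bᶜ) : Fin (Bᶜ.card + 1) → A ⊗[𝕜] V) =
      fun j => (Fin.cons (List.ofFn (subTuple a B)).prod (subTuple a Bᶜ) : Fin _ → A) j ⊗ₜ
        (Fin.cons (δ B.card (subTuple x B)) (subTuple x Bᶜ) : Fin _ → V) j := by
    ext j
    cases j using Fin.cases with
    | zero => exact MultilinearMap.tensorExt_tmul (δ B.card) (subTuple a B) (subTuple x B)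
    | succ j => simp [subTuple]
  rw [this]
  simp only [tensorExt]
  rw [MultilinearMap.tensorExt_tmul, List.ofFn_succ]
  simp

end StructMaps

namespace LInfData

/-- The elements of `A ⊗ sL` of total degree `e`, where the elements of `𝒜 d` have degree `-d`. -/
def tensorDeg (L : LInfData 𝕜 V) (𝒜 : ℤ → Submodule 𝕜 A) (e : ℤ) : Submodule 𝕜 (A ⊗[𝕜] V) :=
  Submodule.span 𝕜 {t | ∃ d, ∃ a ∈ 𝒜 d, ∃ x ∈ L.susp (d + e), a ⊗ₜ[𝕜] x = t}

/-- Graded symmetry of a single multilinear map on `sL`. -/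
def IsSymmMap (L : LInfData 𝕜 V) {m : ℕ} (f : MultilinearMap 𝕜 (fun _ : Fin m => V) W) : Prop :=
  ∀ (d : Fin m → ℤ) (x : Fin m → V), L.Homog d x → ∀ σ : Equiv.Perm (Fin m),
    f x = koszulSign σ.symm d • f (x ∘ σ)

/-- A multilinear map `sL^m → sL'` of degree `e`. -/
def IsDegMap (L : LInfData 𝕜 V) (L' : LInfData 𝕜 W) (e : ℤ) {m : ℕ}
    (f : MultilinearMap 𝕜 (fun _ : Fin m => V) W) : Prop :=
  ∀ (d : Fin m → ℤ) (x : Fin m → V), L.Homog d x → f x ∈ L'.susp (∑ i, d i + e)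

variable {L : LInfData 𝕜 V} {L' : LInfData 𝕜 W}

theorem tmul_mem_tensorDeg {d e : ℤ} {a : A} (ha : a ∈ 𝒜 d) {x : V} (hx : x ∈ L.susp (d + e)) :
    a ⊗ₜ x ∈ L.tensorDeg 𝒜 e :=
  Submodule.subset_span ⟨d, a, ha, x, hx, rfl⟩

/-- To prove an equation between multilinear maps on elements of total degree zero, one may assume
that the arguments are pure tensors. -/
theorem eq_on_tensorDeg {E : Type*} [AddCommGroup E] [Module 𝕜 E] {m : ℕ}
    {f g : MultilinearMap 𝕜 (fun _ : Fin m => A ⊗[𝕜] V) E}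
    (h : ∀ (d : Fin m → ℤ) (a : Fin m → A) (x : Fin m → V), (∀ i, a i ∈ 𝒜 (d i)) → L.Homog d x →
      f (fun i => a i ⊗ₜ x i) = g (fun i => a i ⊗ₜ x i))
    {u : Fin m → A ⊗[𝕜] V} (hu : ∀ i, u i ∈ L.tensorDeg 𝒜 0) : f u = g u := by
  refine MultilinearMap.eq_of_eqOn_span ?_ u hu
  intro z hz
  choose d a ha x hx hax using hz
  obtain rfl : (fun i => a i ⊗ₜ x i) = z := funext hax
  exact h d a x ha fun i => by simpa using hx i

theorem IsSymmMap.tensorExt_comp_perm (h𝒜 : IsSupercommutative 𝒜) {m : ℕ}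
    {f : MultilinearMap 𝕜 (fun _ : Fin m => V) W} (hf : L.IsSymmMap f)
    {u : Fin m → A ⊗[𝕜] V} (hu : ∀ i, u i ∈ L.tensorDeg 𝒜 0) (σ : Equiv.Perm (Fin m)) :
    f.tensorExt A (u ∘ σ) = f.tensorExt A u := by
  refine eq_on_tensorDeg (𝒜 := 𝒜) (L := L) (f := (f.tensorExt A).domDomCongr σ)
    (g := f.tensorExt A) (fun d a x ha hx => ?_) hu
  rw [MultilinearMap.domDomCongr_apply, MultilinearMap.tensorExt_tmul,
    MultilinearMap.tensorExt_tmul, hf d x hx σ, h𝒜.prod_ofFn_comp_perm ha σ, units_smul_tmul_smul]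
  rfl

theorem IsDegMap.tensorExt_mem (h𝒜 : IsSupercommutative 𝒜) {e : ℤ} {m : ℕ}
    {f : MultilinearMap 𝕜 (fun _ : Fin m => V) W} (hf : L.IsDegMap L' e f)
    {u : Fin m → A ⊗[𝕜] V} (hu : ∀ i, u i ∈ L.tensorDeg 𝒜 0) :
    f.tensorExt A u ∈ L'.tensorDeg 𝒜 e := by
  rw [← Submodule.Quotient.mk_eq_zero]
  refine eq_on_tensorDeg (𝒜 := 𝒜) (L := L)
    (f := (L'.tensorDeg 𝒜 e).mkQ.compMultilinearMap (f.tensorExt A)) (g := 0)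
    (fun d a x ha hx => ?_) hu
  rw [LinearMap.compMultilinearMap_apply, MultilinearMap.tensorExt_tmul, zero_apply,
    Submodule.mkQ_apply, Submodule.Quotient.mk_eq_zero]
  exact tmul_mem_tensorDeg (h𝒜.prod_ofFn_mem ha) (hf d x hx)

theorem smul_mem_tensorDeg (h𝒜 : IsSupercommutative 𝒜) {i j e : ℤ} (hij : i + e = j) {θ : A}
    (hθ : θ ∈ 𝒜 i) {u : A ⊗[𝕜] V} (hu : u ∈ L.tensorDeg 𝒜 j) : θ • u ∈ L.tensorDeg 𝒜 e := by
  induction hu using Submodule.span_induction with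
  | mem t ht =>
    obtain ⟨d, a, ha, x, hx, rfl⟩ := ht
    rw [TensorProduct.smul_tmul', smul_eq_mul]
    refine tmul_mem_tensorDeg (h𝒜.mul_mem hθ ha) ?_
    rwa [show i + d + e = d + j by omega]
  | zero => simp
  | add v w _ _ hv hw => rw [smul_add]; exact add_mem hv hw
  | smul c v _ hv => rw [smul_comm]; exact Submodule.smul_mem _ c hv

end LInfData
end

/-! ### Families of multilinear maps as functions -/

namespace StructMaps

section

variable {𝕜 E E' E'' : Type*} [Field 𝕜] [AddCommGroup E] [Module 𝕜 E]
  [AddCommGroup E'] [Module 𝕜 E'] [AddCommGroup E''] [Module 𝕜 E'']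

/-- The maps `Fin j → Fin p`, grouped by the sizes of their fibres. Both sides come from expanding
`(∑ X_a) ^ j` in a polynomial ring, and replacing each monomial by the
corresponding value of `g`. -/
theorem sum_card_fiber {j p : ℕ} (g : (Fin p → ℕ) → E) :
    ∑ c : Fin j → Fin p, g (fun a => (Finset.univ.filter (fun i => c i = a)).card) =
      ∑ r ∈ Finset.piAntidiag Finset.univ j, (Nat.multinomial Finset.univ r : 𝕜) • g r := by
  let ℓ := (MvPolynomial.basisMonomials (Fin p) 𝕜).constr 𝕜 fun s => g s
  have hℓ : ∀ s : Fin p →₀ ℕ, ℓ (MvPolynomial.monomial s 1) = g s := fun s => by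
    have := (MvPolynomial.basisMonomials (Fin p) 𝕜).constr_basis 𝕜 (fun s => g s) s
    rwa [MvPolynomial.coe_basisMonomials] at this
  have hm : ∀ r : Fin p → ℕ, ∏ a, (MvPolynomial.X a : MvPolynomial (Fin p) 𝕜) ^ r a =
      MvPolynomial.monomial (Finsupp.equivFunOnFinite.symm r) 1 := fun r => by
    rw [MvPolynomial.monomial_eq, Finsupp.prod_fintype _ _ (by simp)]
    simp
  have h := congrArg ℓ
    ((Fintype.sum_pow (fun a => (MvPolynomial.X a : MvPolynomial (Fin p) 𝕜)) j).symm.trans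
    (Finset.sum_pow_eq_sum_piAntidiag Finset.univ _ j))
  rw [map_sum, map_sum] at h
  convert h using 1
  · refine Finset.sum_congr rfl fun c _ => ?_
    rw [← Finset.prod_fiberwise' Finset.univ c
      (fun a => (MvPolynomial.X a : MvPolynomial (Fin p) 𝕜))]
    simp only [Finset.prod_const]
    rw [hm, hℓ]
    rfl
  · refine Finset.sum_congr rfl fun r _ => ?_
    rw [hm, ← nsmul_eq_mul, map_nsmul, hℓ, Nat.cast_smul_eq_nsmul]
    rfl

/-- The value at `u` of the formal map `u ↦ ∑ F_p (u, …, u) / p!`, truncated after order `N`. -/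
def eval (F : StructMaps 𝕜 E E') (N : ℕ) (u : E) : E' :=
  ∑ p ∈ Finset.range (N + 1), (p.factorial : 𝕜)⁻¹ • F p fun _ => u

/-- Composition of families corresponds to composition of functions. -/
theorem eval_eval [CharZero 𝕜] {G : StructMaps 𝕜 E' E''} {F : StructMaps 𝕜 E E'} (hG : G 0 = 0)
    (hF : F 0 = 0)
    {N : ℕ} {u : E}
    (hN : ∀ p (r : Fin p → ℕ), N < ∑ a, r a → G p (fun a => F (r a) fun _ => u) = 0) :
    ∑ j ∈ Finset.range (N + 1), (j.factorial : 𝕜)⁻¹ •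
      ∑ p ∈ Finset.Icc 1 j, G.morphTerm F p 0 (fun _ : Fin j => u) = G.eval N (F.eval N u) := by
  classical
  set g : ∀ p, (Fin p → ℕ) → E'' := fun p r => G p fun a => F (r a) fun _ => u with hg
  have hg0 : ∀ p (r : Fin p → ℕ) a, r a = 0 → g p r = 0 := fun p r a ha =>
    (G p).map_coord_zero a (by rw [ha, hF]; rfl)
  have h1 : ∀ j p, G.morphTerm F p 0 (fun _ : Fin j => u) = (p.factorial : 𝕜)⁻¹ •
      ∑ r ∈ Finset.piAntidiag Finset.univ j, (Nat.multinomial Finset.univ r : 𝕜) • g p r := by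
    intro j p
    -- as `F 0 = 0`, the sum in `morphTerm` may be extended to the maps which are not surjective
    rw [morphTerm, ← sum_card_fiber]
    congr 1
    rw [Finset.sum_filter]
    refine Finset.sum_congr rfl fun c _ => ?_
    split_ifs with hc
    · rw [koszulSign_zero, one_smul]
      rfl
    · rw [Function.Surjective] at hc
      push Not at hc
      obtain ⟨a, ha⟩ := hc
      exact (hg0 p _ a (by simpa using ha)).symm
  have h2 : ∀ j ∈ Finset.range (N + 1), ∑ p ∈ Finset.Icc 1 j,
      G.morphTerm F p 0 (fun _ : Fin j => u) =
      ∑ p ∈ Finset.range (N + 1), G.morphTerm F p 0 (fun _ : Fin j => u) := by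
    intro j hj
    rw [Finset.mem_range] at hj
    refine Finset.sum_subset (fun p hp => ?_) fun p hp hp' => ?_
    · rw [Finset.mem_Icc] at hp
      rw [Finset.mem_range]
      omega
    · rw [Finset.mem_Icc, not_and_or] at hp'
      rw [h1, Finset.sum_eq_zero, smul_zero]
      intro r hr
      rw [Finset.mem_piAntidiag] at hr
      by_cases hp0 : p = 0
      · subst hp0
        simp [hg, hG]
      · have : ∃ a, r a = 0 := by
          by_contra! h
          have : ∑ a : Fin p, 1 ≤ ∑ a, r a :=
            Finset.sum_le_sum fun a _ => Nat.one_le_iff_ne_zero.2 (h a)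
          have hr1 : ∑ a, r a = j := hr.1
          simp only [Finset.sum_const, Finset.card_univ, Fintype.card_fin, smul_eq_mul] at this
          omega
        obtain ⟨a, ha⟩ := this
        rw [hg0 p r a ha, smul_zero]
  rw [Finset.sum_congr rfl fun j hj => by rw [h2 j hj, Finset.smul_sum], Finset.sum_comm, eval]
  refine Finset.sum_congr rfl fun p _ => ?_
  simp only [eval]
  rw [MultilinearMap.map_sum_finset (G p) (fun _ k => (k.factorial : 𝕜)⁻¹ • F k fun _ => u)
    fun _ => Finset.range (N + 1)]
  simp only [MultilinearMap.map_smul_univ, h1]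
  simp only [smul_comm _ ((p.factorial : 𝕜)⁻¹), ← Finset.smul_sum]
  congr 1
  have h3 : ∀ j, (j.factorial : 𝕜)⁻¹ • ∑ r ∈ Finset.piAntidiag Finset.univ j,
      (Nat.multinomial Finset.univ r : 𝕜) • g p r =
      ∑ r ∈ Finset.piAntidiag Finset.univ j, (∏ a, ((r a).factorial : 𝕜)⁻¹) • g p r := by
    intro j
    rw [Finset.smul_sum]
    refine Finset.sum_congr rfl fun r hr => ?_
    rw [Finset.mem_piAntidiag] at hr
    rw [smul_smul]
    congr 1
    have := Nat.multinomial_spec Finset.univ r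
    rw [hr.1] at this
    rw [← this, Finset.prod_inv_distrib]
    push_cast
    have h4 : (Nat.multinomial Finset.univ r : 𝕜) ≠ 0 :=
      Nat.cast_ne_zero.2 (Nat.multinomial_pos _ _).ne'
    rw [mul_inv, mul_assoc, inv_mul_cancel₀ h4, mul_one]
  simp only [h3]
  have h4 : ∀ j ∈ Finset.range (N + 1), Finset.piAntidiag Finset.univ j =
      (Fintype.piFinset fun _ : Fin p => Finset.range (N + 1)).filter fun r => ∑ a, r a = j := by
    intro j hj
    ext r
    simp only [Finset.mem_piAntidiag, Finset.mem_filter, Fintype.mem_piFinset, Finset.mem_range,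
      Finset.mem_univ, implies_true, and_true] at hj ⊢
    refine ⟨fun h => ⟨fun a => ?_, h⟩, fun h => h.2⟩
    have h' : ∑ a, r a = j := h
    have := Finset.single_le_sum (f := r) (fun _ _ => Nat.zero_le _) (Finset.mem_univ a)
    omega
  rw [Finset.sum_congr rfl fun j hj => by rw [h4 j hj], Finset.sum_fiberwise_eq_sum_filter]
  rw [Finset.sum_filter]
  refine Finset.sum_congr rfl fun r _ => ?_
  split_ifs with h
  · rfl
  · rw [hN p r (by simpa using h), smul_zero]

end

end StructMaps

/-! ### Coderivations as infinitesimal changes of variables -/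

namespace LInfData

section

variable {𝕜 V W X : Type*} [Field 𝕜] [AddCommGroup V] [Module 𝕜 V]
  [AddCommGroup W] [Module 𝕜 W] [AddCommGroup X] [Module 𝕜 X]
  {A : Type*} [Ring A] [Algebra 𝕜 A] {𝒜 : ℤ → Submodule 𝕜 A}
  {L : LInfData 𝕜 V} {L' : LInfData 𝕜 W}

theorem IsGradedSymmetric.isSymmMap {e : ℤ} {F : StructMaps 𝕜 V W}
    (hF : L.IsGradedSymmetric L' e F) (m : ℕ) : L.IsSymmMap (F m) := hF.symm m

theorem IsGradedSymmetric.isDegMap {e : ℤ} {F : StructMaps 𝕜 V W}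
    (hF : L.IsGradedSymmetric L' e F) (m : ℕ) : L.IsDegMap L' e (F m) := hF.degree m

theorem IsGradedSymmetric.tensorExt_zero {e : ℤ} {F : StructMaps 𝕜 V W}
    (hF : L.IsGradedSymmetric L' e F) : F.tensorExt A 0 = 0 := by
  rw [StructMaps.tensorExt, hF.zero, MultilinearMap.tensorExt_zero]

theorem IsGradedSymmetric.eval_mem (h𝒜 : IsSupercommutative 𝒜) {e : ℤ} {F : StructMaps 𝕜 V W}
    (hF : L.IsGradedSymmetric L' e F) (N : ℕ) {u : A ⊗[𝕜] V} (hu : u ∈ L.tensorDeg 𝒜 0) :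
    (F.tensorExt A).eval N u ∈ L'.tensorDeg 𝒜 e :=
  Submodule.sum_mem _ fun p _ => Submodule.smul_mem _ _ <|
    (hF.isDegMap p).tensorExt_mem h𝒜 fun _ => hu

/-- The truncated value at a multiple of a central element `t` is a multiple of `t`. -/
theorem IsGradedSymmetric.exists_eval_smul (h𝒜 : IsSupercommutative 𝒜) {e : ℤ}
    {F : StructMaps 𝕜 V W} (hF : L.IsGradedSymmetric L' e F) {t : A} (ht : ∀ a, a * t = t * a)
    (ht0 : t ∈ 𝒜 0) (N : ℕ) {v : A ⊗[𝕜] V} (hv : v ∈ L.tensorDeg 𝒜 0) :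
    ∃ w ∈ L'.tensorDeg 𝒜 e, (F.tensorExt A).eval N (t • v) = t • w := by
  refine ⟨∑ p ∈ Finset.range N, ((p + 1).factorial : 𝕜)⁻¹ • t ^ p •
    F.tensorExt A (p + 1) fun _ => v,
    Submodule.sum_mem _ fun p _ => Submodule.smul_mem _ _ ?_, ?_⟩
  · have : t ^ p ∈ 𝒜 0 := by
      clear * - h𝒜 ht0
      induction p with
      | zero => simpa using h𝒜.one_mem
      | succ p ih => simpa [pow_succ] using h𝒜.mul_mem ih ht0
    exact smul_mem_tensorDeg h𝒜 (zero_add e) this ((hF.isDegMap _).tensorExt_mem h𝒜 fun _ => hv)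
  · rw [StructMaps.eval, Finset.sum_range_succ', hF.tensorExt_zero, Finset.smul_sum]
    simp only [zero_apply, smul_zero, add_zero]
    refine Finset.sum_congr rfl fun p _ => ?_
    rw [smul_comm t, StructMaps.tensorExt, MultilinearMap.tensorExt_smul _ ht, pow_succ', mul_smul]

theorem tensorExt_composite_eq_zero {G : StructMaps 𝕜 W X} {F : StructMaps 𝕜 V W} {t : A}
    (ht : ∀ a, a * t = t * a) {N : ℕ} (htN : t ^ (N + 1) = 0) (v : A ⊗[𝕜] V) (p : ℕ)
    (r : Fin p → ℕ) (hr : N < ∑ a, r a) :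
    G.tensorExt A p (fun a => F.tensorExt A (r a) fun _ => t • v) = 0 := by
  simp only [StructMaps.tensorExt, MultilinearMap.tensorExt_smul _ ht]
  rw [MultilinearMap.tensorExt_pow_smul _ ht, pow_eq_zero_of_le hr htN, zero_smul]

theorem tensorExt_update_eq_cons (h𝒜 : IsSupercommutative 𝒜) {q : ℕ}
    {f : MultilinearMap 𝕜 (fun _ : Fin (q + 1) => V) W} (hf : L.IsSymmMap f) {u w : A ⊗[𝕜] V}
    (hu : u ∈ L.tensorDeg 𝒜 0) (hw : w ∈ L.tensorDeg 𝒜 0) (i : Fin (q + 1)) :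
    f.tensorExt A (Function.update (fun _ => u) i w) = f.tensorExt A (Fin.cons w fun _ => u) := by
  rw [← hf.tensorExt_comp_perm h𝒜 (u := Fin.cons w fun _ => u) ?_ (Equiv.swap 0 i)]
  · congr 1
    ext j
    by_cases hj : j = i
    · subst hj; simp
    · rw [Function.update_of_ne hj, Function.comp]
      have : Equiv.swap 0 i j ≠ 0 := by
        intro h
        rw [Equiv.swap_apply_eq_iff, Equiv.swap_apply_left] at h
        exact hj h
      obtain ⟨k, hk⟩ := Fin.exists_succ_eq.2 this
      rw [← hk, Fin.cons_succ]
  · intro j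
    cases j using Fin.cases
    · simpa using hw
    · simpa using hu

/-- The coderivation with structure maps `δ` corresponds to the infinitesimal change of variables
`u ↦ u + θ δ(u)`, where `θ` is an odd parameter. -/
theorem smul_sum_coderTerm [CharZero 𝕜] (h𝒜 : IsSupercommutative 𝒜) {e : ℤ} {G : StructMaps 𝕜 V W}
    (hG : L.IsGradedSymmetric L' e G) {δ : StructMaps 𝕜 V V} (hδ : L.IsGradedSymmetric L (-1) δ)
    {t θ : A} (ht : ∀ a, a * t = t * a) (ht0 : t ∈ 𝒜 0) {N : ℕ} (htN : t ^ (N + 1) = 0)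
    (hθ : ∀ a, θ * a * θ = 0) (hθ1 : θ ∈ 𝒜 (-1)) {v : A ⊗[𝕜] V} (hv : v ∈ L.tensorDeg 𝒜 0) :
    θ • ∑ j ∈ Finset.range (N + 1), (j.factorial : 𝕜)⁻¹ •
        ∑ k ∈ Finset.Icc 1 j,
            (G.tensorExt A).coderTerm (δ.tensorExt A) k 0 (fun _ : Fin j => t • v) =
      (G.tensorExt A).eval N (t • v + θ • (δ.tensorExt A).eval N (t • v)) -
        (G.tensorExt A).eval N (t • v) := by
  set u := t • v with hu
  have hu0 : u ∈ L.tensorDeg 𝒜 0 := smul_mem_tensorDeg h𝒜 (zero_add 0) ht0 hv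
  set φ : ℕ → ℕ → A ⊗[𝕜] W := fun q r =>
    G.tensorExt A (q + 1) (Fin.cons (δ.tensorExt A r fun _ => u) fun _ => u) with hφ
  have hφ0 : ∀ q, φ q 0 = 0 := fun q =>
    (G.tensorExt A (q + 1)).map_coord_zero 0 (by simp [hδ.tensorExt_zero])
  have hφN : ∀ q r, N < q + r → φ q r = 0 := by
    intro q r hqr
    have : (Fin.cons (δ.tensorExt A r fun _ => u) fun _ => u : Fin (q + 1) → A ⊗[𝕜] V) =
        fun i => t ^ ((Fin.cons r fun _ => 1 : Fin (q + 1) → ℕ) i) •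
          (Fin.cons (δ.tensorExt A r fun _ => v) fun _ => v : Fin (q + 1) → A ⊗[𝕜] V) i := by
      ext i
      cases i using Fin.cases with
      | zero => simpa [StructMaps.tensorExt, hu] using
          MultilinearMap.tensorExt_smul (δ r) ht fun _ => v
      | succ i => simp [hu]
    simp only [hφ]
    rw [this, StructMaps.tensorExt, MultilinearMap.tensorExt_pow_smul _ ht, Fin.sum_univ_succ]
    simp only [Fin.cons_zero, Fin.cons_succ, Finset.sum_const, Finset.card_univ, Fintype.card_fin,
      smul_eq_mul, mul_one]
    rw [pow_eq_zero_of_le (show N + 1 ≤ r + q by omega) htN, zero_smul]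
  -- on equal arguments of degree zero, the summand of `coderTerm` depends only on the size of the
  -- subset `B`
  have h1 : ∀ j, (j.factorial : 𝕜)⁻¹ •
      ∑ k ∈ Finset.Icc 1 j, (G.tensorExt A).coderTerm (δ.tensorExt A) k 0 (fun _ : Fin j => u) =
      ∑ x ∈ Finset.HasAntidiagonal.antidiagonal j,
          ((x.1.factorial : 𝕜)⁻¹ * (x.2.factorial : 𝕜)⁻¹) • φ x.1 x.2 := by
    intro j
    simp only [StructMaps.coderTerm]
    rw [Finset.sum_fiberwise_eq_sum_filter, Finset.sum_filter]
    have : ∀ B : Finset (Fin j), (if Bᶜ.card + 1 ∈ Finset.Icc 1 j then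
        koszulSign (fun i => if i ∈ B then 0 else 1) (0 : Fin j → ℤ) •
          G.tensorExt A (Bᶜ.card + 1) (Fin.cons (δ.tensorExt A B.card (subTuple (fun _ => u) B))
            (subTuple (fun _ => u) Bᶜ)) else 0) = φ (j - B.card) B.card := by
      intro B
      rw [koszulSign_zero, one_smul]
      change (if _ then φ Bᶜ.card B.card else 0) = _
      have hB : Bᶜ.card = j - B.card := by rw [Finset.card_compl, Fintype.card_fin]
      rw [hB]
      split_ifs with h
      · rfl
      · have : B.card = 0 := by
          have : B.card ≤ j := by simpa using B.card_le_univ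
          simp only [Finset.mem_Icc, le_add_iff_nonneg_left, zero_le, true_and, not_le] at h
          omega
        rw [this, hφ0]
    simp only [this]
    rw [← Finset.powerset_univ, Finset.sum_powerset_apply_card (fun r => φ (j - r) r),
      Finset.card_univ, Fintype.card_fin, Finset.smul_sum,
      ← Finset.Nat.sum_antidiagonal_swap, Finset.Nat.sum_antidiagonal_eq_sum_range_succ_mk]
    refine Finset.sum_congr rfl fun r hr => ?_
    rw [Finset.mem_range] at hr
    rw [← Nat.cast_smul_eq_nsmul 𝕜, smul_smul, Nat.cast_choose 𝕜 (by omega : r ≤ j)]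
    congr 1
    have := Nat.cast_ne_zero (R := 𝕜).2 j.factorial_ne_zero
    simp only [Prod.swap]
    field_simp
  set w := θ • (δ.tensorExt A).eval N u with hw
  have hw0 : w ∈ L.tensorDeg 𝒜 0 :=
    smul_mem_tensorDeg h𝒜 (by norm_num) hθ1 (hδ.eval_mem h𝒜 N hu0)
  -- `w` is a multiple of `θ`, and `θ A θ = 0`: the expansion stops after the first order
  have h2 : ∀ p, G.tensorExt A p (fun _ => u + w) - G.tensorExt A p (fun _ => u) =
      ∑ i, G.tensorExt A p (Function.update (fun _ => u) i w) := by
    intro p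
    rw [sub_eq_iff_eq_add']
    refine (G.tensorExt A p).map_add_of_sq_zero (fun _ => u) (fun _ => w) fun i j hij z hi hj => ?_
    exact MultilinearMap.tensorExt_eq_zero_of_smul (G p) hθ hij hi hj
  have h3 : ∀ q, G.tensorExt A (q + 1) (Fin.cons w fun _ => u) =
      θ • ∑ r ∈ Finset.range (N + 1), (r.factorial : 𝕜)⁻¹ • φ q r := by
    intro q
    rw [hw]
    simp only [StructMaps.tensorExt, hφ]
    rw [MultilinearMap.tensorExt_cons_smul]
    congr 1
    have := (MultilinearMap.tensorExt A (G (q + 1))).map_update_sum (Finset.range (N + 1)) 0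
      (fun r => (r.factorial : 𝕜)⁻¹ • δ.tensorExt A r fun _ => u) (Fin.cons 0 fun _ => u)
    simp only [Fin.update_cons_zero, MultilinearMap.cons_smul] at this
    exact this
  simp only [h1]
  rw [StructMaps.eval, StructMaps.eval, ← Finset.sum_sub_distrib]
  simp only [← smul_sub, h2]
  have h4 : ∀ q, ((q + 1).factorial : 𝕜)⁻¹ •
      ∑ i, G.tensorExt A (q + 1) (Function.update (fun _ => u) i w) =
      θ • ∑ r ∈ Finset.range (N + 1), ((q.factorial : 𝕜)⁻¹ * (r.factorial : 𝕜)⁻¹) • φ q r := by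
    intro q
    have h : ∀ i, G.tensorExt A (q + 1) (Function.update (fun _ => u) i w) =
        G.tensorExt A (q + 1) (Fin.cons w fun _ => u) :=
      tensorExt_update_eq_cons h𝒜 (hG.isSymmMap _) hu0 hw0
    rw [Finset.sum_congr rfl fun i _ => h i, h3, Finset.sum_const, Finset.card_univ,
      Fintype.card_fin, ← Nat.cast_smul_eq_nsmul 𝕜, smul_smul, smul_comm _ θ, Finset.smul_sum]
    congr 1
    refine Finset.sum_congr rfl fun r _ => ?_
    rw [smul_smul]
    congr 2
    have : ((q + 1 : ℕ) : 𝕜) ≠ 0 := Nat.cast_ne_zero.2 q.succ_ne_zero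
    rw [Nat.factorial_succ, Nat.cast_mul, mul_inv, mul_comm, ← mul_assoc, mul_inv_cancel₀ this,
      one_mul]
  rw [Finset.sum_range_succ' (fun p => (p.factorial : 𝕜)⁻¹ •
    ∑ i, G.tensorExt A p (Function.update (fun _ => u) i w)) N, Fintype.sum_empty, smul_zero,
    add_zero, Finset.sum_congr rfl fun q _ => h4 q, ← Finset.smul_sum]
  congr 1
  -- the terms with `q = N` vanish, as do those with `q + r > N`
  have h5 : ∑ q ∈ Finset.range N, ∑ r ∈ Finset.range (N + 1),
      ((q.factorial : 𝕜)⁻¹ * (r.factorial : 𝕜)⁻¹) • φ q r =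
      ∑ q ∈ Finset.range (N + 1), ∑ r ∈ Finset.range (N + 1),
      ((q.factorial : 𝕜)⁻¹ * (r.factorial : 𝕜)⁻¹) • φ q r := by
    rw [Finset.sum_range_succ _ N, left_eq_add]
    refine Finset.sum_eq_zero fun r _ => ?_
    rcases Nat.eq_zero_or_pos r with rfl | hr
    · rw [hφ0, smul_zero]
    · rw [hφN _ _ (by omega), smul_zero]
  rw [h5, ← Finset.sum_product']
  have h6 : ∀ j ∈ Finset.range (N + 1), Finset.HasAntidiagonal.antidiagonal j =
      (Finset.range (N + 1) ×ˢ Finset.range (N + 1)).filter fun x => x.1 + x.2 = j := by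
    intro j hj
    ext x
    simp only [Finset.HasAntidiagonal.mem_antidiagonal, Finset.mem_filter, Finset.mem_product,
      Finset.mem_range] at hj ⊢
    omega
  rw [Finset.sum_congr rfl fun j hj => by rw [h6 j hj], Finset.sum_fiberwise_eq_sum_filter,
    Finset.sum_filter]
  refine Finset.sum_congr rfl fun x _ => ?_
  split_ifs with h
  · rfl
  · rw [hφN _ _ (by simpa using h), smul_zero]

end

end LInfData

/-! ### The linearized defect on the diagonal -/

namespace LInfData

section

variable {𝕜 V W X : Type*} [Field 𝕜] [AddCommGroup V] [Module 𝕜 V]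
  [AddCommGroup W] [Module 𝕜 W] [AddCommGroup X] [Module 𝕜 X]
  {A : Type*} [Ring A] [Algebra 𝕜 A] {𝒜 : ℤ → Submodule 𝕜 A}
  {L : LInfData 𝕜 V} {L' : LInfData 𝕜 W}

/-- The failure of `F` to be a morphism, in fixed arity and for fixed degrees: the corestriction of
`δ' F - F δ`. -/
noncomputable def defect (L : LInfData 𝕜 V) (L' : LInfData 𝕜 W) (F : StructMaps 𝕜 V W) {m : ℕ}
    (d : Fin m → ℤ) : MultilinearMap 𝕜 (fun _ : Fin m => V) W :=
  ∑ k ∈ Finset.Icc 1 m, L'.δ.morphMap F k d - ∑ k ∈ Finset.Icc 1 m, F.coderMap L.δ k d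

theorem defect_apply (F : StructMaps 𝕜 V W) {m : ℕ} (d : Fin m → ℤ) (x : Fin m → V) :
    L.defect L' F d x = ∑ k ∈ Finset.Icc 1 m, L'.δ.morphTerm F k d x -
      ∑ k ∈ Finset.Icc 1 m, F.coderTerm L.δ k d x := by
  simp only [defect, sub_apply, sum_apply, StructMaps.morphMap_apply, StructMaps.coderMap_apply]

/-- The defect of the extension of `F` to `A ⊗ V`. -/
theorem defect_tensorExt (h𝒜 : IsSupercommutative 𝒜) {F : StructMaps 𝕜 V W} {m : ℕ}
    {f : MultilinearMap 𝕜 (fun _ : Fin m => V) W}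
    (hf : ∀ (d : Fin m → ℤ) (x : Fin m → V), L.Homog d x → f x = L.defect L' F d x)
    {u : Fin m → A ⊗[𝕜] V} (hu : ∀ i, u i ∈ L.tensorDeg 𝒜 0) :
    ∑ k ∈ Finset.Icc 1 m, (L'.δ.tensorExt A).morphTerm (F.tensorExt A) k 0 u -
      ∑ k ∈ Finset.Icc 1 m, (F.tensorExt A).coderTerm (L.δ.tensorExt A) k 0 u =
        f.tensorExt A u := by
  have := eq_on_tensorDeg (𝒜 := 𝒜) (L := L) (g := f.tensorExt A)
    (f := ∑ k ∈ Finset.Icc 1 m, (L'.δ.tensorExt A).morphMap (F.tensorExt A) k 0 -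
      ∑ k ∈ Finset.Icc 1 m, (F.tensorExt A).coderMap (L.δ.tensorExt A) k 0) ?_ hu
  · simpa only [sub_apply, sum_apply, StructMaps.morphMap_apply, StructMaps.coderMap_apply] using
      this
  · intro d a x ha hx
    simp only [sub_apply, sum_apply, StructMaps.morphMap_apply, StructMaps.coderMap_apply,
      StructMaps.morphTerm_tensorExt h𝒜 _ _ _ ha, StructMaps.coderTerm_tensorExt h𝒜 _ _ _ ha,
      MultilinearMap.tensorExt_tmul, hf d x hx, defect_apply, TensorProduct.tmul_sub,
      TensorProduct.tmul_sum]

/-- An odd parameter: an element of degree `-1` with `θ A θ = 0`. -/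
structure IsOddParameter (𝒜 : ℤ → Submodule 𝕜 A) (θ : A) : Prop where
  mem : θ ∈ 𝒜 (-1)
  mul_mul : ∀ a, θ * a * θ = 0

/-- Up to the defect, `F` intertwines the infinitesimal changes of variables given by the
codifferentials. -/
theorem smul_eval_eval [CharZero 𝕜] (h𝒜 : IsSupercommutative 𝒜)
    (hL : L.IsGradedSymmetric L (-1) L.δ) (hL' : L'.IsGradedSymmetric L' (-1) L'.δ)
    {F : StructMaps 𝕜 V W} (hF : L.IsGradedSymmetric L' 0 F) {m : ℕ}
    (hE : ∀ j, 1 ≤ j → j < m → ∀ (d : Fin j → ℤ) (x : Fin j → V), L.Homog d x →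
      L.defect L' F d x = 0)
    {f : MultilinearMap 𝕜 (fun _ : Fin m => V) W}
    (hf : ∀ (d : Fin m → ℤ) (x : Fin m → V), L.Homog d x → f x = L.defect L' F d x)
    {t θ : A} (ht : ∀ a, a * t = t * a) (ht0 : t ∈ 𝒜 0) (htm : t ^ (m + 1) = 0)
    (hθ : IsOddParameter 𝒜 θ) {v : A ⊗[𝕜] V} (hv : v ∈ L.tensorDeg 𝒜 0) :
    θ • (L'.δ.tensorExt A).eval m ((F.tensorExt A).eval m (t • v)) =
      (F.tensorExt A).eval m (t • v + θ • (L.δ.tensorExt A).eval m (t • v)) -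
        (F.tensorExt A).eval m (t • v) + θ • (m.factorial : 𝕜)⁻¹ •
          f.tensorExt A fun _ => t • v := by
  have hu : t • v ∈ L.tensorDeg 𝒜 0 := smul_mem_tensorDeg h𝒜 (zero_add 0) ht0 hv
  rw [← smul_sum_coderTerm h𝒜 hF hL ht ht0 htm hθ.mul_mul hθ.mem hv,
    ← StructMaps.eval_eval hL'.tensorExt_zero hF.tensorExt_zero
      (fun p r hr => tensorExt_composite_eq_zero ht htm v p r hr), ← smul_add]
  congr 1
  rw [← sub_eq_iff_eq_add', ← Finset.sum_sub_distrib]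
  simp only [← smul_sub]
  rw [Finset.sum_eq_single m]
  · rw [defect_tensorExt h𝒜 hf fun _ => hu]
  · intro j hj hjm
    rw [Finset.mem_range] at hj
    rcases Nat.eq_zero_or_pos j with rfl | hj0
    · simp
    · rw [defect_tensorExt h𝒜 (f := 0) (fun d x hx => (hE j hj0 (by omega) d x hx).symm)
        fun _ => hu,
        MultilinearMap.tensorExt_zero, zero_apply, smul_zero]
  · simp

/-- The codifferential squares to zero: the infinitesimal change of variables which it defines does
not change its values. -/
theorem IsLInfAlgebra.eval_add_smul_eval [CharZero 𝕜] (h𝒜 : IsSupercommutative 𝒜)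
    (hL : L.IsLInfAlgebra) {N : ℕ} {t θ : A} (ht : ∀ a, a * t = t * a) (ht0 : t ∈ 𝒜 0)
    (htN : t ^ (N + 1) = 0) (hθ : IsOddParameter 𝒜 θ) {v : A ⊗[𝕜] V} (hv : v ∈ L.tensorDeg 𝒜 0) :
    (L.δ.tensorExt A).eval N (t • v + θ • (L.δ.tensorExt A).eval N (t • v)) =
      (L.δ.tensorExt A).eval N (t • v) := by
  have hu : t • v ∈ L.tensorDeg 𝒜 0 := smul_mem_tensorDeg h𝒜 (zero_add 0) ht0 hv
  rw [← sub_eq_zero, ← smul_sum_coderTerm h𝒜 hL.symmetric hL.symmetric ht ht0 htN hθ.mul_mul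
    hθ.mem hv,
    Finset.sum_eq_zero, smul_zero]
  intro j _
  rcases Nat.eq_zero_or_pos j with rfl | hj
  · simp
  have := eq_on_tensorDeg (𝒜 := 𝒜) (L := L) (g := 0) (m := j) (u := fun _ => t • v)
    (f := ∑ k ∈ Finset.Icc 1 j, (L.δ.tensorExt A).coderMap (L.δ.tensorExt A) k 0) ?_ fun _ => hu
  · simp only [sum_apply, StructMaps.coderMap_apply] at this
    rw [this, zero_apply, smul_zero]
  · intro d a x ha hx
    simp only [sum_apply, StructMaps.coderMap_apply, StructMaps.coderTerm_tensorExt h𝒜 _ _ _ ha,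
      zero_apply]
    rw [← TensorProduct.tmul_sum, hL.codiff j hj d x hx, TensorProduct.tmul_zero]

/-- Changing an argument by an element of top order in `t` affects only the linear part. -/
theorem eval_add_top (F : StructMaps 𝕜 V W) {t : A} (ht : ∀ a, a * t = t * a) {N : ℕ} (hN : 1 ≤ N)
    (htN : t ^ (N + 1) = 0) (y w : A ⊗[𝕜] V) (hF : F 0 = 0) :
    (F.tensorExt A).eval N (t • y + t ^ N • w) =
      (F.tensorExt A).eval N (t • y) + F.tensorExt A 1 fun _ => t ^ N • w := by
  rw [← sub_eq_iff_eq_add', StructMaps.eval, StructMaps.eval, ← Finset.sum_sub_distrib,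
    Finset.sum_eq_single 1]
  · have : (fun _ : Fin 1 => t • y + t ^ N • w) = (fun _ => t • y) + fun _ => t ^ N • w := rfl
    rw [this, (F.tensorExt A 1).map_add_of_sq_zero _ _ fun i j hij =>
      absurd (Subsingleton.elim i j) hij]
    simp only [Finset.univ_unique, Finset.sum_singleton, Nat.factorial_one, Nat.cast_one, inv_one,
      one_smul, add_sub_cancel_left]
    congr 1
    ext i
    rw [Subsingleton.elim i default, Function.update_self]
  · intro p hp hp1
    rw [← smul_sub]
    rcases Nat.eq_zero_or_pos p with rfl | hp0
    · rw [StructMaps.tensorExt, hF, MultilinearMap.tensorExt_zero]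
      simp
    have : (fun _ : Fin p => t • y + t ^ N • w) = (fun _ => t • y) + fun _ => t ^ N • w := rfl
    rw [this, (F.tensorExt A p).map_add_of_zero, sub_self, smul_zero]
    intro i s hi
    have h : s.piecewise (fun _ => t ^ N • w) (fun _ => t • y) =
        fun k => t ^ (if k ∈ s then N else 1) • s.piecewise (fun _ => w) (fun _ => y) k := by
      ext k
      by_cases hk : k ∈ s <;> simp [hk]
    rw [h, StructMaps.tensorExt, MultilinearMap.tensorExt_pow_smul _ ht,
      pow_eq_zero_of_le (m := N + 1) ?_ htN, zero_smul]
    have : Nontrivial (Fin p) := Fin.nontrivial_iff_two_le.2 (by omega)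
    obtain ⟨j, hj⟩ := exists_ne i
    have := Finset.add_le_sum (f := fun k => if k ∈ s then N else 1) (s := Finset.univ)
      (fun _ _ => Nat.zero_le _) (Finset.mem_univ i) (Finset.mem_univ j) hj.symm
    simp only [hi, if_true] at this
    have h1 : 1 ≤ if j ∈ s then N else 1 := by split_ifs <;> omega
    omega
  · simp only [Finset.mem_range, not_lt]
    omega

theorem exists_eval_smul_eq (F : StructMaps 𝕜 V W) {t : A} (ht : ∀ a, a * t = t * a) {N : ℕ}
    (hN : 1 ≤ N) (v : A ⊗[𝕜] V) (hF : F 0 = 0) :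
    ∃ r, (F.tensorExt A).eval N (t • v) = t • ((F.tensorExt A 1 fun _ => v) + t • r) := by
  obtain ⟨n, rfl⟩ := Nat.exists_eq_add_of_le' hN
  refine ⟨∑ p ∈ Finset.range n, ((p + 2).factorial : 𝕜)⁻¹ • t ^ p •
    F.tensorExt A (p + 2) fun _ => v, ?_⟩
  rw [StructMaps.eval, Finset.sum_range_succ', Finset.sum_range_succ']
  simp only [StructMaps.tensorExt, MultilinearMap.tensorExt_smul _ ht, hF,
    MultilinearMap.tensorExt_zero, zero_apply, smul_zero, add_zero, zero_add, Nat.factorial_one,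
    Nat.cast_one, inv_one, one_smul, pow_one, smul_add, Finset.smul_sum]
  rw [add_comm]
  congr 1
  refine Finset.sum_congr rfl fun p _ => ?_
  rw [smul_comm t (_ : 𝕜), smul_comm t (_ : 𝕜), smul_smul, smul_smul]
  congr 2
  rw [pow_succ', pow_succ', mul_assoc]

theorem tensorExt_add_smul {m : ℕ} (f : MultilinearMap 𝕜 (fun _ : Fin m => V) W) {t : A}
    (ht : ∀ a, a * t = t * a) (htm : t ^ (m + 1) = 0) (a b : A ⊗[𝕜] V) :
    (f.tensorExt A fun _ => t • (a + t • b)) = t ^ m • f.tensorExt A fun _ => a := by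
  rw [MultilinearMap.tensorExt_smul _ ht]
  refine ((Algebra.lsmul 𝕜 𝕜 (A ⊗[𝕜] W) (t ^ m)).compMultilinearMap
    (f.tensorExt A)).map_add_of_zero (fun _ => a) (fun _ => t • b) fun i s hi => ?_
  have h : s.piecewise (fun _ => t • b) (fun _ => a) =
      fun k => t ^ (if k ∈ s then 1 else 0) • s.piecewise (fun _ => b) (fun _ => a) k := by
    ext k
    by_cases hk : k ∈ s <;> simp [hk]
  rw [LinearMap.compMultilinearMap_apply, h, MultilinearMap.tensorExt_pow_smul _ ht,
    Algebra.lsmul_coe]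
  beta_reduce
  rw [smul_smul, ← pow_add, pow_eq_zero_of_le _ htm, zero_smul]
  have := Finset.single_le_sum (f := fun k => if k ∈ s then 1 else 0) (fun _ _ => Nat.zero_le _)
    (Finset.mem_univ i)
  simp only [hi, if_true] at this
  omega

/-- The linearized identity `δ' (δ' F - F δ) + (δ' F - F δ) δ = 0` in the lowest arity in which the
defect does not vanish, on the diagonal.  It is obtained from the equality of the two changes of
variables `(u + τ δ u) + σ δ (u + τ δ u)` and `u + (τ + σ) δ u`. -/
theorem smul_linearized_defect [CharZero 𝕜] (h𝒜 : IsSupercommutative 𝒜)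
    (hL : L.IsLInfAlgebra) (hL' : L'.IsLInfAlgebra)
    {F : StructMaps 𝕜 V W} (hF : L.IsGradedSymmetric L' 0 F) {m : ℕ} (hm : 1 ≤ m)
    (hE : ∀ j, 1 ≤ j → j < m → ∀ (d : Fin j → ℤ) (x : Fin j → V), L.Homog d x →
      L.defect L' F d x = 0)
    {f : MultilinearMap 𝕜 (fun _ : Fin m => V) W}
    (hf : ∀ (d : Fin m → ℤ) (x : Fin m → V), L.Homog d x → f x = L.defect L' F d x)
    {t σ τ : A} (ht : ∀ a, a * t = t * a) (ht0 : t ∈ 𝒜 0) (htm : t ^ (m + 1) = 0)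
    (hσ : IsOddParameter 𝒜 σ) (hτ : IsOddParameter 𝒜 τ) (hστ : IsOddParameter 𝒜 (τ + σ))
    {v : A ⊗[𝕜] V} (hv : v ∈ L.tensorDeg 𝒜 0) :
    σ • t ^ m • (L'.δ.tensorExt A 1 (fun _ => τ • f.tensorExt A fun _ => v) +
      ∑ i, f.tensorExt A
        (Function.update (fun _ => v) i (τ • L.δ.tensorExt A 1 fun _ => v))) = 0 := by
  have hu : t • v ∈ L.tensorDeg 𝒜 0 := smul_mem_tensorDeg h𝒜 (zero_add 0) ht0 hv
  set u := t • v with hu_def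
  set D := (L.δ.tensorExt A).eval m with hD
  set D' := (L'.δ.tensorExt A).eval m with hD'
  set Φ := (F.tensorExt A).eval m with hΦ
  set e : A ⊗[𝕜] V → A ⊗[𝕜] W := fun u => (m.factorial : 𝕜)⁻¹ • f.tensorExt A fun _ => u with he
  obtain ⟨r, hr⟩ := exists_eval_smul_eq L.δ ht hm v hL.symmetric.zero
  obtain ⟨w, hw, hwD⟩ := hL.symmetric.exists_eval_smul h𝒜 ht ht0 m hv
  obtain ⟨y, hy, hyΦ⟩ := hF.exists_eval_smul h𝒜 ht ht0 m hv
  obtain ⟨w', hw', hwD'⟩ := hL'.symmetric.exists_eval_smul h𝒜 ht ht0 m hy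
  rw [← hu_def] at hr hwD hyΦ
  rw [← hD] at hr hwD
  rw [← hΦ] at hyΦ
  rw [← hD'] at hwD'
  set δv := L.δ.tensorExt A 1 fun _ => v with hδv
  -- the displaced point is again a multiple of `t`
  have hU : u + τ • D u = t • (v + τ • w) := by
    rw [hwD, hu_def, smul_add, smul_smul τ, ht, ← smul_smul]
  have hV : v + τ • w ∈ L.tensorDeg 𝒜 0 :=
    add_mem hv (smul_mem_tensorDeg h𝒜 (by norm_num) hτ.mem hw)
  have h1 := smul_eval_eval h𝒜 hL.symmetric hL'.symmetric hF hE hf ht ht0 htm hτ hv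
  have h2 := smul_eval_eval h𝒜 hL.symmetric hL'.symmetric hF hE hf ht ht0 htm hστ hv
  have h3 := smul_eval_eval h𝒜 hL.symmetric hL'.symmetric hF hE hf ht ht0 htm hσ hV
  have h4 := hL.eval_add_smul_eval h𝒜 ht ht0 htm hτ hv
  have h5 := hL'.eval_add_smul_eval h𝒜 ht ht0 htm hτ hy
  rw [← hU] at h3
  rw [← hu_def, ← hD] at h4
  rw [← hyΦ, ← hD'] at h5
  rw [← hu_def, ← hD, ← hD', ← hΦ] at h1 h2
  rw [← hD, ← hD', ← hΦ, h4] at h3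
  change _ = _ + τ • e u at h1
  change _ = _ + (τ + σ) • e u at h2
  change _ = _ + σ • e (u + τ • D u) at h3
  -- the value of the codifferential of `L'` at `Φ (u + τ • D u)`
  have heu : ∀ z : A ⊗[𝕜] V, e (t • z) = t ^ m • e z := fun z => by
    simp only [he]
    rw [MultilinearMap.tensorExt_smul _ ht, smul_comm]
  have htm' : ∀ a, a * t ^ m = t ^ m * a := fun a => Commute.pow_right (ht a) m
  have h6 : Φ (u + τ • D u) = (Φ u + τ • D' (Φ u)) + t ^ m • (-(τ • e v)) := by
    have : τ • e u = t ^ m • τ • e v := by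
      rw [hu_def, heu, smul_smul, htm', ← smul_smul]
    rw [smul_neg, ← this, h1]
    abel
  have hY : Φ u + τ • D' (Φ u) = t • (y + τ • w') := by
    rw [hyΦ, hwD', smul_add, smul_smul τ, ht, ← smul_smul]
  have h7 : D' (Φ (u + τ • D u)) = D' (Φ u) + L'.δ.tensorExt A 1 fun _ => t ^ m • (-(τ • e v)) := by
    rw [h6, hY, hD', eval_add_top _ ht hm htm _ _ hL'.symmetric.zero, ← hD', ← hY, h5]
  -- the value of the defect at the displaced point
  have h8 : e (u + τ • D u) = t ^ m • e (v + τ • δv) := by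
    have : u + τ • D u = t • ((v + τ • δv) + t • (τ • r)) := by
      rw [hr, hu_def]
      simp only [smul_add, smul_smul, ← mul_assoc, ht]
      rw [add_assoc]
    simp only [he]
    rw [this, tensorExt_add_smul _ ht htm, smul_comm]
  have h9 : e (v + τ • δv) = e v + (m.factorial : 𝕜)⁻¹ •
      ∑ i, f.tensorExt A (Function.update (fun _ => v) i (τ • δv)) := by
    simp only [he]
    rw [← smul_add]
    congr 1
    exact (f.tensorExt A).map_add_of_sq_zero (fun _ => v) (fun _ => τ • δv)
      fun i j hij z hi hj => MultilinearMap.tensorExt_eq_zero_of_smul f hτ.mul_mul hij hi hj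
  have h10 : (L'.δ.tensorExt A 1 fun _ => t ^ m • (-(τ • e v))) =
      -(t ^ m • (m.factorial : 𝕜)⁻¹ •
        L'.δ.tensorExt A 1 fun _ => τ • f.tensorExt A fun _ => v) := by
    have : (fun _ : Fin 1 => t ^ m • (-(τ • e v))) =
        fun _ => t ^ m • ((-(m.factorial : 𝕜)⁻¹) • τ • f.tensorExt A fun _ => v) := by
      ext
      simp only [he]
      rw [smul_comm τ (_ : 𝕜)]
      exact congrArg (t ^ m • ·) (neg_smul ((m.factorial : 𝕜)⁻¹) _).symm
    rw [this, StructMaps.tensorExt, MultilinearMap.tensorExt_smul _ htm', pow_one,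
      MultilinearMap.map_smul_univ]
    simp
  have key : σ • t ^ m • (m.factorial : 𝕜)⁻¹ •
      (L'.δ.tensorExt A 1 (fun _ => τ • f.tensorExt A fun _ => v) +
      ∑ i, f.tensorExt A (Function.update (fun _ => v) i (τ • δv))) = 0 := by
    have hP : u + τ • D u + σ • D u = u + (τ + σ) • D u := by rw [add_smul, add_assoc]
    rw [h7, h10, h8, h9, hP, smul_add, smul_add, smul_add, ← heu, ← hu_def, smul_neg] at h3
    rw [add_smul τ σ (D' (Φ u)), add_smul τ σ (e u), h1] at h2
    have h2' : σ • D' (Φ u) = Φ (u + (τ + σ) • D u) - Φ (u + τ • D u) + σ • e u := by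
      rw [← sub_eq_zero] at h2 ⊢
      rw [← h2]
      abel
    rw [h2'] at h3
    rw [smul_add, smul_add, smul_add]
    rw [← sub_eq_zero] at h3
    rw [← neg_eq_zero, ← h3]
    abel
  have hm0 : (m.factorial : 𝕜) ≠ 0 := Nat.cast_ne_zero.2 m.factorial_ne_zero
  have := congrArg ((m.factorial : 𝕜) • ·) key
  simp only [smul_zero] at this
  rwa [smul_comm _ σ, smul_comm _ (t ^ m), smul_smul _ (_⁻¹ : 𝕜), mul_inv_cancel₀ hm0, one_smul]
    at this

end

end LInfData

/-! ### Grassmann algebras -/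

section

open CliffordAlgebra (involute evenOdd)

variable {R M : Type*} [CommRing R] [AddCommGroup M] [Module R M]

namespace ExteriorAlgebra

theorem ι_mul_eq_involute_mul (v : M) (b : ExteriorAlgebra R M) :
    ι R v * b = involute b * ι R v := by
  induction b using ExteriorAlgebra.induction with
  | algebraMap r => rw [AlgHom.commutes, Algebra.commutes]
  | ι w =>
    have h : involute (ι R w) = -ι R w := CliffordAlgebra.involute_ι w
    rw [h, neg_mul, eq_neg_iff_add_eq_zero, ι_add_mul_swap]
  | mul a b ha hb => rw [map_mul, mul_assoc, ← hb, ← mul_assoc, ha, mul_assoc]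
  | add a b ha hb => rw [map_add, mul_add, add_mul, ha, hb]

theorem ι_mul_mul_ι (v : M) (a : ExteriorAlgebra R M) : ι R v * a * ι R v = 0 := by
  rw [ι_mul_eq_involute_mul, mul_assoc, ι_sq_zero, mul_zero]

theorem mul_comm_of_mem_even (a : ExteriorAlgebra R M) {b : ExteriorAlgebra R M}
    (hb : b ∈ evenOdd (0 : QuadraticForm R M) 0) : a * b = b * a := by
  induction a using ExteriorAlgebra.induction with
  | algebraMap r => rw [Algebra.commutes]
  | ι v => rw [ι_mul_eq_involute_mul, CliffordAlgebra.involute_eq_of_mem_even hb]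
  | mul x y hx hy => rw [mul_assoc, hy, ← mul_assoc, hx, mul_assoc]
  | add x y hx hy => rw [mul_add, add_mul, hx, hy]

theorem mul_comm_of_mem_odd (a : ExteriorAlgebra R M) {b : ExteriorAlgebra R M}
    (hb : b ∈ evenOdd (0 : QuadraticForm R M) 1) : a * b = b * involute a := by
  induction a using ExteriorAlgebra.induction with
  | algebraMap r => rw [AlgHom.commutes, Algebra.commutes]
  | ι v =>
    have h : involute (ι R v) = -ι R v := CliffordAlgebra.involute_ι v
    rw [ι_mul_eq_involute_mul, CliffordAlgebra.involute_eq_of_mem_odd hb, h, neg_mul, mul_neg]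
  | mul x y hx hy => rw [mul_assoc, hy, ← mul_assoc, hx, mul_assoc, map_mul]
  | add x y hx hy => rw [map_add, mul_add, add_mul, hx, hy]

theorem isSupercommutative_evenOdd (𝕜 : Type*) [CommRing 𝕜] [Algebra 𝕜 R] [Module 𝕜 M]
    [IsScalarTower 𝕜 R M] :
    IsSupercommutative (𝕜 := 𝕜) (A := ExteriorAlgebra R M)
      fun i => (evenOdd (0 : QuadraticForm R M) (i : ZMod 2)).restrictScalars 𝕜 where
  one_mem := by
    rw [Submodule.restrictScalars_mem, Int.cast_zero]
    exact CliffordAlgebra.one_le_evenOdd_zero _ (Submodule.mem_one.2 ⟨1, map_one _⟩)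
  mul_mem {i j a b} ha hb := by
    rw [Submodule.restrictScalars_mem] at *
    rw [Int.cast_add]
    exact CliffordAlgebra.evenOdd_mul_le _ _ _ (Submodule.mul_mem_mul ha hb)
  comm {i j a b} ha hb := by
    rw [Submodule.restrictScalars_mem] at ha hb
    rcases Int.even_or_odd j with hj | hj
    · rw [(ZMod.intCast_eq_zero_iff_even).2 hj] at hb
      rw [mul_comm_of_mem_even a hb, Int.negOnePow_even _ (hj.mul_left i), one_smul]
    · rw [(ZMod.intCast_eq_one_iff_odd).2 hj] at hb
      rw [mul_comm_of_mem_odd a hb]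
      rcases Int.even_or_odd i with hi | hi
      · rw [(ZMod.intCast_eq_zero_iff_even).2 hi] at ha
        rw [CliffordAlgebra.involute_eq_of_mem_even ha, Int.negOnePow_even _ (hi.mul_right j),
          one_smul]
      · rw [(ZMod.intCast_eq_one_iff_odd).2 hi] at ha
        rw [CliffordAlgebra.involute_eq_of_mem_odd ha, Int.negOnePow_odd _ (hi.mul hj), mul_neg,
          Units.neg_smul, one_smul]

/-- A product of distinct generators is unimodular: some linear form takes the value `1` on it,
namely a determinant. -/
theorem exists_apply_prod_eq_one {I : Type*} [DecidableEq I] {l : List I} (hl : l.Nodup) :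
    ∃ φ : ExteriorAlgebra R (I → R) →ₗ[R] R,
      φ ((l.map fun i => ι R (Pi.single i (1 : R))).prod) = 1 := by
  refine ⟨liftAlternating (Function.update 0 l.length
    (Matrix.detRowAlternating.compLinearMap (LinearMap.funLeft R R l.get))), ?_⟩
  have h : (l.map fun i => ι R (Pi.single i (1 : R))) =
      List.ofFn fun k : Fin l.length => ι R (Pi.single (l.get k) (1 : R)) := by
    conv_lhs => rw [← List.ofFn_get l, List.map_ofFn]
    rfl
  rw [h, ← ιMulti_apply, liftAlternating_apply_ιMulti, Function.update_self,
    AlternatingMap.compLinearMap_apply]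
  have h1 : (fun i => LinearMap.funLeft R R l.get (Pi.single (l.get i) (1 : R))) =
      (1 : Matrix (Fin l.length) (Fin l.length) R) := by
    refine funext₂ fun i j => ?_
    rw [LinearMap.funLeft_apply, Pi.single_apply, Matrix.one_apply]
    simp only [hl.get_inj_iff, eq_comm]
  rw [h1]
  exact Matrix.det_one

end ExteriorAlgebra

end

/-- The coefficients used to linearize, and to transfer graded identities: a supercommutative
algebra with a central nilpotent `t`, odd parameters `σ`, `τ` and elements `ε i` of the prescribed
degrees, which are generic in the sense that `t ^ N * (σ * (τ * ∏ ε i)) ≠ 0`. -/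
theorem exists_grassmann.{u} (𝕜 : Type u) [Field 𝕜] {m : ℕ} (d : Fin m → ℤ) (N : ℕ) :
    ∃ (A : Type u) (_ : Ring A) (_ : Algebra 𝕜 A) (𝒜 : ℤ → Submodule 𝕜 A) (t σ τ : A)
      (ε : Fin m → A), IsSupercommutative 𝒜 ∧ (∀ i, ε i ∈ 𝒜 (d i)) ∧ (∀ a, a * t = t * a) ∧
      t ∈ 𝒜 0 ∧ t ^ (N + 1) = 0 ∧ LInfData.IsOddParameter 𝒜 σ ∧ LInfData.IsOddParameter 𝒜 τ ∧
      LInfData.IsOddParameter 𝒜 (τ + σ) ∧ t ^ N * (σ * (τ * (List.ofFn ε).prod)) ≠ 0 := by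
  classical
  let R := AdjoinRoot (Polynomial.X ^ (N + 1) : Polynomial 𝕜)
  let I := Fin 2 ⊕ Fin m
  let e : I → ExteriorAlgebra R (I → R) := fun i => ExteriorAlgebra.ι R (Pi.single i 1)
  have hodd : ∀ v : I → R, LInfData.IsOddParameter (𝕜 := 𝕜)
      (fun i => (CliffordAlgebra.evenOdd (0 : QuadraticForm R (I → R))
        (i : ZMod 2)).restrictScalars 𝕜) (ExteriorAlgebra.ι R v) := fun v =>
    ⟨by
      rw [Submodule.restrictScalars_mem, (ZMod.intCast_eq_one_iff_odd).2 (by decide)]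
      exact CliffordAlgebra.ι_mem_evenOdd_one _ v, ExteriorAlgebra.ι_mul_mul_ι v⟩
  have h𝒜 := ExteriorAlgebra.isSupercommutative_evenOdd (R := R) (M := I → R) 𝕜
  refine ⟨ExteriorAlgebra R (I → R), inferInstance, inferInstance, _,
    algebraMap R _ (AdjoinRoot.root _), e (Sum.inl 0), e (Sum.inl 1),
    fun i => if Odd (d i) then e (Sum.inr i) else 1, h𝒜, fun i => ?_,
    fun a => (Algebra.commutes _ a).symm, ?_, ?_, hodd _, hodd _, ?_, ?_⟩
  · beta_reduce
    rw [Submodule.restrictScalars_mem]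
    split_ifs with hi
    · rw [(ZMod.intCast_eq_one_iff_odd).2 hi]
      exact CliffordAlgebra.ι_mem_evenOdd_one _ _
    · rw [(ZMod.intCast_eq_zero_iff_even).2 (Int.not_odd_iff_even.1 hi)]
      exact CliffordAlgebra.one_le_evenOdd_zero _ (Submodule.mem_one.2 ⟨1, map_one _⟩)
  · rw [Submodule.restrictScalars_mem, Int.cast_zero]
    exact CliffordAlgebra.one_le_evenOdd_zero _ (Submodule.mem_one.2 ⟨_, rfl⟩)
  · have := AdjoinRoot.mk_self (f := (Polynomial.X ^ (N + 1) : Polynomial 𝕜))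
    rw [map_pow, AdjoinRoot.mk_X] at this
    rw [← map_pow, this, map_zero]
  · rw [← map_add]
    exact hodd _
  · obtain ⟨l, hl'⟩ : ∃ l, l = (List.finRange m).filter fun i => Odd (d i) := ⟨_, rfl⟩
    have hl : (Sum.inl 0 :: Sum.inl 1 :: l.map Sum.inr : List I).Nodup := by
      simp only [List.nodup_cons, List.mem_cons, List.mem_map, reduceCtorEq, and_false,
        exists_false, or_false, not_false_eq_true, true_and]
      exact ⟨fun h => absurd (Sum.inl_injective h) (by decide),
        (hl' ▸ (List.nodup_finRange m).filter _).map Sum.inr_injective⟩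
    obtain ⟨φ, hφ⟩ := ExteriorAlgebra.exists_apply_prod_eq_one (R := R) hl
    have hε : (List.ofFn fun i => if Odd (d i) then e (Sum.inr i) else 1).prod =
        ((l.map Sum.inr).map e).prod := by
      rw [List.ofFn_eq_map]
      clear hφ hl
      subst hl'
      induction List.finRange m with
      | nil => simp
      | cons i s ih =>
        by_cases hi : Odd (d i)
        · simp only [List.map_cons, List.prod_cons, hi, if_true, ih, decide_true,
            List.filter_cons_of_pos]
        · simp only [List.map_cons, List.prod_cons, hi, if_false, ih, one_mul, decide_false,
            Bool.false_eq_true, not_false_eq_true, List.filter_cons_of_neg]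
    intro h
    replace h := congrArg φ h
    rw [hε, ← map_pow, ← Algebra.smul_def, map_smul, ← List.prod_cons, ← List.prod_cons,
      ← List.map_cons, ← List.map_cons, hφ, map_zero, smul_eq_mul, mul_one,
      ← AdjoinRoot.mk_X, ← map_pow, AdjoinRoot.mk_eq_zero, pow_dvd_pow_iff Polynomial.X_ne_zero
        Polynomial.not_isUnit_X] at h
    omega

theorem eq_zero_of_tmul_eq_zero {𝕜 A V : Type*} [Field 𝕜] [AddCommGroup A] [Module 𝕜 A]
    [AddCommGroup V] [Module 𝕜 V] {c : A} (hc : c ≠ 0) {y : V} (h : c ⊗ₜ[𝕜] y = 0) : y = 0 := by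
  rw [Ne, ← Module.forall_dual_apply_eq_zero_iff 𝕜] at hc
  push Not at hc
  obtain ⟨φ, hφ⟩ := hc
  have := congrArg ((TensorProduct.lid 𝕜 V).toLinearMap ∘ₗ φ.rTensor V) h
  simpa [hφ] using this

/-! ### Symmetry and degree of the composites -/

section

variable {𝕜 V W X : Type*} [Field 𝕜] [AddCommGroup V] [Module 𝕜 V]
  [AddCommGroup W] [Module 𝕜 W] [AddCommGroup X] [Module 𝕜 X]

namespace StructMaps

theorem apply_comp_equiv {F : StructMaps 𝕜 V W} {M : Submodule 𝕜 V}
    (hF : ∀ k (u : Fin k → V), (∀ i, u i ∈ M) → ∀ σ : Equiv.Perm (Fin k), F k (u ∘ σ) = F k u)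
    {k k' : ℕ} (g : Fin k ≃ Fin k') (u : Fin k' → V) (hu : ∀ i, u i ∈ M) :
    F k (u ∘ g) = F k' u := by
  obtain rfl := Fin.equiv_iff_eq.1 ⟨g⟩
  exact hF k u hu g

/-- A family which is symmetric on arguments in `M` takes the same value on two corresponding
blocks. -/
theorem apply_subTuple_comp {F : StructMaps 𝕜 V W} {M : Submodule 𝕜 V}
    (hF : ∀ k (u : Fin k → V), (∀ i, u i ∈ M) → ∀ σ : Equiv.Perm (Fin k), F k (u ∘ σ) = F k u)
    {m : ℕ} {z : Fin m → V} (hz : ∀ i, z i ∈ M) (σ : Equiv.Perm (Fin m)) {B B' : Finset (Fin m)}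
    (hB : ∀ i, i ∈ B' ↔ σ i ∈ B) :
    F B'.card (subTuple (z ∘ σ) B') = F B.card (subTuple z B) := by
  refine Eq.trans ?_ (apply_comp_equiv hF
    ((B'.orderIsoOfFin rfl).toEquiv.trans ((σ.subtypeEquiv hB).trans
    (B.orderIsoOfFin rfl).symm.toEquiv)) _ fun i => hz _)
  congr 1
  ext a
  simp only [subTuple, Function.comp, ← Finset.coe_orderIsoOfFin_apply]
  simp

theorem morphTerm_comp_perm (G : StructMaps 𝕜 W X) {F : StructMaps 𝕜 V W} {M : Submodule 𝕜 V}
    (hF : ∀ k (u : Fin k → V), (∀ i, u i ∈ M) → ∀ σ : Equiv.Perm (Fin k), F k (u ∘ σ) = F k u)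
    (p : ℕ) {m : ℕ} {z : Fin m → V} (hz : ∀ i, z i ∈ M) (σ : Equiv.Perm (Fin m)) :
    G.morphTerm F p 0 (z ∘ σ) = G.morphTerm F p 0 z := by
  classical
  rw [morphTerm, morphTerm]
  congr 1
  refine Finset.sum_equiv (Equiv.arrowCongr σ (Equiv.refl (Fin p))) (fun c => ?_) fun c _ => ?_
  · simp [Equiv.arrowCongr]
  · rw [koszulSign_zero, koszulSign_zero, one_smul, one_smul]
    congr 1
    ext a
    exact apply_subTuple_comp hF hz σ fun i => by simp [Equiv.arrowCongr]

end StructMaps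

namespace LInfData

variable {L : LInfData 𝕜 V} {L' : LInfData 𝕜 W} {L'' : LInfData 𝕜 X}

theorem IsGradedSymmetric.tensorExt_comp_perm {A : Type*} [Ring A] [Algebra 𝕜 A]
    {𝒜 : ℤ → Submodule 𝕜 A} (h𝒜 : IsSupercommutative 𝒜) {e : ℤ} {F : StructMaps 𝕜 V W}
    (hF : L.IsGradedSymmetric L' e F) (k : ℕ) (u : Fin k → A ⊗[𝕜] V)
    (hu : ∀ i, u i ∈ L.tensorDeg 𝒜 0) (σ : Equiv.Perm (Fin k)) :
    F.tensorExt A k (u ∘ σ) = F.tensorExt A k u :=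
  (hF.isSymmMap k).tensorExt_comp_perm h𝒜 hu σ

/-- The value of a coderivation on arguments of total degree zero is invariant under permutations,
up to multiplication by `θ`: the first argument `w` of `G` in `coderTerm` is odd, but `θ • w` has
degree zero, so that `G` is symmetric in all its arguments. -/
theorem smul_coderTerm_comp_perm {A : Type*} [Ring A] [Algebra 𝕜 A]
    {𝒜 : ℤ → Submodule 𝕜 A} (h𝒜 : IsSupercommutative 𝒜) {e : ℤ} {G : StructMaps 𝕜 V W}
    (hG : L.IsGradedSymmetric L' e G) {δ : StructMaps 𝕜 V V} (hδ : L.IsGradedSymmetric L (-1) δ)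
    {θ : A} (hθ : θ ∈ 𝒜 (-1)) (k : ℕ) {m : ℕ} {u : Fin m → A ⊗[𝕜] V}
    (hu : ∀ i, u i ∈ L.tensorDeg 𝒜 0) (σ : Equiv.Perm (Fin m)) :
    θ • (G.tensorExt A).coderTerm (δ.tensorExt A) k 0 (u ∘ σ) =
      θ • (G.tensorExt A).coderTerm (δ.tensorExt A) k 0 u := by
  simp only [StructMaps.coderTerm, Finset.smul_sum, koszulSign_zero, one_smul]
  refine Finset.sum_equiv (Equiv.finsetCongr σ) (fun B => ?_) fun B _ => ?_
  · simp [Finset.card_compl]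
  have hB : ∀ i, i ∈ B ↔ σ i ∈ Equiv.finsetCongr σ B := fun i => by simp
  have hB' : ∀ i, i ∈ Bᶜ ↔ σ i ∈ (Equiv.finsetCongr σ B)ᶜ := fun i => by simp
  rw [StructMaps.apply_subTuple_comp (hδ.tensorExt_comp_perm h𝒜) hu σ hB]
  set B₁ := Equiv.finsetCongr σ B
  set w := δ.tensorExt A B₁.card (subTuple u B₁)
  have hw : θ • w ∈ L.tensorDeg 𝒜 0 := smul_mem_tensorDeg h𝒜 (by norm_num) hθ
    ((hδ.isDegMap _).tensorExt_mem h𝒜 fun i => hu _)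
  simp only [StructMaps.tensorExt, ← MultilinearMap.tensorExt_cons_smul]
  -- with the first argument fixed, the remaining ones may be permuted
  refine StructMaps.apply_subTuple_comp (F := fun k => ((G.tensorExt A (k + 1)).curryLeft (θ • w)))
    (M := L.tensorDeg 𝒜 0) (fun k v hv π => ?_) hu σ hB'
  rw [MultilinearMap.curryLeft_apply, MultilinearMap.curryLeft_apply,
    ← hG.tensorExt_comp_perm h𝒜 (k + 1) (Fin.cons (θ • w) v) ?_
        (Equiv.Perm.decomposeFin.symm (0, π))]
  · congr 1
    ext i
    cases i using Fin.cases with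
    | zero => simp
    | succ i => simp [Equiv.Perm.decomposeFin_symm_apply_succ]
  · intro i
    cases i using Fin.cases with
    | zero => exact hw
    | succ i => exact hv i

/-- Graded symmetry follows from invariance under permutations after extension to a Grassmann
algebra. -/
theorem morphTerm_eq_koszulSign_smul {e : ℤ} (G : StructMaps 𝕜 W X) {F : StructMaps 𝕜 V W}
    (hF : L.IsGradedSymmetric L' e F) (p : ℕ) {m : ℕ} {d : Fin m → ℤ} {x : Fin m → V}
    (hx : L.Homog d x) (σ : Equiv.Perm (Fin m)) :
    G.morphTerm F p d x = koszulSign σ.symm d • G.morphTerm F p (d ∘ σ) (x ∘ σ) := by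
  obtain ⟨A, _, _, 𝒜, t, θ, τ, ε, h𝒜, hε, -, -, -, -, -, -, hne⟩ := exists_grassmann 𝕜 d 0
  have hP : (List.ofFn ε).prod ≠ 0 := fun h => hne (by simp [h])
  rw [← sub_eq_zero]
  refine eq_zero_of_tmul_eq_zero (𝕜 := 𝕜) hP ?_
  rw [TensorProduct.tmul_sub, sub_eq_zero, ← StructMaps.morphTerm_tensorExt h𝒜 G F p hε,
    h𝒜.prod_ofFn_comp_perm hε σ, units_smul_tmul_smul,
    ← StructMaps.morphTerm_tensorExt h𝒜 G F p (d := d ∘ σ) (a := ε ∘ σ) fun i => hε (σ i)]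
  refine (StructMaps.morphTerm_comp_perm _ (hF.tensorExt_comp_perm h𝒜) p (fun i => ?_) σ).symm
  exact tmul_mem_tensorDeg (hε i) (by simpa using hx i)

/-- Graded symmetry follows from invariance under permutations after extension to a Grassmann
algebra. -/
theorem coderTerm_eq_koszulSign_smul {e : ℤ} {G : StructMaps 𝕜 V W} {δ : StructMaps 𝕜 V V}
    (hG : L.IsGradedSymmetric L' e G) (hδ : L.IsGradedSymmetric L (-1) δ) (k : ℕ) {m : ℕ}
    {d : Fin m → ℤ} {x : Fin m → V} (hx : L.Homog d x) (σ : Equiv.Perm (Fin m)) :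
    G.coderTerm δ k d x = koszulSign σ.symm d • G.coderTerm δ k (d ∘ σ) (x ∘ σ) := by
  obtain ⟨A, _, _, 𝒜, t, θ, τ, ε, h𝒜, hε, -, -, -, -, hτ, -, hne⟩ := exists_grassmann 𝕜 d 0
  have hP : τ * (List.ofFn ε).prod ≠ 0 := fun h => hne (by simp [h])
  rw [← sub_eq_zero]
  refine eq_zero_of_tmul_eq_zero (𝕜 := 𝕜) hP ?_
  rw [← smul_eq_mul, ← TensorProduct.smul_tmul', TensorProduct.tmul_sub, smul_sub, sub_eq_zero,
    ← StructMaps.coderTerm_tensorExt h𝒜 G δ k hε,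
    h𝒜.prod_ofFn_comp_perm hε σ, units_smul_tmul_smul,
    ← StructMaps.coderTerm_tensorExt h𝒜 G δ k (d := d ∘ σ) (a := ε ∘ σ) fun i => hε (σ i)]
  refine (smul_coderTerm_comp_perm h𝒜 hG hδ hτ.mem k (fun i => ?_) σ).symm
  exact tmul_mem_tensorDeg (hε i) (by simpa using hx i)

theorem morphTerm_mem_susp {e : ℤ} {G : StructMaps 𝕜 W X} (hG : L'.IsGradedSymmetric L'' e G)
    {F : StructMaps 𝕜 V W} (hF : L.IsGradedSymmetric L' 0 F) (p : ℕ) {m : ℕ} {d : Fin m → ℤ}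
    {x : Fin m → V} (hx : L.Homog d x) : G.morphTerm F p d x ∈ L''.susp (∑ i, d i + e) := by
  classical
  refine Submodule.smul_mem _ _ (Submodule.sum_mem _ fun c _ => units_smul_mem _ _ ?_)
  have h : ∀ a, F (Finset.univ.filter (fun i => c i = a)).card
      (subTuple x (Finset.univ.filter (fun i => c i = a))) ∈
        L'.susp (∑ i with c i = a, d i) := fun a => by
    rw [← sum_subTuple, ← add_zero (∑ j, _)]
    exact hF.degree _ _ _ fun i => hx _
  have := hG.degree p _ _ h
  rwa [Finset.sum_fiberwise] at this

theorem coderTerm_mem_susp {e e' : ℤ} {G : StructMaps 𝕜 V W} (hG : L.IsGradedSymmetric L' e G)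
    {δ : StructMaps 𝕜 V V} (hδ : L.IsGradedSymmetric L e' δ) (k : ℕ) {m : ℕ} {d : Fin m → ℤ}
    {x : Fin m → V} (hx : L.Homog d x) : G.coderTerm δ k d x ∈ L'.susp (∑ i, d i + (e' + e)) := by
  refine Submodule.sum_mem _ fun B _ => units_smul_mem _ _ ?_
  have := hG.degree (Bᶜ.card + 1) (Fin.cons (∑ i ∈ B, d i + e') (subTuple d Bᶜ))
    (Fin.cons (δ B.card (subTuple x B)) (subTuple x Bᶜ)) fun i => ?_
  · rw [Fin.sum_univ_succ] at this
    simp only [Fin.cons_zero, Fin.cons_succ, sum_subTuple] at this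
    rw [← Finset.sum_add_sum_compl B]
    convert this using 2
    ring
  · cases i using Fin.cases with
    | zero =>
      simp only [Fin.cons_zero]
      rw [← sum_subTuple]
      exact hδ.degree _ _ _ fun i => hx _
    | succ i => exact hx _

end LInfData

end

/-! ### The linearized defect -/

section

variable {𝕜 V W X : Type*} [Field 𝕜] [AddCommGroup V] [Module 𝕜 V]
  [AddCommGroup W] [Module 𝕜 W] [AddCommGroup X] [Module 𝕜 X]

/-- Moving a factor of degree `-1` from the left end of a product to the factor in the place `i`. -/
theorem IsSupercommutative.prod_ofFn_update_mul {A : Type*} [Ring A] [Algebra 𝕜 A]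
    {𝒜 : ℤ → Submodule 𝕜 A} (h𝒜 : IsSupercommutative 𝒜) {θ : A} (hθ : θ ∈ 𝒜 (-1)) {m : ℕ}
    {d : Fin m → ℤ} {a : Fin m → A} (ha : ∀ i, a i ∈ 𝒜 (d i)) (i : Fin m) :
    (List.ofFn (Function.update a i (θ * a i))).prod =
      Int.negOnePow (∑ j ∈ Finset.Iio i, d j) • (θ * (List.ofFn a).prod) := by
  have hI : ∀ {m : ℕ} (i : Fin m) (d : Fin m → ℤ), ∑ j ∈ Finset.Iio i, d j =
      ∑ j, if j < i then d j else 0 := fun i d => by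
    rw [← Finset.sum_filter]
    congr 1
    ext
    simp
  rw [hI]
  induction m with
  | zero => exact i.elim0
  | succ m ih =>
    rw [List.ofFn_succ, List.ofFn_succ, List.prod_cons, List.prod_cons]
    cases i using Fin.cases with
    | zero =>
      have : (fun i : Fin m => Function.update a 0 (θ * a 0) i.succ) = fun i => a i.succ := by
        ext i
        rw [Function.update_of_ne (Fin.succ_ne_zero i)]
      rw [this, Function.update_self, mul_assoc]
      simp
    | succ i =>
      have : (fun j : Fin m => Function.update a i.succ (θ * a i.succ) j.succ) =
          Function.update (fun j => a j.succ) i (θ * a i.succ) := by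
        ext j
        by_cases h : j = i
        · subst h; simp
        · rw [Function.update_of_ne h, Function.update_of_ne fun h' => h (Fin.succ_injective _ h')]
      rw [this, ih (a := fun j => a j.succ) (d := fun j => d j.succ) (fun j => ha j.succ) i,
        Function.update_of_ne (Fin.succ_ne_zero i).symm, Fin.sum_univ_succ,
        if_pos (Fin.succ_pos i), Int.negOnePow_add, mul_smul_comm, ← mul_assoc,
        h𝒜.comm (ha 0) hθ, mul_comm (d 0).negOnePow, mul_smul, ← mul_assoc, smul_mul_assoc,
        mul_neg_one, Int.negOnePow_neg]
      simp only [Fin.succ_lt_succ_iff]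

namespace LInfData

variable {L : LInfData 𝕜 V} {L' : LInfData 𝕜 W}

theorem exists_eq_on_homog (hL : DirectSum.IsInternal L.deg) {m : ℕ}
    (T : (Fin m → ℤ) → MultilinearMap 𝕜 (fun _ : Fin m => V) W) :
    ∃ f : MultilinearMap 𝕜 (fun _ : Fin m => V) W,
      ∀ (d : Fin m → ℤ) (x : Fin m → V), L.Homog d x → f x = T d x := by
  obtain ⟨f, hf⟩ := MultilinearMap.exists_eq_on_homogeneous hL fun d => T fun i => d i + 1
  refine ⟨f, fun d x hx => ?_⟩
  rw [hf (fun i => d i - 1) x hx]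
  simp only [sub_add_cancel]

theorem Homog.comp_perm {m : ℕ} {d : Fin m → ℤ} {x : Fin m → V} (hx : L.Homog d x)
    (σ : Equiv.Perm (Fin m)) : L.Homog (d ∘ σ) (x ∘ σ) := fun i => hx (σ i)

theorem Homog.update {m : ℕ} {d : Fin m → ℤ} {x : Fin m → V} (hx : L.Homog d x) (i : Fin m)
    {e : ℤ} {y : V} (hy : y ∈ L.susp e) :
        L.Homog (Function.update d i e) (Function.update x i y) := by
  intro j
  by_cases h : j = i
  · subst h; simpa using hy
  · simpa [Function.update_of_ne h] using hx j

theorem defect_eq_koszulSign_smul (hL : L.IsGradedSymmetric L (-1) L.δ)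
    {F : StructMaps 𝕜 V W} (hF : L.IsGradedSymmetric L' 0 F) {m : ℕ} {d : Fin m → ℤ}
    {x : Fin m → V} (hx : L.Homog d x) (σ : Equiv.Perm (Fin m)) :
    L.defect L' F d x = koszulSign σ.symm d • L.defect L' F (d ∘ σ) (x ∘ σ) := by
  simp only [defect_apply, smul_sub, Finset.smul_sum]
  congr 1
  · exact Finset.sum_congr rfl fun k _ => morphTerm_eq_koszulSign_smul _ hF k hx σ
  · exact Finset.sum_congr rfl fun k _ => coderTerm_eq_koszulSign_smul hF hL k hx σ

theorem IsGradedSymmetric.diff_mem {e : ℤ} {F : StructMaps 𝕜 V W}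
    (hF : L.IsGradedSymmetric L' e F) {i : ℤ} {x : V} (hx : x ∈ L.susp i) :
    F 1 (fun _ => x) ∈ L'.susp (i + e) := by
  simpa using hF.degree 1 (fun _ => i) (fun _ => x) fun _ => hx

theorem tensorExt_update_smul_diff {A : Type*} [Ring A] [Algebra 𝕜 A] {𝒜 : ℤ → Submodule 𝕜 A}
    (h𝒜 : IsSupercommutative 𝒜) {m : ℕ} (f : MultilinearMap 𝕜 (fun _ : Fin m => V) W) {τ : A}
    (hτ : τ ∈ 𝒜 (-1)) {d : Fin m → ℤ} {ε : Fin m → A} (hε : ∀ i, ε i ∈ 𝒜 (d i)) (x : Fin m → V)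
    (i : Fin m) :
    f.tensorExt A (Function.update (fun i => ε i ⊗ₜ x i) i
        (τ • L.δ.tensorExt A 1 fun _ => ε i ⊗ₜ x i)) =
      (τ * (List.ofFn ε).prod) ⊗ₜ (Int.negOnePow (∑ j ∈ Finset.Iio i, d j) •
        f (Function.update x i (L.diff (x i)))) := by
  have h1 : (τ • L.δ.tensorExt A 1 fun _ => ε i ⊗ₜ[𝕜] x i) = (τ * ε i) ⊗ₜ L.diff (x i) := by
    rw [StructMaps.tensorExt, MultilinearMap.tensorExt_tmul, TensorProduct.smul_tmul', smul_eq_mul]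
    simp
    rfl
  have h2 : Function.update (fun i => ε i ⊗ₜ[𝕜] x i) i ((τ * ε i) ⊗ₜ L.diff (x i)) =
      fun j => Function.update ε i (τ * ε i) j ⊗ₜ Function.update x i (L.diff (x i)) j := by
    ext j
    by_cases h : j = i
    · subst h; simp
    · simp [Function.update_of_ne h]
  rw [h1, h2, MultilinearMap.tensorExt_tmul, h𝒜.prod_ofFn_update_mul hτ hε,
    ← units_smul_tmul_smul (Int.negOnePow (∑ j ∈ Finset.Iio i, d j)),
    smul_smul, Int.units_mul_self, one_smul]

/-- The linearized identity `δ' (δ' F - F δ) + (δ' F - F δ) δ = 0` in the lowest arity in which the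
defect does not vanish. -/
theorem linearized_defect [CharZero 𝕜] (hL : L.IsLInfAlgebra) (hL' : L'.IsLInfAlgebra)
    {F : StructMaps 𝕜 V W} (hF : L.IsGradedSymmetric L' 0 F) {m : ℕ} (hm : 1 ≤ m)
    (hE : ∀ j, 1 ≤ j → j < m → ∀ (d : Fin j → ℤ) (x : Fin j → V), L.Homog d x →
      L.defect L' F d x = 0) {d : Fin m → ℤ} {x : Fin m → V} (hx : L.Homog d x) :
    L'.diff (L.defect L' F d x) + ∑ i, Int.negOnePow (∑ j ∈ Finset.Iio i, d j) •
      L.defect L' F (Function.update d i (d i - 1)) (Function.update x i (L.diff (x i))) = 0 := by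
  obtain ⟨f, hf⟩ := exists_eq_on_homog hL.internal fun d => L.defect L' F (m := m) d
  have hfs : L.IsSymmMap f := fun d x hx σ => by
    rw [hf d x hx, hf _ _ (hx.comp_perm σ), defect_eq_koszulSign_smul hL.symmetric hF hx σ]
  obtain ⟨A, _, _, 𝒜, t, σ, τ, ε, h𝒜, hε, ht, ht0, htm, hσ, hτ, hστ, hne⟩ := exists_grassmann 𝕜 d m
  let D := (L.δ.tensorExt A).linPart
  let D' := (L'.δ.tensorExt A).linPart
  let τV : A ⊗[𝕜] V →ₗ[𝕜] A ⊗[𝕜] V := Algebra.lsmul 𝕜 𝕜 (A ⊗[𝕜] V) τ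
  let τW : A ⊗[𝕜] W →ₗ[𝕜] A ⊗[𝕜] W := Algebra.lsmul 𝕜 𝕜 (A ⊗[𝕜] W) τ
  -- `S` polarizes the identity `smul_linearized_defect`, which holds on the diagonal; as `S` is
  -- symmetric, it vanishes
  let S : MultilinearMap 𝕜 (fun _ : Fin m => A ⊗[𝕜] V) (A ⊗[𝕜] W) :=
    (Algebra.lsmul 𝕜 𝕜 (A ⊗[𝕜] W) (σ * t ^ m)).compMultilinearMap
      ((D' ∘ₗ τW).compMultilinearMap (f.tensorExt A) +
        ∑ i, (f.tensorExt A).compLinearMap (Function.update (fun _ => LinearMap.id) i (τV ∘ₗ D)))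
  have hS : ∀ v, S v = σ • t ^ m • (L'.δ.tensorExt A 1 (fun _ => τ • f.tensorExt A v) +
      ∑ i, f.tensorExt A (Function.update v i (τ • L.δ.tensorExt A 1 fun _ => v i))) := by
    intro v
    rw [smul_smul]
    simp only [S, LinearMap.compMultilinearMap_apply, add_apply, sum_apply,
      MultilinearMap.compLinearMap_apply]
    refine congrArg (fun z => (σ * t ^ m) • z)
      (congrArg (D' (τW (f.tensorExt A v)) + ·)
        (Finset.sum_congr rfl fun i _ => congrArg (f.tensorExt A) (funext fun j => ?_)))
    by_cases h : j = i
    · subst h; simp only [Function.update_self]; rfl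
    · simp only [Function.update_of_ne h, LinearMap.id_apply]
  have hD : ∀ v ∈ L.tensorDeg 𝒜 0, (τ • L.δ.tensorExt A 1 fun _ => v) ∈ L.tensorDeg 𝒜 0 :=
    fun v hv => smul_mem_tensorDeg h𝒜 (by norm_num) hτ.mem
      ((hL.symmetric.isDegMap 1).tensorExt_mem h𝒜 fun _ => hv)
  have hSp : ∀ v, (∀ i, v i ∈ L.tensorDeg 𝒜 0) → ∀ π : Equiv.Perm (Fin m), S (v ∘ π) = S v := by
    intro v hv π
    rw [hS, hS, hfs.tensorExt_comp_perm h𝒜 hv π]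
    congr 3
    refine Finset.sum_equiv π (by simp) fun i _ => ?_
    rw [← hfs.tensorExt_comp_perm h𝒜
      (u := Function.update v (π i) (τ • L.δ.tensorExt A 1 fun _ => v (π i))) (fun j => ?_) π,
      Function.update_comp_equiv, Equiv.symm_apply_apply]
    · rfl
    · by_cases h : j = π i
      · subst h; simpa using hD _ (hv _)
      · simpa [Function.update_of_ne h] using hv j
  have hv : ∀ i, ε i ⊗ₜ x i ∈ L.tensorDeg 𝒜 0 := fun i =>
    tmul_mem_tensorDeg (hε i) (by simpa using hx i)
  have h0 : S (fun i => ε i ⊗ₜ x i) = 0 := by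
    have := S.sum_perm_eq_zero (L.tensorDeg 𝒜 0) (fun v hv => ?_) _ hv
    · rw [Finset.sum_congr rfl fun π _ => hSp _ hv π, Finset.sum_const, ← Nat.cast_smul_eq_nsmul 𝕜,
        smul_eq_zero] at this
      refine this.resolve_left (Nat.cast_ne_zero.2 ?_)
      rw [Finset.card_univ]
      exact Fintype.card_ne_zero
    · rw [hS]
      exact smul_linearized_defect h𝒜 hL hL' hF hm hE hf ht ht0 htm hσ hτ hστ hv
  refine eq_zero_of_tmul_eq_zero (𝕜 := 𝕜) hne ?_
  rw [← h0, hS]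
  have hc : ∀ y : W, (t ^ m * (σ * (τ * (List.ofFn ε).prod))) ⊗ₜ[𝕜] y =
      σ • t ^ m • ((τ * (List.ofFn ε).prod) ⊗ₜ[𝕜] y) := fun y => by
    rw [← mul_assoc, ← Commute.pow_right (ht σ) m, mul_assoc, TensorProduct.smul_tmul',
      TensorProduct.smul_tmul', smul_eq_mul, smul_eq_mul]
  rw [hc]
  refine congrArg (fun z => σ • t ^ m • z) ?_
  rw [TensorProduct.tmul_add, TensorProduct.tmul_sum]
  refine congrArg₂ (· + ·) ?_ (Finset.sum_congr rfl fun i _ => ?_)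
  · rw [MultilinearMap.tensorExt_tmul, TensorProduct.smul_tmul', smul_eq_mul, StructMaps.tensorExt,
      MultilinearMap.tensorExt_tmul, hf d x hx]
    simp
    rfl
  · have h : L.diff (x i) ∈ L.susp (d i - 1) := hL.symmetric.diff_mem (hx i)
    rw [tensorExt_update_smul_diff h𝒜 f hτ.mem hε, hf _ _ (hx.update i h)]

end LInfData

end

/-! ### Strict morphisms -/

theorem Submodule.isInternal_prod {ι 𝕜 V W : Type*} [DecidableEq ι] [Ring 𝕜] [AddCommGroup V]
    [Module 𝕜 V] [AddCommGroup W] [Module 𝕜 W] {𝒱 : ι → Submodule 𝕜 V} {𝒲 : ι → Submodule 𝕜 W}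
    (h𝒱 : DirectSum.IsInternal 𝒱) (h𝒲 : DirectSum.IsInternal 𝒲) :
    DirectSum.IsInternal fun i => (𝒱 i).prod (𝒲 i) := by
  rw [DirectSum.isInternal_submodule_iff_iSupIndep_and_iSup_eq_top] at *
  refine ⟨?_, ?_⟩
  · rw [iSupIndep_iff_finsetSum_eq_zero_imp_eq_zero] at *
    intro s v hv h0 i hi
    refine Prod.ext ?_ ?_
    · exact h𝒱.1 s (fun i => (v i).1) (fun i hi => (hv i hi).1)
        (by simpa [Prod.fst_sum] using congrArg Prod.fst h0) i hi
    · exact h𝒲.1 s (fun i => (v i).2) (fun i hi => (hv i hi).2)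
        (by simpa [Prod.snd_sum] using congrArg Prod.snd h0) i hi
  · simp only [LinearMap.prod_eq_sup_map, iSup_sup_eq, ← Submodule.map_iSup, h𝒱.2, h𝒲.2,
      Submodule.map_top, LinearMap.sup_range_inl_inr]

section

variable {𝕜 V W X : Type*} [Field 𝕜] [AddCommGroup V] [Module 𝕜 V]
  [AddCommGroup W] [Module 𝕜 W] [AddCommGroup X] [Module 𝕜 X]

theorem koszulSign_const {m : ℕ} {α : Type*} [LinearOrder α] (a : α) (d : Fin m → ℤ) :
    koszulSign (fun _ => a) d = 1 := by
  simp [koszulSign]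

namespace StructMaps

theorem ofLinear_of_ne {g : V →ₗ[𝕜] W} {m : ℕ} (hm : m ≠ 1) : ofLinear g m = 0 := by
  match m with
  | 0 => rfl
  | 1 => exact absurd rfl hm
  | _ + 2 => rfl

theorem linPart_ofLinear (g : V →ₗ[𝕜] W) : (ofLinear g).linPart = g := rfl

theorem apply_subTuple_univ (F : StructMaps 𝕜 V W) {m : ℕ} (x : Fin m → V) :
    F (Finset.univ : Finset (Fin m)).card (subTuple x Finset.univ) = F m x := by
  have key : ∀ k (h : (Finset.univ : Finset (Fin m)).card = k),
      F (Finset.univ : Finset (Fin m)).card (subTuple x Finset.univ) =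
        F k fun a => x (Finset.univ.orderEmbOfFin h a) := by
    rintro _ rfl
    rfl
  rw [key m (Finset.card_fin m), ← Finset.orderEmbOfFin_unique (f := id) _ (by simp) strictMono_id]
  rfl

theorem apply_subTuple_singleton (F : StructMaps 𝕜 V W) {m : ℕ} (x : Fin m → V) (i : Fin m) :
    F ({i} : Finset (Fin m)).card (subTuple x {i}) = F 1 fun _ => x i := by
  have key : ∀ k (h : ({i} : Finset (Fin m)).card = k),
      F ({i} : Finset (Fin m)).card (subTuple x {i}) =
        F k fun a => x (({i} : Finset (Fin m)).orderEmbOfFin h a) := by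
    rintro _ rfl
    rfl
  rw [key 1 (Finset.card_singleton i)]
  simp only [Finset.orderEmbOfFin_singleton]

/-- The top component of a morphism `F` is the symmetric power of its linear part. -/
theorem morphTerm_self_summand (G : StructMaps 𝕜 W X) (F : StructMaps 𝕜 V W) {m : ℕ} (x : Fin m → V)
    (σ : Equiv.Perm (Fin m)) :
    (G m fun a => F (Finset.univ.filter (fun i => σ i = a)).card
      (subTuple x (Finset.univ.filter (fun i => σ i = a)))) =
        G m ((fun i => F.linPart (x i)) ∘ σ.symm) := by
  congr 1
  ext a
  have : (Finset.univ.filter fun i => σ i = a) = {σ.symm a} := by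
    ext i
    simp [Equiv.eq_symm_apply]
  rw [this, apply_subTuple_singleton]
  rfl

/-- For a strict morphism, only the top component is nonzero. -/
theorem morphTerm_ofLinear_of_ne (G : StructMaps 𝕜 W X) (g : V →ₗ[𝕜] W) {k m : ℕ} (hk : k ≠ m)
    (d : Fin m → ℤ) (x : Fin m → V) : G.morphTerm (ofLinear g) k d x = 0 := by
  classical
  rw [morphTerm, Finset.sum_eq_zero, smul_zero]
  intro c hc
  -- some block of the partition does not consist of a single letter
  obtain ⟨a, ha⟩ : ∃ a, (Finset.univ.filter fun i => c i = a).card ≠ 1 := by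
    by_contra! h
    apply hk
    have := Finset.card_eq_sum_card_fiberwise (f := c) (s := Finset.univ) (t := Finset.univ)
        (by simp)
    rw [Finset.sum_congr rfl fun a _ => h a] at this
    simpa using this.symm
  rw [(G k).map_coord_zero a, smul_zero]
  rw [ofLinear_of_ne ha, zero_apply]

theorem coderTerm_one (G : StructMaps 𝕜 V W) (δ : StructMaps 𝕜 V V) {m : ℕ} (d : Fin m → ℤ)
    (x : Fin m → V) : G.coderTerm δ 1 d x = G.linPart (δ m x) := by
  rw [coderTerm, Finset.sum_eq_single Finset.univ]
  · have h : koszulSign (fun i => if i ∈ (Finset.univ : Finset (Fin m)) then 0 else 1) d = 1 := by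
      simpa using koszulSign_const 0 d
    rw [h, one_smul, apply_subTuple_univ]
    have key : ∀ k (hk : k = 0) (z : Fin k → V) (w : V),
        G (k + 1) (Fin.cons w z) = G.linPart w := by
      rintro _ rfl z w
      refine congrArg (G 1) (funext fun i => ?_)
      rw [Fin.fin_one_eq_zero i, Fin.cons_zero]
    exact key _ (by simp) _ _
  · intro B hB hB1
    simp only [Finset.mem_filter, Finset.mem_univ, true_and, add_eq_right, Finset.card_eq_zero,
      Finset.compl_eq_empty_iff] at hB
    exact absurd hB hB1
  · simp

end StructMaps

namespace LInfData

variable {L : LInfData 𝕜 V} {L' : LInfData 𝕜 W} {L'' : LInfData 𝕜 X}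

theorem morphTerm_self [CharZero 𝕜] {e : ℤ} {G : StructMaps 𝕜 W X}
    (hG : L'.IsGradedSymmetric L'' e G) {F : StructMaps 𝕜 V W} (hF : L.IsGradedSymmetric L' 0 F)
    {m : ℕ} {d : Fin m → ℤ} {x : Fin m → V} (hx : L.Homog d x) :
    G.morphTerm F m d x = G m fun i => F.linPart (x i) := by
  classical
  have hy : L'.Homog d fun i => F.linPart (x i) := fun i => by
    have := hF.diff_mem (hx i)
    rwa [add_zero] at this
  have h : ∀ c ∈ Finset.univ.filter (Function.Surjective : (Fin m → Fin m) → Prop),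
      (koszulSign c d • G m fun a => F (Finset.univ.filter (fun i => c i = a)).card
        (subTuple x (Finset.univ.filter (fun i => c i = a)))) = G m fun i => F.linPart (x i) := by
    intro c hc
    obtain ⟨σ, rfl⟩ : ∃ σ : Equiv.Perm (Fin m), ⇑σ = c :=
      ⟨Equiv.ofBijective c (Finite.surjective_iff_bijective.1 (by simpa using hc)), rfl⟩
    rw [StructMaps.morphTerm_self_summand, hG.symm m d _ hy σ.symm, Equiv.symm_symm]
  have hcard : (Finset.univ.filter (Function.Surjective : (Fin m → Fin m) → Prop)).card =
      m.factorial := by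
    rw [← congrArg Nat.factorial (Fintype.card_fin m), ← Fintype.card_perm, ← Finset.card_univ]
    refine (Finset.card_bij (fun (σ : Equiv.Perm (Fin m)) _ => ⇑σ)
      (fun σ _ => by simpa using σ.surjective)
      (fun _ _ _ _ h => DFunLike.coe_injective h) fun c hc => ?_).symm
    exact ⟨Equiv.ofBijective c (Finite.surjective_iff_bijective.1 (by simpa using hc)),
      Finset.mem_univ _, rfl⟩
  rw [StructMaps.morphTerm]
  convert congrArg ((m.factorial : 𝕜)⁻¹ • ·) (Finset.sum_congr rfl h) using 1
  rw [Finset.sum_const, hcard, ← Nat.cast_smul_eq_nsmul 𝕜, smul_smul,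
    inv_mul_cancel₀ (Nat.cast_ne_zero.2 m.factorial_ne_zero), one_smul]

theorem isGradedSymmetric_ofLinear {e : ℤ} {g : V →ₗ[𝕜] W}
    (hg : ∀ i, ∀ x ∈ L.deg i, g x ∈ L'.deg (i + e)) :
    L.IsGradedSymmetric L' e (StructMaps.ofLinear g) where
  zero := rfl
  degree m d x hx := by
    by_cases hm : m = 1
    · subst hm
      have := hg _ _ (hx 0)
      rw [Fin.sum_univ_one, susp, show d 0 + e - 1 = d 0 - 1 + e by ring]
      exact this
    · rw [StructMaps.ofLinear_of_ne hm]
      exact zero_mem _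
  symm m d x hx σ := by
    by_cases hm : m = 1
    · subst hm
      rw [Subsingleton.elim σ 1]
      simp [koszulSign]
    · rw [StructMaps.ofLinear_of_ne hm]
      simp

/-- A linear map of degree zero which commutes with all structure maps is a strict morphism. -/
theorem isMorphism_ofLinear [CharZero 𝕜] (hL' : L'.IsGradedSymmetric L' (-1) L'.δ) {g : V →ₗ[𝕜] W}
    (hg : ∀ i, ∀ x ∈ L.deg i, g x ∈ L'.deg i)
    (hδ : ∀ m (x : Fin m → V), g (L.δ m x) = L'.δ m fun i => g (x i)) :
    L.IsMorphism L' (StructMaps.ofLinear g) := by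
  classical
  have hs : L.IsGradedSymmetric L' 0 (StructMaps.ofLinear g) :=
    isGradedSymmetric_ofLinear (by simpa using hg)
  refine ⟨hs, fun m hm d x hx => ?_⟩
  rw [Finset.sum_eq_single m, Finset.sum_eq_single 1, morphTerm_self hL' hs hx,
    StructMaps.coderTerm_one, StructMaps.linPart_ofLinear, hδ]
  · intro k hk hk1
    refine Finset.sum_eq_zero fun B hB => ?_
    rw [StructMaps.ofLinear_of_ne, zero_apply, smul_zero]
    simp only [Finset.mem_filter, Finset.mem_univ, true_and] at hB
    rwa [hB]
  · simp [hm]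
  · intro k hk hkm
    exact StructMaps.morphTerm_ofLinear_of_ne L'.δ g hkm d x
  · simp [hm]

end LInfData

end

/-! ### The middle object -/

section

variable {𝕜 V W : Type*} [Field 𝕜] [AddCommGroup V] [Module 𝕜 V] [AddCommGroup W] [Module 𝕜 W]

/-- The subspace spanned by some of the summands of a direct sum decomposition is the direct sum of
its intersections with all summands. -/
theorem Submodule.isInternal_comap_subtype {ι : Type*} [DecidableEq ι] {𝒱 : ι → Submodule 𝕜 V}
    (h𝒱 : DirectSum.IsInternal 𝒱) (p : ι → Prop) (P : Submodule 𝕜 V)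
    (hP : P = ⨆ i, ⨆ _ : p i, 𝒱 i) :
    DirectSum.IsInternal fun i => (𝒱 i).comap P.subtype := by
  rw [DirectSum.isInternal_submodule_iff_iSupIndep_and_iSup_eq_top] at *
  refine ⟨?_, ?_⟩
  · have h := h𝒱.1
    rw [iSupIndep_iff_finsetSum_eq_zero_imp_eq_zero] at *
    intro s v hv h0 i hi
    exact Subtype.ext (h s (fun i => (v i : V)) hv (by simpa using congrArg Subtype.val h0) i hi)
  · apply Submodule.map_injective_of_injective P.injective_subtype
    rw [Submodule.map_iSup, Submodule.map_top, Submodule.range_subtype]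
    simp only [Submodule.map_comap_subtype]
    refine le_antisymm (iSup_le fun i => inf_le_left) ?_
    conv_lhs => rw [hP]
    refine iSup₂_le fun i hi => le_iSup_of_le i (le_inf ?_ le_rfl)
    rw [hP]
    exact le_iSup₂_of_le i hi le_rfl

theorem Submodule.isInternal_comp_equiv {ι ι' : Type*} [DecidableEq ι] [DecidableEq ι']
    {𝒱 : ι → Submodule 𝕜 V} (h𝒱 : DirectSum.IsInternal 𝒱) (e : ι' ≃ ι) :
    DirectSum.IsInternal fun i => 𝒱 (e i) := by
  rw [DirectSum.isInternal_submodule_iff_iSupIndep_and_iSup_eq_top] at *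
  exact ⟨h𝒱.1.comp e.injective, (e.iSup_comp (g := 𝒱)).trans h𝒱.2⟩

namespace LInfData

variable {L : LInfData 𝕜 V} {L' : LInfData 𝕜 W}

theorem pathDiff_mem {i : ℤ} {p : L.Path} (hp : p ∈ L.pathDeg i) :
    L.pathDiff p ∈ L.pathDeg (i - 1) := by
  refine ⟨zero_mem _, ?_⟩
  rw [sub_add_cancel]
  exact hp.1

theorem pathHtpy_mem {i : ℤ} {p : L.Path} (hp : p ∈ L.pathDeg i) :
    L.pathHtpy p ∈ L.pathDeg (i + 1) :=
  ⟨hp.2, zero_mem _⟩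

theorem pathDiff_pathDiff (p : L.Path) : L.pathDiff (L.pathDiff p) = 0 := by
  ext <;> simp [pathDiff]

theorem pathDiff_pathHtpy_add (p : L.Path) :
    L.pathDiff (L.pathHtpy p) + L.pathHtpy (L.pathDiff p) = p := by
  ext <;> simp [pathDiff, pathHtpy]

theorem isInternal_pathDeg (hL : DirectSum.IsInternal L.deg) : DirectSum.IsInternal L.pathDeg := by
  have h := Submodule.isInternal_comap_subtype hL (fun i => 1 ≤ i) L.posPart rfl
  exact Submodule.isInternal_prod h (Submodule.isInternal_comp_equiv h (Equiv.addRight 1))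

theorem deg_inf_posPart (hL : DirectSum.IsInternal L.deg) {i : ℤ} (hi : i ≤ 0) :
    L.deg i ⊓ L.posPart = ⊥ := by
  rw [← disjoint_iff]
  refine (hL.submodule_iSupIndep i).mono_right ?_
  exact iSup₂_le fun j hj => le_iSup₂_of_le j (by omega) le_rfl

theorem comap_deg_eq_bot (hL : DirectSum.IsInternal L.deg) {i : ℤ} (hi : i ≤ 0) :
    (L.deg i).comap L.posPart.subtype = ⊥ := by
  rw [eq_bot_iff]
  intro x hx
  have : (x : V) ∈ L.deg i ⊓ L.posPart := ⟨hx, x.2⟩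
  rw [deg_inf_posPart hL hi, Submodule.mem_bot] at this
  exact Subtype.ext this

theorem middle_δ_fst (m : ℕ) (x : Fin m → V × L'.Path) :
    ((L.middle L').δ m x).1 = L.δ m fun i => (x i).1 := by
  by_cases hm : m = 1
  · subst hm
    simp [middle, StructMaps.ofLinear]
  · simp [middle, StructMaps.ofLinear_of_ne hm]

theorem middle_δ_snd_of_ne {m : ℕ} (hm : m ≠ 1) (x : Fin m → V × L'.Path) :
    ((L.middle L').δ m x).2 = 0 := by
  simp [middle, StructMaps.ofLinear_of_ne hm]

theorem middle_δ_one_snd (x : Fin 1 → V × L'.Path) :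
    ((L.middle L').δ 1 x).2 = L'.pathDiff (x 0).2 := by
  simp [middle, StructMaps.ofLinear]

theorem middle_diff (x : V × L'.Path) : (L.middle L').diff x = (L.diff x.1, L'.pathDiff x.2) :=
  Prod.ext (middle_δ_fst 1 fun _ => x) (middle_δ_one_snd fun _ => x)

theorem pathDiff_middle_δ_snd (m : ℕ) (x : Fin m → V × L'.Path) :
    L'.pathDiff ((L.middle L').δ m x).2 = 0 := by
  by_cases hm : m = 1
  · subst hm
    rw [middle_δ_one_snd, pathDiff_pathDiff]
  · rw [middle_δ_snd_of_ne hm, map_zero]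

theorem middle_δ_cons_snd {k : ℕ} {w : V × L'.Path} (hw : L'.pathDiff w.2 = 0)
    (z : Fin k → V × L'.Path) : ((L.middle L').δ (k + 1) (Fin.cons w z)).2 = 0 := by
  cases k with
  | zero => rw [middle_δ_one_snd]; exact hw
  | succ k => exact middle_δ_snd_of_ne (by omega) _

theorem isLInfAlgebra_middle (hL : L.IsLInfAlgebra) (hL' : L'.IsLInfAlgebra) :
    (L.middle L').IsLInfAlgebra where
  internal := Submodule.isInternal_prod hL.internal (isInternal_pathDeg hL'.internal)
  symmetric :=
    { zero := by
        ext x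
        · simp [middle, StructMaps.ofLinear, hL.symmetric.zero]
        all_goals simp [middle, StructMaps.ofLinear]
      degree := fun m d x hx => by
        refine ⟨?_, ?_⟩
        · rw [middle_δ_fst]
          exact hL.symmetric.degree m d _ fun i => (hx i).1
        · by_cases hm : m = 1
          · subst hm
            rw [middle_δ_one_snd, Fin.sum_univ_one, show d 0 + -1 - 1 = d 0 - 1 - 1 by ring]
            exact pathDiff_mem (hx 0).2
          · rw [middle_δ_snd_of_ne hm]
            exact zero_mem _
      symm := fun m d x hx σ => by
        by_cases hm : m = 1
        · subst hm
          rw [Subsingleton.elim σ 1]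
          simp [koszulSign]
        · refine Prod.ext ?_ ?_
          · rw [Prod.smul_fst, middle_δ_fst, middle_δ_fst]
            exact hL.symmetric.symm m d _ (fun i => (hx i).1) σ
          · rw [Prod.smul_snd, middle_δ_snd_of_ne hm, middle_δ_snd_of_ne hm, smul_zero] }
  codiff := fun m hm d x hx => by
    refine Prod.ext ?_ ?_
    · rw [Prod.fst_sum, Prod.fst_zero, ← hL.codiff m hm d (fun i => (x i).1) fun i => (hx i).1]
      refine Finset.sum_congr rfl fun k _ => ?_
      rw [StructMaps.coderTerm, StructMaps.coderTerm, Prod.fst_sum]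
      refine Finset.sum_congr rfl fun B _ => ?_
      rw [Prod.smul_fst, middle_δ_fst]
      congr 2
      ext i
      cases i using Fin.cases with
      | zero => exact middle_δ_fst _ _
      | succ i => rfl
    · rw [Prod.snd_sum, Prod.snd_zero]
      refine Finset.sum_eq_zero fun k _ => ?_
      rw [StructMaps.coderTerm, Prod.snd_sum]
      refine Finset.sum_eq_zero fun B _ => ?_
      rw [Prod.smul_snd, middle_δ_cons_snd (pathDiff_middle_δ_snd _ _), smul_zero]

theorem isLieAlgebra_middle {n : ℕ∞} (hL : L.IsLieAlgebra n) (hL' : L'.IsLieAlgebra n) :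
    (L.middle L').IsLieAlgebra n where
  toIsLInfAlgebra := isLInfAlgebra_middle hL.toIsLInfAlgebra hL'.toIsLInfAlgebra
  neg i hi := by
    simp only [middle, pathDeg, hL.neg i hi, comap_deg_eq_bot hL'.internal hi.le,
      comap_deg_eq_bot hL'.internal (show i + 1 ≤ 0 by omega), Submodule.prod_bot]
  top i hi := by
    have h : L'.deg ((i : ℤ) + 1) = ⊥ := by
      have := hL'.top (i + 1) (hi.trans (by exact_mod_cast Nat.le_succ i))
      rwa [Nat.cast_succ] at this
    have hb : (⊥ : Submodule 𝕜 W).comap L'.posPart.subtype = ⊥ := by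
      rw [Submodule.comap_bot, Submodule.ker_subtype]
    simp only [middle, pathDeg, hL.top i hi, hL'.top i hi, h, hb, Submodule.prod_bot]

theorem isMorphism_incl [CharZero 𝕜] (hL : L.IsLInfAlgebra) (hL' : L'.IsLInfAlgebra) :
    L.IsMorphism (L.middle L') (L.incl L') := by
  refine isMorphism_ofLinear (isLInfAlgebra_middle hL hL').symmetric
    (fun i x hx => ⟨hx, zero_mem _⟩) fun m x => Prod.ext ?_ ?_
  · rw [middle_δ_fst]
    rfl
  · by_cases hm : m = 1
    · subst hm
      rw [middle_δ_one_snd]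
      exact (map_zero _).symm
    · rw [middle_δ_snd_of_ne hm]
      rfl

theorem isStrict_incl : (L.incl L').IsStrict := fun _ hm =>
  StructMaps.ofLinear_of_ne (by omega)

theorem isWeakEquivalence_incl : L.IsWeakEquivalence (L.middle L') (L.incl L') := by
  refine fun i => ⟨fun x hx _ ⟨y, hy, hyx⟩ => ⟨y.1, hy.1, ?_⟩, fun y hy hy0 => ?_⟩
  · rw [middle_diff] at hyx
    exact congrArg Prod.fst hyx
  · rw [middle_diff] at hy0
    refine ⟨y.1, hy.1, congrArg Prod.fst hy0, (0, L'.pathHtpy y.2),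
      ⟨zero_mem _, pathHtpy_mem hy.2⟩, ?_⟩
    rw [middle_diff]
    have h0 : L'.pathDiff y.2 = 0 := congrArg Prod.snd hy0
    have := pathDiff_pathHtpy_add y.2
    rw [h0, map_zero, add_zero] at this
    refine Prod.ext ?_ ?_
    · simp [incl, StructMaps.linPart_ofLinear]
    · simp [incl, StructMaps.linPart_ofLinear, this]

end LInfData

end

/-! ### The extremal terms of the composites -/

section

variable {𝕜 V W X : Type*} [Field 𝕜] [AddCommGroup V] [Module 𝕜 V]
  [AddCommGroup W] [Module 𝕜 W] [AddCommGroup X] [Module 𝕜 X]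

/-- The sign picked up by moving a map of degree one to the letter `i` is compatible with
permutations of the letters. -/
theorem koszulSign_update {m : ℕ} (σ : Equiv.Perm (Fin m)) (d : Fin m → ℤ) (i : Fin m) :
    Int.negOnePow (∑ j ∈ Finset.Iio (σ.symm i), (d ∘ σ) j) *
      koszulSign σ.symm (Function.update d i (d i + 1)) =
        koszulSign σ.symm d * Int.negOnePow (∑ j ∈ Finset.Iio i, d j) := by
  set d' := Function.update d i (d i + 1) with hd'
  obtain ⟨A, _, _, 𝒜, t, θ, τ, ε, h𝒜, hε, -, -, -, -, hτ, -, hne⟩ := exists_grassmann ℚ d' 0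
  have hP : τ * (List.ofFn ε).prod ≠ 0 := fun h => hne (by simp [h])
  have hsum : ∑ j ∈ Finset.Iio i, d' j = ∑ j ∈ Finset.Iio i, d j :=
    Finset.sum_congr rfl fun j hj => Function.update_of_ne (Finset.mem_Iio.1 hj).ne _ _
  have hsum' : ∑ j ∈ Finset.Iio (σ.symm i), (d' ∘ σ) j = ∑ j ∈ Finset.Iio (σ.symm i), (d ∘ σ) j :=
    Finset.sum_congr rfl fun j hj => Function.update_of_ne
      (fun h => (Finset.mem_Iio.1 hj).ne (by rw [← h, Equiv.symm_apply_apply])) _ _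
  -- compute the product of the `ε j`, with `τ` inserted in the place `i`, in two ways
  have h1 := h𝒜.prod_ofFn_update_mul hτ.mem hε i
  have h2 := h𝒜.prod_ofFn_update_mul hτ.mem (d := d' ∘ σ) (a := ε ∘ σ) (fun j => hε (σ j))
      (σ.symm i)
  have h3 := h𝒜.prod_ofFn_comp_perm (d := d) (a := Function.update ε i (τ * ε i)) (fun j => by
    by_cases h : j = i
    · subst h
      have := h𝒜.mul_mem hτ.mem (hε j)
      rw [hd', Function.update_self, neg_add_cancel_comm_assoc] at this
      rwa [Function.update_self]
    · have := hε j
      rw [hd', Function.update_of_ne h] at this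
      rwa [Function.update_of_ne h]) σ
  rw [Function.update_comp_equiv, h1, hsum] at h3
  rw [Function.comp_apply, Equiv.apply_symm_apply, hsum'] at h2
  rw [h2, h𝒜.prod_ofFn_comp_perm hε σ] at h3
  rw [mul_smul_comm] at h3
  have hQ : τ * (List.ofFn (ε ∘ σ)).prod ≠ 0 := fun h => hP (by
    rw [h𝒜.prod_ofFn_comp_perm hε σ, mul_smul_comm, h, smul_zero])
  rw [smul_smul, smul_smul] at h3
  have key : ∀ u v : ℤˣ, u • (τ * (List.ofFn (ε ∘ σ)).prod) = v • (τ * (List.ofFn (ε ∘ σ)).prod) →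
      u = v := by
    intro u v huv
    have := sub_eq_zero.2 huv
    rw [Units.smul_def, Units.smul_def, ← sub_smul, ← Int.cast_smul_eq_zsmul ℚ, smul_eq_zero,
      Int.cast_eq_zero, sub_eq_zero] at this
    exact Units.ext (this.resolve_right hQ)
  have h4 := key _ _ h3
  have hu : ∀ u : ℤˣ, u * u = 1 := Int.units_mul_self
  calc _ = (koszulSign σ.symm d * koszulSign σ.symm d) *
        (Int.negOnePow (∑ j ∈ Finset.Iio (σ.symm i), (d ∘ σ) j) * koszulSign σ.symm d') := by
        rw [hu, one_mul]
    _ = koszulSign σ.symm d * (koszulSign σ.symm d *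
        Int.negOnePow (∑ j ∈ Finset.Iio (σ.symm i), (d ∘ σ) j)) * koszulSign σ.symm d' := by
        simp only [mul_assoc]
    _ = _ := by rw [← h4, mul_assoc, mul_assoc, hu, mul_one]

namespace StructMaps

theorem morphTerm_one (G : StructMaps 𝕜 W X) (F : StructMaps 𝕜 V W) {m : ℕ} (hm : 1 ≤ m)
    (d : Fin m → ℤ) (x : Fin m → V) : G.morphTerm F 1 d x = G.linPart (F m x) := by
  classical
  rw [morphTerm, Finset.sum_eq_single fun _ => 0]
  · rw [koszulSign_const, Nat.factorial_one, Nat.cast_one, inv_one, one_smul, one_smul]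
    refine congrArg (G 1) (funext fun a => ?_)
    rw [← apply_subTuple_univ F x, Finset.filter_true_of_mem]
    exact fun i _ => (Subsingleton.elim _ _)
  · exact fun c _ hc => absurd (Subsingleton.elim _ _) hc
  · intro h
    refine absurd ?_ h
    simp only [Finset.mem_filter, Finset.mem_univ, true_and]
    exact fun a => ⟨⟨0, hm⟩, Subsingleton.elim _ _⟩

theorem coderTerm_congr {F G : StructMaps 𝕜 V W} (δ : StructMaps 𝕜 V V) {k : ℕ} (h : F k = G k)
    {m : ℕ} (d : Fin m → ℤ) (x : Fin m → V) : F.coderTerm δ k d x = G.coderTerm δ k d x := by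
  refine Finset.sum_congr rfl fun B hB => ?_
  have hB' : F (Bᶜ.card + 1) = G (Bᶜ.card + 1) := by rw [(Finset.mem_filter.1 hB).2, h]
  rw [hB']

theorem morphTerm_congr (G : StructMaps 𝕜 W X) {F F' : StructMaps 𝕜 V W} {p m : ℕ}
    (h : ∀ k ≤ m, (2 ≤ p → k < m) → F k = F' k) (d : Fin m → ℤ) (x : Fin m → V) :
    G.morphTerm F p d x = G.morphTerm F' p d x := by
  classical
  rw [morphTerm, morphTerm]
  congr 1
  refine Finset.sum_congr rfl fun c hc => ?_
  congr 2
  ext a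
  rw [h]
  · exact (Finset.card_le_univ _).trans_eq (Fintype.card_fin m)
  · intro hp
    have : Nontrivial (Fin p) := Fin.nontrivial_iff_two_le.2 hp
    obtain ⟨b, hb⟩ := exists_ne a
    obtain ⟨i, hi⟩ := (Finset.mem_filter.1 hc).2 b
    refine (Finset.card_lt_univ_of_notMem (x := i) ?_).trans_eq (Fintype.card_fin m)
    simp [hi, hb]

end StructMaps

namespace LInfData

variable {L : LInfData 𝕜 V} {L' : LInfData 𝕜 W}

/-- The component `S^m → S^m` of a coderivation is the extension of its linear part as a
derivation. -/
theorem coderTerm_self {e : ℤ} {F : StructMaps 𝕜 V W} (hF : L.IsGradedSymmetric L' e F)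
    (hL : L.IsGradedSymmetric L (-1) L.δ) {m : ℕ} {d : Fin m → ℤ} {x : Fin m → V}
    (hx : L.Homog d x) :
    F.coderTerm L.δ m d x = ∑ i, Int.negOnePow (∑ j ∈ Finset.Iio i, d j) •
      F m (Function.update x i (L.diff (x i))) := by
  obtain ⟨A, _, _, 𝒜, t, θ, τ, ε, h𝒜, hε, -, -, -, -, hτ, -, hne⟩ := exists_grassmann 𝕜 d 0
  have hP : τ * (List.ofFn ε).prod ≠ 0 := fun h => hne (by simp [h])
  rw [← sub_eq_zero]
  refine eq_zero_of_tmul_eq_zero (𝕜 := 𝕜) hP ?_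
  rw [TensorProduct.tmul_sub, sub_eq_zero, TensorProduct.tmul_sum]
  simp only [← tensorExt_update_smul_diff h𝒜 (F m) hτ.mem hε]
  rw [← smul_eq_mul, ← TensorProduct.smul_tmul', ← StructMaps.coderTerm_tensorExt h𝒜 F L.δ m hε]
  set u : Fin m → A ⊗[𝕜] V := fun i => ε i ⊗ₜ x i
  have hu : ∀ i, u i ∈ L.tensorDeg 𝒜 0 := fun i =>
    tmul_mem_tensorDeg (hε i) (by simpa using hx i)
  rw [StructMaps.coderTerm, Finset.smul_sum]
  have hset : (Finset.univ.filter fun B : Finset (Fin m) => Bᶜ.card + 1 = m) =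
      Finset.univ.image fun i : Fin m => ({i} : Finset (Fin m)) := by
    ext B
    simp only [Finset.mem_filter, Finset.mem_univ, true_and, Finset.mem_image]
    rw [Finset.card_compl, Fintype.card_fin]
    have hB : B.card ≤ m := (Finset.card_le_univ B).trans_eq (Fintype.card_fin m)
    constructor
    · intro h
      obtain ⟨i, rfl⟩ := Finset.card_eq_one.1 (show B.card = 1 by omega)
      exact ⟨i, rfl⟩
    · rintro ⟨i, rfl⟩
      rw [Finset.card_singleton] at hB ⊢
      omega
  rw [hset, Finset.sum_image fun i _ j _ h => Finset.singleton_injective h]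
  refine Finset.sum_congr rfl fun i _ => ?_
  rw [koszulSign_zero, one_smul, StructMaps.apply_subTuple_singleton]
  set w := L.δ.tensorExt A 1 fun _ => u i
  have hw : τ • w ∈ L.tensorDeg 𝒜 0 := smul_mem_tensorDeg h𝒜 (by norm_num) hτ.mem
    ((hL.isDegMap 1).tensorExt_mem h𝒜 fun _ => hu i)
  set k := ({i}ᶜ : Finset (Fin m)).card with hk
  simp only [StructMaps.tensorExt, ← MultilinearMap.tensorExt_cons_smul]
  let g : Fin (k + 1) → Fin m := Fin.cons i (({i}ᶜ : Finset (Fin m)).orderEmbOfFin rfl)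
  have hg : Function.Injective g := by
    refine Fin.cons_injective_iff.2 ⟨?_, RelEmbedding.injective _⟩
    simp
  have hkm : k + 1 = m := by
    rw [hk, Finset.card_compl, Fintype.card_fin, Finset.card_singleton]
    have := i.pos
    omega
  have hg' : Function.Bijective g :=
    (Fintype.bijective_iff_injective_and_card g).2 ⟨hg, by simp [hkm]⟩
  have := StructMaps.apply_comp_equiv (hF.tensorExt_comp_perm h𝒜) (Equiv.ofBijective g hg')
    (Function.update u i (τ • w)) fun j => ?_
  · refine Eq.trans (congrArg _ (funext fun a => ?_)) this
    rw [Function.comp_apply, Equiv.ofBijective_apply]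
    cases a using Fin.cases with
    | zero => simp [g]
    | succ a =>
      have : ({i}ᶜ : Finset (Fin m)).orderEmbOfFin rfl a ≠ i :=
        Finset.notMem_singleton.1
          (Finset.mem_compl.1 (({i}ᶜ : Finset (Fin m)).orderEmbOfFin_mem rfl a))
      simp [g, Function.update_of_ne this, subTuple]
  · by_cases h : j = i
    · subst h; simpa using hw
    · simpa [Function.update_of_ne h] using hu j

end LInfData

end

/-! ### The symmetrized homotopy -/

section

variable {𝕜 V W : Type*} [Field 𝕜] [AddCommGroup V] [Module 𝕜 V] [AddCommGroup W] [Module 𝕜 W]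

theorem negOnePow_sum_update {m : ℕ} (d : Fin m → ℤ) (i j : Fin m) {e : ℤ} (he : Odd (e - d j)) :
    Int.negOnePow (∑ k ∈ Finset.Iio i, Function.update d j e k) =
      (if j < i then -1 else 1) * Int.negOnePow (∑ k ∈ Finset.Iio i, d k) := by
  split_ifs with h
  · have hj : j ∈ Finset.Iio i := Finset.mem_Iio.2 h
    rw [Finset.sum_update_of_mem hj, Finset.sdiff_singleton_eq_erase,
      ← Finset.add_sum_erase _ d hj, ← sub_add_cancel e (d j), add_assoc, Int.negOnePow_add,
      Int.negOnePow_odd _ he]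
  · rw [Finset.sum_update_of_notMem (by simpa using h), one_mul]

section

variable {E : Type*} [AddCommGroup E] [Module 𝕜 E] {m : ℕ}
  (c : (Fin m → ℤ) → MultilinearMap 𝕜 (fun _ : Fin m => E) W) (D H : E →ₗ[𝕜] E)

/-- Maps of degree `-1` and `1` acting on different letters anticommute. -/
theorem anticomm_of_ne {i j : Fin m} (hij : i ≠ j) (d : Fin m → ℤ) (z : Fin m → E) :
    Int.negOnePow (∑ k ∈ Finset.Iio j, d k) •
        Int.negOnePow (∑ k ∈ Finset.Iio i, Function.update d j (d j + 1) k) •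
          c (Function.update (Function.update d j (d j + 1)) i
              (Function.update d j (d j + 1) i - 1))
            (Function.update (Function.update z j (H (z j))) i
              (D (Function.update z j (H (z j)) i))) +
      Int.negOnePow (∑ k ∈ Finset.Iio i, d k) •
        Int.negOnePow (∑ k ∈ Finset.Iio j, Function.update d i (d i - 1) k) •
          c (Function.update (Function.update d i (d i - 1)) j
              (Function.update d i (d i - 1) j + 1))
            (Function.update (Function.update z i (D (z i))) j
              (H (Function.update z i (D (z i)) j))) = 0 := by
  rw [negOnePow_sum_update d i j (by simp), negOnePow_sum_update d j i (by simp),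
    Function.update_of_ne hij, Function.update_of_ne hij, Function.update_of_ne hij.symm,
    Function.update_of_ne hij.symm, Function.update_comm hij.symm, Function.update_comm hij.symm,
    smul_smul, smul_smul]
  rcases lt_or_gt_of_ne hij with h | h
  · rw [if_pos h, if_neg h.not_gt, one_mul, neg_one_mul, mul_neg, Units.neg_smul, mul_comm,
      add_neg_cancel]
  · rw [if_pos h, if_neg h.not_gt, one_mul, neg_one_mul, mul_neg, Units.neg_smul, mul_comm,
      neg_add_cancel]

theorem anticomm_self (j : Fin m) (d : Fin m → ℤ) (z : Fin m → E)
    (hz : D (H (z j)) + H (D (z j)) = z j) :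
    Int.negOnePow (∑ k ∈ Finset.Iio j, d k) •
        Int.negOnePow (∑ k ∈ Finset.Iio j, Function.update d j (d j + 1) k) •
          c (Function.update (Function.update d j (d j + 1)) j
              (Function.update d j (d j + 1) j - 1))
            (Function.update (Function.update z j (H (z j))) j
              (D (Function.update z j (H (z j)) j))) +
      Int.negOnePow (∑ k ∈ Finset.Iio j, d k) •
        Int.negOnePow (∑ k ∈ Finset.Iio j, Function.update d j (d j - 1) k) •
          c (Function.update (Function.update d j (d j - 1)) j
              (Function.update d j (d j - 1) j + 1))
            (Function.update (Function.update z j (D (z j))) j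
              (H (Function.update z j (D (z j)) j))) = c d z := by
  rw [negOnePow_sum_update d j j (by simp), negOnePow_sum_update d j j (by simp),
    if_neg (lt_irrefl j), one_mul, smul_smul, smul_smul, Int.units_mul_self, one_smul, one_smul]
  simp only [Function.update_self, Function.update_idem, add_sub_cancel_right, sub_add_cancel,
    Function.update_eq_self]
  rw [← MultilinearMap.map_update_add, hz, Function.update_eq_self]

end

namespace LInfData

variable (L : LInfData 𝕜 V) (L' : LInfData 𝕜 W)

/-- The homotopy `0 ⊕ h` on `L ⊕ P(L')`. -/
def middleHtpy (_L : LInfData 𝕜 V) (L' : LInfData 𝕜 W) : V × L'.Path →ₗ[𝕜] V × L'.Path :=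
  LinearMap.inr 𝕜 V L'.Path ∘ₗ L'.pathHtpy ∘ₗ LinearMap.snd 𝕜 V L'.Path

/-- The projection of `L ⊕ P(L')` to the summand from which `mixed` takes the letter `i`. -/
def mixedProj (_L : LInfData 𝕜 V) (L' : LInfData 𝕜 W) {m : ℕ} (T : Finset (Fin m)) (i : Fin m) :
    V × L'.Path →ₗ[𝕜] V × L'.Path :=
  if i ∈ T then LinearMap.inr 𝕜 V L'.Path ∘ₗ LinearMap.snd 𝕜 V L'.Path
  else LinearMap.inl 𝕜 V L'.Path ∘ₗ LinearMap.fst 𝕜 V L'.Path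

variable {L L'} {m : ℕ}

theorem mixed_apply (T : Finset (Fin m)) (x : Fin m → V × L'.Path) (i : Fin m) :
    L.mixed L' T x i = L.mixedProj L' T i (x i) := by
  by_cases h : i ∈ T <;> simp [mixed, mixedProj, h]

theorem diff_mixedProj (T : Finset (Fin m)) (i : Fin m) (y : V × L'.Path) :
    (L.middle L').diff (L.mixedProj L' T i y) = L.mixedProj L' T i ((L.middle L').diff y) := by
  by_cases h : i ∈ T <;> simp [mixedProj, h, middle_diff]

theorem mixed_update_diff (T : Finset (Fin m)) (x : Fin m → V × L'.Path) (i : Fin m) :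
    L.mixed L' T (Function.update x i ((L.middle L').diff (x i))) =
      Function.update (L.mixed L' T x) i ((L.middle L').diff (L.mixed L' T x i)) := by
  ext1 j
  rw [mixed_apply, mixed_apply]
  by_cases h : j = i
  · subst h; rw [Function.update_self, Function.update_self, diff_mixedProj]
  · rw [Function.update_of_ne h, Function.update_of_ne h, mixed_apply]

theorem middleHtpy_mixed {T : Finset (Fin m)} {i : Fin m} (hi : i ∈ T) (x : Fin m → V × L'.Path) :
    L.middleHtpy L' (L.mixed L' T x i) = (0, L'.pathHtpy (x i).2) := by
  simp [middleHtpy, mixed, hi]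

theorem diff_middleHtpy_add {T : Finset (Fin m)} {i : Fin m} (hi : i ∈ T)
    (x : Fin m → V × L'.Path) :
    (L.middle L').diff (L.middleHtpy L' (L.mixed L' T x i)) +
      L.middleHtpy L' ((L.middle L').diff (L.mixed L' T x i)) = L.mixed L' T x i := by
  have := pathDiff_pathHtpy_add (x i).2
  simp [middleHtpy, mixed, hi, middle_diff, this]

theorem compHtpy_eq (c : (Fin m → ℤ) → (Fin m → V × L'.Path) → W) (d : Fin m → ℤ)
    (x : Fin m → V × L'.Path) :
    L.compHtpy L' c d x = ∑ T : Finset (Fin m), ((T.card : 𝕜)⁻¹) •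
      ∑ i ∈ T, Int.negOnePow (∑ j ∈ Finset.Iio i, d j) • c (Function.update d i (d i + 1))
        (Function.update (L.mixed L' T x) i (L.middleHtpy L' (L.mixed L' T x i))) := by
  rw [compHtpy]
  refine Finset.sum_congr rfl fun T _ => ?_
  congr 1
  refine Finset.sum_congr rfl fun i hi => ?_
  rw [middleHtpy_mixed hi]

/-- The splitting of `S^m(sL ⊕ sP(L'))`. -/
theorem sum_mixed (c : MultilinearMap 𝕜 (fun _ : Fin m => V × L'.Path) W)
    (x : Fin m → V × L'.Path) : c x = ∑ T : Finset (Fin m), c (L.mixed L' T x) := by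
  have h : x = (fun i => ((0 : V), (x i).2)) + fun i => ((x i).1, 0) := by
    ext i <;> simp
  conv_lhs => rw [h, c.map_add_univ]
  refine Finset.sum_congr rfl fun T _ => ?_
  refine congrArg c (funext fun i => ?_)
  by_cases hi : i ∈ T <;> simp [mixed, hi]

/-- The homotopy formula for `H`: composition with `δ₁ H + H δ₁` removes the component in which all
letters belong to `L`. -/
theorem compHtpy_homotopy [CharZero 𝕜]
    (c : (Fin m → ℤ) → MultilinearMap 𝕜 (fun _ : Fin m => V × L'.Path) W) (d : Fin m → ℤ)
    (x : Fin m → V × L'.Path) :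
    L.compHtpy L' (fun d y => ∑ i, Int.negOnePow (∑ j ∈ Finset.Iio i, d j) •
        c (Function.update d i (d i - 1)) (Function.update y i ((L.middle L').diff (y i)))) d x +
      ∑ i, Int.negOnePow (∑ j ∈ Finset.Iio i, d j) •
        L.compHtpy L' (fun d y => c d y) (Function.update d i (d i - 1))
          (Function.update x i ((L.middle L').diff (x i))) =
      c d x - c d (L.mixed L' ∅ x) := by
  simp only [compHtpy_eq, mixed_update_diff, Finset.smul_sum]
  rw [Finset.sum_comm (s := Finset.univ) (t := (Finset.univ : Finset (Finset (Fin m)))),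
    ← Finset.sum_add_distrib, sum_mixed (L := L) (c d) x,
    ← Finset.sum_erase_add _ _ (Finset.mem_univ (∅ : Finset (Fin m))),
    ← Finset.sum_erase_add _ _ (Finset.mem_univ (∅ : Finset (Fin m)))]
  rw [add_sub_cancel_right]
  simp only [Finset.sum_empty, Finset.sum_const_zero, add_zero]
  refine Finset.sum_congr rfl fun T hT => ?_
  have hT0 : (T.card : 𝕜) ≠ 0 := by simpa using hT
  rw [Finset.sum_comm (s := Finset.univ) (t := T), ← Finset.sum_add_distrib]
  simp only [smul_comm (_ : ℤˣ) (_ : 𝕜), ← Finset.smul_sum, ← smul_add]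
  refine Eq.trans (congrArg ((T.card : 𝕜)⁻¹ • ·) (Finset.sum_congr rfl fun j hj =>
    (?_ : _ = c d (L.mixed L' T x)))) ?_
  · rw [Finset.smul_sum, ← Finset.sum_add_distrib, Finset.sum_eq_single j]
    · exact anticomm_self c _ _ j d _ (diff_middleHtpy_add hj x)
    · exact fun i _ hij => anticomm_of_ne c _ _ hij d _
    · simp
  · rw [Finset.sum_const, ← Nat.cast_smul_eq_nsmul 𝕜, smul_smul, inv_mul_cancel₀ hT0, one_smul]

end LInfData

end

/-! ### The symmetrized homotopy on symmetric families -/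

section

variable {𝕜 V W : Type*} [Field 𝕜] [AddCommGroup V] [Module 𝕜 V] [AddCommGroup W] [Module 𝕜 W]

namespace LInfData

variable {L : LInfData 𝕜 V} {L' : LInfData 𝕜 W}

section

variable {m : ℕ}

theorem Homog.mixed {d : Fin m → ℤ} {x : Fin m → V × L'.Path} (hx : (L.middle L').Homog d x)
    (T : Finset (Fin m)) : (L.middle L').Homog d (L.mixed L' T x) := by
  intro i
  by_cases h : i ∈ T
  · simp only [LInfData.mixed, h, if_true]
    exact ⟨zero_mem _, (hx i).2⟩
  · simp only [LInfData.mixed, h, if_false]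
    exact ⟨(hx i).1, zero_mem _⟩

theorem middleHtpy_mem {i : ℤ} {y : V × L'.Path} (hy : y ∈ (L.middle L').susp i) :
    L.middleHtpy L' y ∈ (L.middle L').susp (i + 1) := by
  refine ⟨zero_mem _, ?_⟩
  rw [add_sub_right_comm]
  exact pathHtpy_mem hy.2

theorem Homog.update_middleHtpy {d : Fin m → ℤ} {x : Fin m → V × L'.Path}
    (hx : (L.middle L').Homog d x) (i : Fin m) :
    (L.middle L').Homog (Function.update d i (d i + 1))
      (Function.update x i (L.middleHtpy L' (x i))) :=
  hx.update i (middleHtpy_mem (hx i))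

theorem compHtpy_congr {c c' : (Fin m → ℤ) → (Fin m → V × L'.Path) → W}
    (h : ∀ d x, (L.middle L').Homog d x → c d x = c' d x) {d : Fin m → ℤ}
    {x : Fin m → V × L'.Path} (hx : (L.middle L').Homog d x) :
    L.compHtpy L' c d x = L.compHtpy L' c' d x := by
  simp only [compHtpy_eq]
  refine Finset.sum_congr rfl fun T _ => ?_
  congr 1
  exact Finset.sum_congr rfl fun i _ => by rw [h _ _ ((hx.mixed T).update_middleHtpy i)]

theorem map_compHtpy (g : W →ₗ[𝕜] W) (c : (Fin m → ℤ) → (Fin m → V × L'.Path) → W)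
    (d : Fin m → ℤ) (x : Fin m → V × L'.Path) :
    g (L.compHtpy L' c d x) = L.compHtpy L' (fun d x => g (c d x)) d x := by
  simp only [compHtpy, map_sum, map_smul, Units.smul_def, map_zsmul]

theorem compHtpy_mem {c : (Fin m → ℤ) → (Fin m → V × L'.Path) → W} {e : ℤ}
    (hc : ∀ d x, (L.middle L').Homog d x → c d x ∈ L'.susp (∑ i, d i + e)) {d : Fin m → ℤ}
    {x : Fin m → V × L'.Path} (hx : (L.middle L').Homog d x) :
    L.compHtpy L' c d x ∈ L'.susp (∑ i, d i + (e + 1)) := by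
  rw [compHtpy_eq]
  refine Submodule.sum_mem _ fun T _ => Submodule.smul_mem _ _ (Submodule.sum_mem _ fun i _ =>
    units_smul_mem _ _ ?_)
  have := hc _ _ ((hx.mixed T).update_middleHtpy i)
  rw [Finset.sum_update_of_mem (Finset.mem_univ i), Finset.sdiff_singleton_eq_erase] at this
  rw [← Finset.add_sum_erase _ d (Finset.mem_univ i)]
  convert this using 2
  ring

theorem compHtpy_eq_koszulSign_smul {c : (Fin m → ℤ) → (Fin m → V × L'.Path) → W}
    (hc : ∀ d x, (L.middle L').Homog d x → ∀ σ : Equiv.Perm (Fin m),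
      c d x = koszulSign σ.symm d • c (d ∘ σ) (x ∘ σ)) {d : Fin m → ℤ}
    {x : Fin m → V × L'.Path} (hx : (L.middle L').Homog d x) (σ : Equiv.Perm (Fin m)) :
    L.compHtpy L' c d x = koszulSign σ.symm d • L.compHtpy L' c (d ∘ σ) (x ∘ σ) := by
  rw [compHtpy_eq, compHtpy_eq, Finset.smul_sum]
  refine Finset.sum_equiv (Equiv.finsetCongr σ.symm) (by simp) fun T _ => ?_
  have hcard : (Equiv.finsetCongr σ.symm T).card = T.card := by simp
  rw [hcard, smul_comm (koszulSign σ.symm d) (_ : 𝕜)]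
  refine congrArg ((T.card : 𝕜)⁻¹ • ·) ?_
  rw [Finset.smul_sum]
  refine Finset.sum_equiv σ.symm (fun i => by simp) fun i _ => ?_
  have hmix : L.mixed L' (Equiv.finsetCongr σ.symm T) (x ∘ σ) = L.mixed L' T x ∘ σ := by
    ext1 j
    have : j ∈ Equiv.finsetCongr σ.symm T ↔ σ j ∈ T := by simp
    simp only [mixed, Function.comp_apply, this]
  rw [hmix, hc _ _ ((hx.mixed T).update_middleHtpy i) σ, Function.update_comp_equiv,
    Function.update_comp_equiv, Function.comp_apply, Function.comp_apply, Equiv.apply_symm_apply,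
    smul_smul, smul_smul]
  congr 1
  have h := koszulSign_update σ d i
  have hu : ∀ u : ℤˣ, u * u = 1 := Int.units_mul_self
  set a := koszulSign σ.symm d
  set b := koszulSign σ.symm (Function.update d i (d i + 1))
  calc _ = a * a * (Int.negOnePow (∑ j ∈ Finset.Iio i, d j) * b) := by rw [hu, one_mul]
    _ = a * (a * Int.negOnePow (∑ j ∈ Finset.Iio i, d j)) * b := by simp only [mul_assoc]
    _ = _ := by rw [← h, mul_assoc, mul_assoc, hu, mul_one]

/-- `compHtpy`, for a family of multilinear maps, as a multilinear map for fixed degrees. -/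
noncomputable def compHtpyMap (L : LInfData 𝕜 V) (L' : LInfData 𝕜 W)
    (c : (Fin m → ℤ) → MultilinearMap 𝕜 (fun _ : Fin m => V × L'.Path) W) (d : Fin m → ℤ) :
    MultilinearMap 𝕜 (fun _ : Fin m => V × L'.Path) W :=
  ∑ T : Finset (Fin m), ((T.card : 𝕜)⁻¹) • ∑ i ∈ T, Int.negOnePow (∑ j ∈ Finset.Iio i, d j) •
    (c (Function.update d i (d i + 1))).compLinearMap
      (Function.update (L.mixedProj L' T) i (L.middleHtpy L' ∘ₗ L.mixedProj L' T i))

theorem compHtpyMap_apply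
    (c : (Fin m → ℤ) → MultilinearMap 𝕜 (fun _ : Fin m => V × L'.Path) W) (d : Fin m → ℤ)
    (x : Fin m → V × L'.Path) :
    L.compHtpyMap L' c d x = L.compHtpy L' (fun d x => c d x) d x := by
  rw [compHtpyMap, compHtpy_eq, sum_apply]
  refine Finset.sum_congr rfl fun T _ => ?_
  rw [smul_apply, sum_apply]
  congr 1
  refine Finset.sum_congr rfl fun i _ => ?_
  rw [smul_apply, MultilinearMap.compLinearMap_apply]
  congr 2
  ext1 j
  by_cases h : j = i
  · subst h
    rw [Function.update_self, Function.update_self, LinearMap.comp_apply, mixed_apply]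
  · rw [Function.update_of_ne h, Function.update_of_ne h, mixed_apply]

end

/-! ### The obstruction -/

/-- `obstruction` as a multilinear map, for fixed degrees. -/
noncomputable def obstructionMap (L : LInfData 𝕜 V) (L' : LInfData 𝕜 W) (Φ : StructMaps 𝕜 V W)
    {m : ℕ} (d : Fin m → ℤ) : MultilinearMap 𝕜 (fun _ : Fin m => V) W :=
  ∑ k ∈ Finset.Icc 1 (m - 1), Φ.coderMap L.δ k d - ∑ k ∈ Finset.Icc 2 m, L'.δ.morphMap Φ k d

theorem obstructionMap_apply (Φ : StructMaps 𝕜 V W) {m : ℕ} (d : Fin m → ℤ) (x : Fin m → V) :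
    L.obstructionMap L' Φ d x = L.obstruction L' Φ d x := by
  simp only [obstructionMap, obstruction, sub_apply, sum_apply, StructMaps.morphMap_apply,
    StructMaps.coderMap_apply]

theorem obstruction_congr {F G : StructMaps 𝕜 V W} {m : ℕ} (h : ∀ k < m, F k = G k)
    (d : Fin m → ℤ) (x : Fin m → V) : L.obstruction L' F d x = L.obstruction L' G d x := by
  rw [obstruction, obstruction]
  congr 1
  · refine Finset.sum_congr rfl fun k hk => StructMaps.coderTerm_congr _ (h k ?_) d x
    rw [Finset.mem_Icc] at hk
    omega
  · refine Finset.sum_congr rfl fun k hk => StructMaps.morphTerm_congr _ (fun j _ hj => h j ?_) d x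
    exact hj (Finset.mem_Icc.1 hk).1

theorem defect_congr {F G : StructMaps 𝕜 V W} {m : ℕ} (h : ∀ k ≤ m, F k = G k)
    (d : Fin m → ℤ) (x : Fin m → V) : L.defect L' F d x = L.defect L' G d x := by
  rw [defect_apply, defect_apply]
  congr 1
  · exact Finset.sum_congr rfl fun k _ => StructMaps.morphTerm_congr _ (fun j hj _ => h j hj) d x
  · exact Finset.sum_congr rfl fun k hk =>
      StructMaps.coderTerm_congr _ (h k (Finset.mem_Icc.1 hk).2) d x

/-- The obstruction consists of those terms of the defect which do not involve `F_m`. -/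
theorem defect_eq_sub_obstruction (F : StructMaps 𝕜 V W) {m : ℕ} (hm : 2 ≤ m) (d : Fin m → ℤ)
    (x : Fin m → V) : L.defect L' F d x =
      L'.diff (F m x) - F.coderTerm L.δ m d x - L.obstruction L' F d x := by
  rw [defect_apply, obstruction, ← Finset.add_sum_Ioc_eq_sum_Icc (show 1 ≤ m by omega),
    StructMaps.morphTerm_one _ _ (by omega)]
  have h1 : Finset.Ioc 1 m = Finset.Icc 2 m := rfl
  obtain ⟨n, rfl⟩ : ∃ n, m = n + 1 := ⟨m - 1, by omega⟩
  rw [h1, Finset.sum_Icc_succ_top (f := fun k => F.coderTerm L.δ k d x) (by omega),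
    Nat.add_sub_cancel]
  change L'.diff _ + _ - _ = _
  abel

theorem obstruction_mem (hL : L.IsGradedSymmetric L (-1) L.δ)
    (hL' : L'.IsGradedSymmetric L' (-1) L'.δ) {F : StructMaps 𝕜 V W}
    (hF : L.IsGradedSymmetric L' 0 F) {m : ℕ} {d : Fin m → ℤ} {x : Fin m → V} (hx : L.Homog d x) :
    L.obstruction L' F d x ∈ L'.susp (∑ i, d i + -1) :=
  sub_mem (Submodule.sum_mem _ fun k _ => coderTerm_mem_susp hF hL k hx)
    (Submodule.sum_mem _ fun k _ => morphTerm_mem_susp hL' hF k hx)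

theorem obstruction_eq_koszulSign_smul (hL : L.IsGradedSymmetric L (-1) L.δ)
    {F : StructMaps 𝕜 V W} (hF : L.IsGradedSymmetric L' 0 F) {m : ℕ} {d : Fin m → ℤ}
    {x : Fin m → V} (hx : L.Homog d x) (σ : Equiv.Perm (Fin m)) :
    L.obstruction L' F d x = koszulSign σ.symm d • L.obstruction L' F (d ∘ σ) (x ∘ σ) := by
  simp only [obstruction, smul_sub, Finset.smul_sum]
  congr 1
  · exact Finset.sum_congr rfl fun k _ => coderTerm_eq_koszulSign_smul hF hL k hx σ
  · exact Finset.sum_congr rfl fun k _ => morphTerm_eq_koszulSign_smul _ hF k hx σ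

/-- Multilinear maps which agree on homogeneous arguments are equal. -/
theorem ext_of_homog (hL : DirectSum.IsInternal L.deg) {m : ℕ}
    {f g : MultilinearMap 𝕜 (fun _ : Fin m => V) W} (h : ∀ d x, L.Homog d x → f x = g x) :
    f = g := by
  refine MultilinearMap.ext fun u => MultilinearMap.eq_of_eqOn_span
    (S := {x | ∃ i, x ∈ L.susp i}) (fun z hz => ?_) u fun i => ?_
  · choose d hd using hz
    exact h d z hd
  · have htop : (⊤ : Submodule 𝕜 V) ≤ Submodule.span 𝕜 {x | ∃ i, x ∈ L.susp i} := by
      rw [← hL.submodule_iSup_eq_top]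
      refine iSup_le fun i x hx => Submodule.subset_span ⟨i + 1, ?_⟩
      rwa [susp, add_sub_cancel_right]
    exact htop trivial

theorem IsGradedSymmetric.truncate {e : ℤ} {F : StructMaps 𝕜 V W} {m : ℕ} (h0 : F 0 = 0)
    (hs : ∀ k < m, L.IsSymmMap (F k)) (hd : ∀ k < m, L.IsDegMap L' e (F k)) :
    L.IsGradedSymmetric L' e (fun k => if k < m then F k else 0) where
  zero := by simp [h0]
  degree k d x hx := by
    split_ifs with hk
    · exact hd k hk d x hx
    · exact zero_mem _
  symm k d x hx σ := by
    split_ifs with hk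
    · exact hs k hk d x hx σ
    · simp

theorem IsMorphism.diff_linPart {F : StructMaps 𝕜 V W} (hF : L.IsMorphism L' F) {i : ℤ} {x : V}
    (hx : x ∈ L.susp i) :
    L'.diff (F.linPart x) = F.linPart (L.diff x) := by
  have := hF.dgmap 1 le_rfl (fun _ => i) (fun _ => x) fun _ => hx
  rwa [Finset.Icc_self, Finset.sum_singleton, Finset.sum_singleton,
    StructMaps.morphTerm_one _ _ le_rfl,
    StructMaps.coderTerm_one] at this

theorem IsLInfAlgebra.diff_diff (hL : L.IsLInfAlgebra) {i : ℤ} {x : V} (hx : x ∈ L.susp i) :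
    L.diff (L.diff x) = 0 := by
  have := hL.codiff 1 le_rfl (fun _ => i) (fun _ => x) fun _ => hx
  rwa [Finset.Icc_self, Finset.sum_singleton, StructMaps.coderTerm_one] at this

/-- The obstruction vanishes for a strict morphism. -/
theorem IsMorphism.obstruction_eq_zero {f : StructMaps 𝕜 V W} (hf : L.IsMorphism L' f)
    (hs : f.IsStrict) {m : ℕ} (hm : 2 ≤ m) {d : Fin m → ℤ} {x : Fin m → V} (hx : L.Homog d x) :
    L.obstruction L' f d x = 0 := by
  have h := defect_eq_sub_obstruction (L := L) (L' := L') f hm d x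
  have h1 : f.coderTerm L.δ m d x = 0 := by
    rw [StructMaps.coderTerm_congr (G := 0) L.δ (hs m hm), StructMaps.coderTerm]
    simp
  rw [defect_apply, hf.dgmap m (by omega) d x hx, hs m hm, zero_apply, map_zero, h1] at h
  simpa using h.symm

end LInfData

end

/-! ### The fibration -/

section

variable {𝕜 V W : Type*} [Field 𝕜] [AddCommGroup V] [Module 𝕜 V] [AddCommGroup W] [Module 𝕜 W]

/-- Dependent sequences may be defined by course-of-values recursion; the values which are not yet
defined are replaced by zero. -/
theorem exists_eq_step {β : ℕ → Type*} [∀ k, Zero (β k)] (step : ∀ m, (∀ k, β k) → β m) :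
    ∃ Φ : ∀ k, β k, ∀ m, Φ m = step m fun k => if k < m then Φ k else 0 := by
  refine ⟨fun m => Nat.strongRecOn m fun m ih => step m fun k => if h : k < m then ih k h else 0,
    fun m => ?_⟩
  beta_reduce
  rw [Nat.strongRecOn_eq]
  congr 1

namespace LInfData

variable {L : LInfData 𝕜 V} {L' : LInfData 𝕜 W} {f : StructMaps 𝕜 V W}

/-- The recursive description of the structure maps of the fibration `L ⊕ P(L') → L'`. -/
structure IsRecursiveLift (L : LInfData 𝕜 V) (L' : LInfData 𝕜 W) (f : StructMaps 𝕜 V W)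
    (Φ : StructMaps 𝕜 (V × L'.Path) W) : Prop where
  zero : Φ 0 = 0
  one : Φ 1 = StructMaps.ofLinear (L.linProj L' f) 1
  eq_neg_compHtpy : ∀ m, 2 ≤ m → ∀ (d : Fin m → ℤ) (x : Fin m → V × L'.Path),
    (L.middle L').Homog d x → Φ m x = -L.compHtpy L' ((L.middle L').obstruction L' Φ) d x

theorem exists_isRecursiveLift (hL : L.IsLInfAlgebra) (hL' : L'.IsLInfAlgebra)
    (f : StructMaps 𝕜 V W) : ∃ Φ, L.IsRecursiveLift L' f Φ := by
  have hK := isLInfAlgebra_middle hL hL'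
  choose ext hext using fun (m : ℕ)
    (T : (Fin m → ℤ) → MultilinearMap 𝕜 (fun _ : Fin m => V × L'.Path) W) =>
    exists_eq_on_homog hK.internal T
  obtain ⟨Φ, hΦ⟩ := exists_eq_step
    (β := fun m => MultilinearMap 𝕜 (fun _ : Fin m => V × L'.Path) W) fun m F =>
      match m with
      | 0 => 0
      | 1 => StructMaps.ofLinear (L.linProj L' f) 1
      | m + 2 => ext (m + 2) fun d => -L.compHtpyMap L' ((L.middle L').obstructionMap L' F) d
  refine ⟨Φ, hΦ 0, hΦ 1, fun m hm d x hx => ?_⟩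
  obtain ⟨n, rfl⟩ := Nat.exists_eq_add_of_le' hm
  rw [hΦ, hext _ _ d x hx, neg_apply, compHtpyMap_apply]
  congr 2
  ext d x
  rw [obstructionMap_apply]
  exact obstruction_congr (fun k hk => if_pos hk) d x

namespace IsRecursiveLift

variable {Φ : StructMaps 𝕜 (V × L'.Path) W}

theorem linPart_eq (hΦ : L.IsRecursiveLift L' f Φ) : Φ.linPart = L.linProj L' f := by
  rw [StructMaps.linPart, hΦ.one]
  rfl

/-- The lift extends `f`. -/
theorem apply_inl (hΦ : L.IsRecursiveLift L' f Φ) (hL : DirectSum.IsInternal L.deg)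
    (hf0 : f 0 = 0) (hs : f.IsStrict) {m : ℕ} (v : Fin m → V) :
    Φ m (fun i => (v i, 0)) = f m v := by
  have : (Φ m).compLinearMap (fun _ => LinearMap.inl 𝕜 V L'.Path) = f m := by
    refine ext_of_homog hL fun d v hv => ?_
    change Φ m (fun i => (v i, 0)) = f m v
    match m with
    | 0 => rw [hΦ.zero, hf0, zero_apply, zero_apply]
    | 1 =>
      rw [hΦ.one]
      have h0 : L'.pathProj 0 = 0 := map_zero _
      simp [StructMaps.ofLinear, linProj, StructMaps.linPart]
      congr 1
      ext i
      rw [Subsingleton.elim i 0]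
    | m + 2 =>
      rw [hΦ.eq_neg_compHtpy _ (by omega) d (fun i => (v i, 0)) fun i => ⟨hv i, zero_mem _⟩,
        hs _ (by omega),
        zero_apply, neg_eq_zero, compHtpy]
      refine Finset.sum_eq_zero fun T _ => ?_
      rw [Finset.sum_eq_zero, smul_zero]
      intro i _
      rw [← obstructionMap_apply, MultilinearMap.map_coord_zero _ i, smul_zero]
      rw [Function.update_self]
      simp
  rw [← this]
  rfl

theorem obstruction_inl (hΦ : L.IsRecursiveLift L' f Φ) (hL : DirectSum.IsInternal L.deg)
    (hf0 : f 0 = 0) (hs : f.IsStrict) {m : ℕ} (d : Fin m → ℤ) (v : Fin m → V) :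
    (L.middle L').obstruction L' Φ d (fun i => (v i, 0)) = L.obstruction L' f d v := by
  have hδ : ∀ {k : ℕ} (v : Fin k → V),
      (L.middle L').δ k (fun i => (v i, 0)) = (L.δ k v, 0) := fun {k} v => by
    refine Prod.ext (middle_δ_fst _ _) ?_
    by_cases hk : k = 1
    · subst hk
      rw [middle_δ_one_snd]
      exact map_zero _
    · rw [middle_δ_snd_of_ne hk]
  rw [obstruction, obstruction]
  congr 1
  · refine Finset.sum_congr rfl fun k _ => Finset.sum_congr rfl fun B _ => ?_
    congr 1
    rw [← hΦ.apply_inl hL hf0 hs]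
    congr 1
    ext1 i
    cases i using Fin.cases with
    | zero => exact hδ _
    | succ i => rfl
  · refine Finset.sum_congr rfl fun k _ => ?_
    rw [StructMaps.morphTerm, StructMaps.morphTerm]
    congr 1
    refine Finset.sum_congr rfl fun c _ => ?_
    congr 2
    ext1 a
    exact hΦ.apply_inl hL hf0 hs _

theorem linProj_mem (hL' : L'.IsGradedSymmetric L' (-1) L'.δ) (hf : L.IsGradedSymmetric L' 0 f)
    (i : ℤ) (x : V × L'.Path) (hx : x ∈ (L.middle L').deg i) :
    L.linProj L' f x ∈ L'.deg (i + 0) := by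
  have h1 : f.linPart x.1 ∈ L'.deg (i + 0) := by
    have := hf.diff_mem (i := i + 1) (x := x.1) (by rw [susp, add_sub_cancel_right]; exact hx.1)
    rw [susp, add_right_comm, add_sub_cancel_right] at this
    exact this
  have h2 : (x.2.1 : W) ∈ L'.deg (i + 0) := by rw [add_zero]; exact hx.2.1
  have h3 : L'.diff x.2.2 ∈ L'.deg (i + 0) := by
    have := hL'.diff_mem (i := i + 1 + 1) (x := (x.2.2 : W))
      (by rw [susp, add_sub_cancel_right]; exact hx.2.2)
    rw [susp, show i + 1 + 1 + -1 - 1 = i + 0 by ring] at this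
    exact this
  exact add_mem h1 (add_mem h2 h3)

theorem diff_linProj (hL' : L'.IsLInfAlgebra) (hf : L.IsMorphism L' f) {i : ℤ} {x : V × L'.Path}
    (hx : x ∈ (L.middle L').susp i) :
    L'.diff (L.linProj L' f x) = L.linProj L' f ((L.middle L').diff x) := by
  have h1 := hf.diff_linPart hx.1
  have h2 : L'.diff (L'.diff x.2.2) = 0 :=
    hL'.diff_diff (i := i + 1) (by rw [susp, add_sub_right_comm]; exact hx.2.2)
  rw [middle_diff]
  simp [linProj, pathProj, pathDiff, h1, h2]

/-- The inductive step: the homotopy cancels the obstruction. -/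
theorem defect_eq_zero [CharZero 𝕜] (hL : L.IsLInfAlgebra) (hL' : L'.IsLInfAlgebra)
    (hf : L.IsMorphism L' f) (hs : f.IsStrict) (hΦ : L.IsRecursiveLift L' f Φ) {m : ℕ} (hm : 2 ≤ m)
    (hF : (L.middle L').IsGradedSymmetric L' 0 fun k => if k < m then Φ k else 0)
    (hF' : (L.middle L').IsGradedSymmetric L' 0 fun k => if k < m + 1 then Φ k else 0)
    (hE : ∀ j, 1 ≤ j → j < m → ∀ (d : Fin j → ℤ) (x : Fin j → V × L'.Path),
      (L.middle L').Homog d x → (L.middle L').defect L' Φ d x = 0)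
    {d : Fin m → ℤ} {x : Fin m → V × L'.Path} (hx : (L.middle L').Homog d x) :
    (L.middle L').defect L' Φ d x = 0 := by
  have hK := isLInfAlgebra_middle hL hL'
  set F : StructMaps 𝕜 (V × L'.Path) W := fun k => if k < m then Φ k else 0 with hFdef
  set c : (Fin m → ℤ) → MultilinearMap 𝕜 (fun _ : Fin m => V × L'.Path) W :=
    (L.middle L').obstructionMap L' Φ with hc
  have hFm : F m = 0 := if_neg (lt_irrefl m)
  have hcF : ∀ d x, (L.middle L').defect L' F (m := m) d x = -c d x := by
    intro d x
    rw [defect_eq_sub_obstruction F hm, hFm, zero_apply, map_zero,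
      StructMaps.coderTerm_congr (G := 0) _ hFm, obstruction_congr (G := Φ) fun k hk => if_pos hk,
      hc, obstructionMap_apply, StructMaps.coderTerm]
    simp
  -- the obstruction is a cocycle
  have hcoc : ∀ d x, (L.middle L').Homog d x → (-L'.diff) (c d x) =
      ∑ i, Int.negOnePow (∑ j ∈ Finset.Iio i, d j) • c (Function.update d i (d i - 1))
        (Function.update x i ((L.middle L').diff (x i))) := by
    intro d x hx
    have := linearized_defect hK hL' hF (by omega) (fun j hj hjm d x hx => by
      rw [defect_congr (G := Φ) fun k hk => if_pos (by omega)]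
      exact hE j hj hjm d x hx) hx
    simp only [hcF, smul_neg, Finset.sum_neg_distrib, map_neg] at this
    rw [LinearMap.neg_apply]
    exact add_neg_eq_zero.1 this
  have hΦm : ∀ d x, (L.middle L').Homog d x → Φ m x = -L.compHtpy L' (fun d x => c d x) d x := by
    intro d x hx
    rw [hΦ.eq_neg_compHtpy m hm d x hx]
    simp only [hc, obstructionMap_apply]
  have hcod : Φ.coderTerm (L.middle L').δ m d x = ∑ i, Int.negOnePow (∑ j ∈ Finset.Iio i, d j) •
      Φ m (Function.update x i ((L.middle L').diff (x i))) := by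
    have := coderTerm_self hF' hK.symmetric hx
    rw [StructMaps.coderTerm_congr (G := Φ) _ (if_pos (Nat.lt_succ_self m))] at this
    simpa using this
  have hmix : c d (L.mixed L' ∅ x) = 0 := by
    have : L.mixed L' ∅ x = fun i => ((x i).1, 0) := by ext1 i; simp [mixed]
    rw [this, hc, obstructionMap_apply, hΦ.obstruction_inl hL.internal hf.symmetric.zero hs]
    exact hf.obstruction_eq_zero hs hm fun i => (hx i).1
  have h1 : L'.diff (Φ m x) = L.compHtpy L' (fun d y => ∑ i,
      Int.negOnePow (∑ j ∈ Finset.Iio i, d j) • c (Function.update d i (d i - 1))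
        (Function.update y i ((L.middle L').diff (y i)))) d x := by
    rw [hΦm d x hx, map_neg, ← LinearMap.neg_apply, map_compHtpy]
    exact compHtpy_congr hcoc hx
  have h2 : ∀ i, Φ m (Function.update x i ((L.middle L').diff (x i))) =
      -L.compHtpy L' (fun d x => c d x) (Function.update d i (d i - 1))
        (Function.update x i ((L.middle L').diff (x i))) := fun i =>
    hΦm _ _ (hx.update i (hK.symmetric.diff_mem (hx i)))
  have h3 := compHtpy_homotopy (L := L) c d x
  rw [hmix, sub_zero] at h3
  rw [defect_eq_sub_obstruction Φ hm, ← obstructionMap_apply, ← hc, hcod, h1]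
  simp only [h2, smul_neg, Finset.sum_neg_distrib, sub_neg_eq_add]
  rw [h3, sub_self]

theorem isMorphism [CharZero 𝕜] (hL : L.IsLInfAlgebra) (hL' : L'.IsLInfAlgebra)
    (hf : L.IsMorphism L' f) (hs : f.IsStrict) (hΦ : L.IsRecursiveLift L' f Φ) :
    (L.middle L').IsMorphism L' Φ := by
  have hK := isLInfAlgebra_middle hL hL'
  have hlin : (L.middle L').IsGradedSymmetric L' 0 (StructMaps.ofLinear (L.linProj L' f)) :=
    isGradedSymmetric_ofLinear (linProj_mem hL'.symmetric hf.symmetric)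
  have key : ∀ m, ((L.middle L').IsSymmMap (Φ m) ∧ (L.middle L').IsDegMap L' 0 (Φ m)) ∧
      (1 ≤ m → ∀ (d : Fin m → ℤ) (x : Fin m → V × L'.Path), (L.middle L').Homog d x →
        (L.middle L').defect L' Φ d x = 0) := by
    intro m
    induction m using Nat.strong_induction_on with
    | _ m ih =>
    match m with
    | 0 =>
      rw [hΦ.zero]
      exact ⟨⟨fun d x _ σ => by simp, fun d x _ => zero_mem _⟩, fun h => absurd h (by omega)⟩
    | 1 =>
      rw [hΦ.one]
      refine ⟨⟨hlin.isSymmMap 1, hlin.isDegMap 1⟩, fun _ d x hx => ?_⟩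
      rw [defect_apply, Finset.Icc_self, Finset.sum_singleton, Finset.sum_singleton,
        StructMaps.morphTerm_one _ _ le_rfl, StructMaps.coderTerm_one, hΦ.linPart_eq, hΦ.one,
        sub_eq_zero]
      have : x = fun _ => x 0 := by
        ext1 i
        rw [Subsingleton.elim i 0]
      rw [this]
      exact diff_linProj hL' hf (hx 0)
    | m + 2 =>
      have hF := IsGradedSymmetric.truncate hΦ.zero (fun k hk => (ih k hk).1.1)
        (fun k hk => (ih k hk).1.2)
      have hc : ∀ d x, (L.middle L').obstruction L' Φ (m := m + 2) d x =
          (L.middle L').obstruction L'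
          (fun k => if k < m + 2 then Φ k else 0) d x := fun d x =>
        obstruction_congr (fun k hk => (if_pos hk).symm) d x
      have hsymm : (L.middle L').IsSymmMap (Φ (m + 2)) := fun d x hx σ => by
        rw [hΦ.eq_neg_compHtpy _ (by omega) d x hx,
          hΦ.eq_neg_compHtpy _ (by omega) _ _ (hx.comp_perm σ), smul_neg,
          compHtpy_eq_koszulSign_smul (fun d x hx σ => ?_) hx σ]
        rw [hc, hc]
        exact obstruction_eq_koszulSign_smul hK.symmetric hF hx σ
      have hdeg : (L.middle L').IsDegMap L' 0 (Φ (m + 2)) := fun d x hx => by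
        rw [hΦ.eq_neg_compHtpy _ (by omega) d x hx, neg_mem_iff]
        refine compHtpy_mem (e := -1) (fun d x hx => ?_) hx
        rw [hc]
        exact obstruction_mem hK.symmetric hL'.symmetric hF hx
      have hF' := IsGradedSymmetric.truncate (m := m + 3) hΦ.zero (e := 0) (L := L.middle L')
        (L' := L') (fun k hk => ?_) (fun k hk => ?_)
      · exact ⟨⟨hsymm, hdeg⟩, fun _ d x hx => defect_eq_zero hL hL' hf hs hΦ (by omega) hF hF'
          (fun j hj hjm => (ih j hjm).2 hj) hx⟩
      · rcases Nat.lt_succ_iff_lt_or_eq.1 hk with hk | rfl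
        · exact (ih k hk).1.1
        · exact hsymm
      · rcases Nat.lt_succ_iff_lt_or_eq.1 hk with hk | rfl
        · exact (ih k hk).1.2
        · exact hdeg
  refine ⟨⟨hΦ.zero, fun m d x hx => (key m).1.2 d x hx, fun m d x hx σ => (key m).1.1 d x hx σ⟩,
    fun m hm d x hx => ?_⟩
  have := (key m).2 hm d x hx
  rwa [defect_apply, sub_eq_zero] at this

theorem isFibration (hΦ : L.IsRecursiveLift L' f Φ) : (L.middle L').IsFibration L' Φ := by
  intro i hi y hy
  have hy' : y ∈ L'.posPart := Submodule.mem_iSup_of_mem i (Submodule.mem_iSup_of_mem hi hy)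
  refine ⟨(0, (⟨y, hy'⟩, 0)), ⟨zero_mem _, hy, zero_mem _⟩, ?_⟩
  rw [hΦ.linPart_eq]
  simp [linProj, pathProj]

theorem compVal_incl [CharZero 𝕜] (hL : L.IsLInfAlgebra) (hL' : L'.IsLInfAlgebra)
    (hf : L.IsMorphism L' f) (hs : f.IsStrict) (hΦ : L.IsRecursiveLift L' f Φ) {m : ℕ} (hm : 1 ≤ m)
    {d : Fin m → ℤ} {x : Fin m → V} (hx : L.Homog d x) :
    Φ.compVal (L.incl L') d x = f m x := by
  rw [StructMaps.compVal, Finset.sum_eq_single m,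
    morphTerm_self (hΦ.isMorphism hL hL' hf hs).symmetric (isMorphism_incl hL hL').symmetric hx]
  · exact hΦ.apply_inl hL.internal hf.symmetric.zero hs x
  · exact fun k _ hk => StructMaps.morphTerm_ofLinear_of_ne _ _ hk d x
  · simp [hm]

end IsRecursiveLift

end LInfData

end

theorem mainTheorem4 {𝕜 : Type*} [Field 𝕜] [CharZero 𝕜] (n : ℕ∞)
    {V W : Type*} [AddCommGroup V] [Module 𝕜 V] [AddCommGroup W] [Module 𝕜 W]
    (L : LInfData 𝕜 V) (L' : LInfData 𝕜 W)
    (hL : L.IsLieAlgebra n) (hL' : L'.IsLieAlgebra n)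
    (f : StructMaps 𝕜 V W) (hf : L.IsMorphism L' f) (hstrict : f.IsStrict) :
    -- `P(L')` is an acyclic complex, contracted by `h`
    ((∀ i, ∀ p ∈ L'.pathDeg i, L'.pathDiff p ∈ L'.pathDeg (i - 1)) ∧
      (∀ i, ∀ p ∈ L'.pathDeg i, L'.pathHtpy p ∈ L'.pathDeg (i + 1)) ∧
      (∀ p, L'.pathDiff (L'.pathDiff p) = 0) ∧
      (∀ p, L'.pathDiff (L'.pathHtpy p) + L'.pathHtpy (L'.pathDiff p) = p)) ∧
    -- the middle object is a Lie `n`-algebra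
    (L.middle L').IsLieAlgebra n ∧
    -- the strict inclusion is a weak equivalence
    L.IsMorphism (L.middle L') (L.incl L') ∧
    (L.incl L').IsStrict ∧
    L.IsWeakEquivalence (L.middle L') (L.incl L') ∧
    -- there is a fibration which completes the factorization, with the stated components
    ∃ φ : StructMaps 𝕜 (V × L'.Path) W,
      (L.middle L').IsMorphism L' φ ∧
      (L.middle L').IsFibration L' φ ∧
      (∀ m, 1 ≤ m → ∀ (d : Fin m → ℤ) (x : Fin m → V), L.Homog d x →
        φ.compVal (L.incl L') d x = f m x) ∧
      φ.linPart = L.linProj L' f ∧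
      (∀ m, 2 ≤ m → ∀ (d : Fin m → ℤ) (x : Fin m → V × L'.Path), (L.middle L').Homog d x →
        φ m x = - L.compHtpy L' ((L.middle L').obstruction L' φ) d x) := by
  have hLA := hL.toIsLInfAlgebra
  have hLA' := hL'.toIsLInfAlgebra
  obtain ⟨Φ, hΦ⟩ := LInfData.exists_isRecursiveLift hLA hLA' f
  exact ⟨⟨fun _ _ => LInfData.pathDiff_mem, fun _ _ => LInfData.pathHtpy_mem,
      LInfData.pathDiff_pathDiff, LInfData.pathDiff_pathHtpy_add⟩,
    LInfData.isLieAlgebra_middle hL hL', LInfData.isMorphism_incl hLA hLA',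
    LInfData.isStrict_incl, LInfData.isWeakEquivalence_incl,
    Φ, hΦ.isMorphism hLA hLA' hf hstrict, hΦ.isFibration,
    fun _ hm _ _ hx => hΦ.compVal_incl hLA hLA' hf hstrict hm hx, hΦ.linPart_eq,
    hΦ.eq_neg_compHtpy⟩
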